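/- Consider a stochastic linear bandit with a nonempty action set $\mathcal A\subseteq\mathbb R^d$ and unknown parameter $\theta^*$, where $\|\theta^*\|_2\le 1$ and $|\langle x,\theta^*\rangle|\le 1$ for all $x\in\mathcal A$. In round $t$ the learner picks $x_t\in\mathcal A$ and observes $y_t=\langle x_t,\theta^*\rangle+\eta_t$, where, given the past and $x_t$, the noise has mean $0$ and satisfies $\mathbb E|\eta_t|^{1+\epsilon}\le\upsilon$, with $\epsilon\in(0,1]$ and $\upsilon>0$ known (independent noise terms with these two properties are a special case). Let $T\ge2$ and let $R_T=\mathbb E\sum_{t=1}^T\big(\sup_{x\in\mathcal A}\langle x,\theta^*\rangle-\langle x_t,\theta^*\rangle\big)$ be the expected regret. **Algorithm MED-PE** on a finite set $\mathcal A_0\subseteq\mathcal A$, with $\gamma=T^{-2\epsilon/(1+\epsilon)}$ and $\beta=1$. For a finite set $\mathcal V$ and a probability distribution $\lambda$ on $\mathcal V$ put $A(\lambda)=\gamma I+\mathbb E_{x\sim\lambda}[xx^\top]$ and $$M(\lambda;\mathcal V)=\max_{a\in\mathcal V}\Big(\mathbb E_{x\sim\lambda}\big[|a^\top A(\lambda)^{-1}x|^{1+\epsilon}\big]+\beta^{1+\epsilon}\big(a^\top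 A(\lambda)^{-1}a\big)^{(1+\epsilon)/2}\Big).$$ Start with $\mathcal A_1=\mathcal A_0$. In phase $\ell=1,2,\dots$, as long as $|\mathcal A_\ell|>1$: choose $\lambda_\ell\in\arg\min_\lambda M(\lambda;\mathcal A_\ell)$ over distributions on $\mathcal A_\ell$, and write $M_\ell$ for the minimum; put $\varepsilon_\ell=2^{-\ell}$, $\delta_\ell=1/(2\ell^2T|\mathcal A_\ell|)$ and $$\tau_\ell=\Big\lceil 32^{\frac{1+\epsilon}{\epsilon}}(1+\upsilon)^{\frac1\epsilon}\varepsilon_\ell^{-\frac{1+\epsilon}{\epsilon}}M_\ell^{\frac1\epsilon}\log(1/\delta_\ell)\Big\rceil;$$ draw $x_1,\dots,x_{\tau_\ell}\sim\lambda_\ell$ independently and observe the rewards $y_1,\dots,y_{\tau_\ell}$; for $a\in\mathcal A_\ell$ put $X^{(a)}_i=a^\top A(\lambda_\ell)^{-1}x_i\,y_i$ and let $$W^{(a)}=\frac1{\tau_\ell}\sum_{i=1}^{\tau_\ell}X^{(a)}_i\,\mathbb 1\Big\{|X^{(a)}_i|\le\Big(\frac{u_\ell\, i}{\log(1/\delta_\ell)}\Big)^{\frac1{1+\epsilon}}\Big\},\qquad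 u_\ell=4(1+\upsilon)M_\ell;$$ choose $\hat\theta_\ell\in\arg\min_\theta\max_{a\in\mathcal A_\ell}|\theta^\top a-W^{(a)}|$ and put $\mathcal A_{\ell+1}=\{a\in\mathcal A_\ell:\hat\theta_\ell^\top a\ge\max_{a'\in\mathcal A_\ell}\hat\theta_\ell^\top a'-4\varepsilon_\ell\}$. Once a single arm remains, it is pulled in all remaining rounds; the algorithm stops after $T$ rounds. The minimizers may be chosen by any (measurable) rule. **Statement.** For $\kappa\in\mathbb N$ call a finite set $\mathcal A_0\subseteq\mathcal A$ a $(T,\kappa)$-cover of $\mathcal A$ if $|\mathcal A_0|\le T^{\kappa d}$ and each $x\in\mathcal A$ has an $a\in\mathcal A_0$ such that $|\langle x-a,\theta\rangle|\le 1/T$ for every $\theta$ with $\|\theta\|_2\le1$ and $\sup_{x'\in\mathcal A}|\langle x',\theta\rangle|\le1$. 1. There is an absolute constant $\kappa$ such that every nonempty $\mathcal A\subseteq\mathbb R^d$ has, for every $T\ge 2$, a $(T,\kappa)$-cover. For every $\kappa$ there is a constant $C$, depending only on $\kappa$, such that for any nonempty action set $\mathcal A$, MED-PE run on any $(T,\kappa)$-cover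 of $\mathcal A$ has regret (with respect to all of $\mathcal A$) $$R_T\le C\,(1+\upsilon)^{\frac1{1+\epsilon}}(\log T)^{\frac{\epsilon}{1+\epsilon}}\,d^{\frac{1+3\epsilon}{2(1+\epsilon)}}\,T^{\frac1{1+\epsilon}}.$$ 2. There is an absolute constant $C$ such that for any finite action set $\mathcal A$ with $|\mathcal A|=n\ge1$, MED-PE run on $\mathcal A$ has regret $$R_T\le C\,(1+\upsilon)^{\frac1{1+\epsilon}}(\log T)^{\frac{\epsilon}{1+\epsilon}}\,\sqrt d\,(\log n)^{\frac{\epsilon}{1+\epsilon}}\,T^{\frac1{1+\epsilon}}.$$ -/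

import Mathlib

open MeasureTheory ProbabilityTheory

namespace HeavyTailBandit

/-- The ambient Euclidean space of the actions and of the unknown parameter. -/
abbrev Vec (d : ℕ) := EuclideanSpace ℝ (Fin d)

/-! ### Experimental design -/

/-- `w` is a probability vector supported on the finite set `V`. -/
def IsDesign {d : ℕ} (V : Finset (Vec d)) (w : Vec d → ℝ) : Prop :=
  (∀ a, 0 ≤ w a) ∧ (∀ a, a ∉ V → w a = 0) ∧ ∑ a ∈ V, w a = 1

/-- `A^(γ)(w) = γ I + E_{x ∼ w}[x xᵀ]`. -/
noncomputable def regCov {d : ℕ} (γ : ℝ) (V : Finset (Vec d)) (w : Vec d → ℝ) :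
    Matrix (Fin d) (Fin d) ℝ :=
  γ • (1 : Matrix (Fin d) (Fin d) ℝ) + ∑ x ∈ V, w x • Matrix.vecMulVec x.ofLp x.ofLp

/-- The bilinear form `aᵀ A^(γ)(w)⁻¹ x`. -/
noncomputable def invForm {d : ℕ} (γ : ℝ) (V : Finset (Vec d)) (w : Vec d → ℝ)
    (a x : Vec d) : ℝ :=
  a.ofLp ⬝ᵥ ((regCov γ V w)⁻¹).mulVec x.ofLp

/-- `M_{1+ε}(w; V, γ, β)`, the maximum over `a ∈ V` of
`E_{x ∼ w}[|aᵀ A⁻¹ x|^{1+ε}] + β^{1+ε} ‖a‖_{A⁻¹}^{1+ε}` with `A = A^(γ)(w)`. -/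
noncomputable def designValue {d : ℕ} (ε γ β : ℝ) (V : Finset (Vec d)) (w : Vec d → ℝ) : ℝ :=
  ⨆ a : {a // a ∈ V},
    (∑ x ∈ V, w x * |invForm γ V w a.1 x| ^ (1 + ε)
      + β ^ (1 + ε) * Real.sqrt (invForm γ V w a.1 a.1) ^ (1 + ε))

/-! ### The algorithm MED-PE -/

/-- The truncated empirical mean of `X 0, …, X (n - 1)` at confidence level `δ`, for samples with
`(1+ε)`-th absolute moment at most `u`.  The `i`-th sample (counted from one) is kept when its
absolute value is at most `(u i / log (1/δ))^{1/(1+ε)}`. -/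
noncomputable def truncMean (ε u δ : ℝ) (n : ℕ) (X : ℕ → ℝ) : ℝ :=
  (1 / (n : ℝ)) * ∑ i ∈ Finset.range n,
    if |X i| ≤ (u * ((i : ℝ) + 1) / Real.log (1 / δ)) ^ (1 / (1 + ε)) then X i else 0

/-- The input of MED-PE. -/
structure Input (d : ℕ) where
  /-- the finite set of arms on which the algorithm runs -/
  actions : Finset (Vec d)
  /-- the ridge parameter -/
  γ : ℝ
  /-- the weight of the regularization term of the design objective -/
  β : ℝ
  /-- the noise has a finite absolute moment of order `1 + ε` -/
  ε : ℝ
  /-- the bound on that moment -/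
  υ : ℝ
  /-- the horizon -/
  T : ℕ

/-- The two selections that the algorithm leaves open: which minimizing design is taken for an
active set, and which minimizing parameter is fitted to the estimated rewards `W`. -/
structure Selection (d : ℕ) where
  design : Finset (Vec d) → Vec d → ℝ
  fit : Finset (Vec d) → (Vec d → ℝ) → Vec d

/-- The selections really are minimizers (and the fit is measurable in the data). -/
structure Selection.IsValid {d : ℕ} (S : Selection d) (I : Input d) : Prop where
  isDesign : ∀ V ⊆ I.actions, V.Nonempty → IsDesign V (S.design V)
  design_le : ∀ V ⊆ I.actions, V.Nonempty → ∀ w, IsDesign V w →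
    designValue I.ε I.γ I.β V (S.design V) ≤ designValue I.ε I.γ I.β V w
  fit_le : ∀ V ⊆ I.actions, V.Nonempty → ∀ (W : Vec d → ℝ) (θ : Vec d),
    (⨆ a : {a // a ∈ V}, |inner ℝ (S.fit V W) a.1 - W a.1|)
      ≤ ⨆ a : {a // a ∈ V}, |inner ℝ θ a.1 - W a.1|
  fit_measurable : ∀ V ⊆ I.actions, V.Nonempty → Measurable (S.fit V)

/-- The optimal value `M_{1+ε}(λ*; V, γ, β)` attained by the selected design. -/
noncomputable def optValue {d : ℕ} (I : Input d) (S : Selection d) (V : Finset (Vec d)) : ℝ :=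
  designValue I.ε I.γ I.β V (S.design V)

/-- The confidence level `1 / (2 ℓ² T |V|)` used for each arm in phase `ℓ`. -/
noncomputable def confLevel {d : ℕ} (I : Input d) (l : ℕ) (V : Finset (Vec d)) : ℝ :=
  1 / (2 * (l : ℝ) ^ 2 * (I.T : ℝ) * (V.card : ℝ))

/-- The number of pulls in phase `ℓ` with active set `V` (rounded up), where `ε_ℓ = 2^{-ℓ}`. -/
noncomputable def phaseLength {d : ℕ} (I : Input d) (S : Selection d) (l : ℕ)
    (V : Finset (Vec d)) : ℕ :=
  ⌈(32 : ℝ) ^ ((1 + I.ε) / I.ε) * (1 + I.υ) ^ (1 / I.ε)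
    * ((1 / 2 : ℝ) ^ l) ^ (-((1 + I.ε) / I.ε)) * optValue I S V ^ (1 / I.ε)
    * Real.log (2 * (l : ℝ) ^ 2 * (V.card : ℝ) * (I.T : ℝ))⌉₊

/-- The robust reward estimate `W^(a)` of phase `ℓ`, begun at time `s` with active set `V`; `h` is
the sequence of (action, reward) pairs.  The samples `aᵀ A^(γ)(λ*)⁻¹ x y` have `(1+ε)`-th absolute
moment at most `4 (1 + υ) M_{1+ε}(λ*; V, γ, β)`, which is the moment bound given to the truncated
mean. -/
noncomputable def rewardEstimate {d : ℕ} (I : Input d) (S : Selection d) (h : ℕ → Vec d × ℝ)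
    (l : ℕ) (V : Finset (Vec d)) (s : ℕ) (a : Vec d) : ℝ :=
  truncMean I.ε (4 * (1 + I.υ) * optValue I S V) (confLevel I l V) (phaseLength I S l V)
    (fun i => invForm I.γ V (S.design V) a (h (s + i)).1 * (h (s + i)).2)

open Classical in
/-- The elimination step at the end of phase `ℓ`. -/
noncomputable def eliminate {d : ℕ} (I : Input d) (S : Selection d) (h : ℕ → Vec d × ℝ)
    (l : ℕ) (V : Finset (Vec d)) (s : ℕ) : Finset (Vec d) :=
  V.filter fun a =>
    (⨆ a' : {a' // a' ∈ V}, inner ℝ (S.fit V (rewardEstimate I S h l V s)) a'.1)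
        - 4 * (1 / 2 : ℝ) ^ l
      ≤ inner ℝ (S.fit V (rewardEstimate I S h l V s)) a

/-- What the algorithm remembers: the number of the current phase, its active set, and the time at
which it began. -/
structure PhaseState (d : ℕ) where
  phase : ℕ
  active : Finset (Vec d)
  start : ℕ

/-- The state in which the algorithm is when it chooses the action of time `t` (times start at
zero).  It depends only on the first `t` entries of the sequence `h` of (action, reward) pairs.
Once a single arm is left, the state no longer changes. -/
noncomputable def stateAt {d : ℕ} (I : Input d) (S : Selection d) (h : ℕ → Vec d × ℝ) :
    ℕ → PhaseState d
  | 0 => ⟨1, I.actions, 0⟩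
  | t + 1 =>
    let P := stateAt I S h t
    if 1 < P.active.card ∧ P.start + phaseLength I S P.phase P.active ≤ t + 1 then
      ⟨P.phase + 1, eliminate I S h P.phase P.active P.start, t + 1⟩
    else P

/-! ### The bandit -/

/-- The information available before the action of time `t` is chosen. -/
abbrev pastInfo {d : ℕ} {Ω : Type*} (x : ℕ → Ω → Vec d) (y : ℕ → Ω → ℝ) (t : ℕ) :
    MeasurableSpace Ω :=
  MeasurableSpace.comap (fun ω (s : Fin t) => (x s ω, y s ω)) inferInstance

/-- The information available after the action of time `t` is chosen, before its reward is
observed. -/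
abbrev pastInfoWithAction {d : ℕ} {Ω : Type*} (x : ℕ → Ω → Vec d) (y : ℕ → Ω → ℝ) (t : ℕ) :
    MeasurableSpace Ω :=
  pastInfo x y t ⊔ MeasurableSpace.comap (x t) inferInstance

/-- Actions `x` and rewards `y` of a linear bandit with parameter `θ` up to time `T`: the noise
`η t = y t - ⟨x t, θ⟩` has, given the past and the chosen action, mean zero and absolute moment of
order `1 + ε` at most `υ`.  Noise terms with these two properties which are independent of the past
and of the chosen action are a special case; the law of the noise may also depend on the action. -/
structure IsLinearBandit {d : ℕ} {Ω : Type*} [MeasurableSpace Ω] (μ : Measure Ω) (θ : Vec d)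
    (ε υ : ℝ) (T : ℕ) (x : ℕ → Ω → Vec d) (y : ℕ → Ω → ℝ) : Prop where
  measurable_action : ∀ t, Measurable (x t)
  measurable_reward : ∀ t, Measurable (y t)
  integrable_noise : ∀ t < T, Integrable (fun ω => y t ω - inner ℝ (x t ω) θ) μ
  integrable_moment : ∀ t < T, Integrable (fun ω => |y t ω - inner ℝ (x t ω) θ| ^ (1 + ε)) μ
  noise_mean : ∀ t < T,
    μ[fun ω => y t ω - inner ℝ (x t ω) θ | pastInfoWithAction x y t] =ᵐ[μ] fun _ => 0
  noise_moment : ∀ t < T,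
    μ[fun ω => |y t ω - inner ℝ (x t ω) θ| ^ (1 + ε) | pastInfoWithAction x y t]
      ≤ᵐ[μ] fun _ => υ

/-- A run of MED-PE on a linear bandit with parameter `θ`: at each time `t` below the horizon, given
the past, the action is drawn from the selected design for the active set (for an active set with
one element this means that its only arm is pulled). -/
structure IsRun {d : ℕ} {Ω : Type*} [MeasurableSpace Ω] (μ : Measure Ω) (I : Input d)
    (S : Selection d) (θ : Vec d) (x : ℕ → Ω → Vec d) (y : ℕ → Ω → ℝ) : Prop where
  bandit : IsLinearBandit μ θ I.ε I.υ I.T x y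
  draw : ∀ t < I.T, ∀ a ∈ I.actions,
    μ[Set.indicator {ω | x t ω = a} (fun _ => (1 : ℝ)) | pastInfo x y t]
      =ᵐ[μ] fun ω => S.design (stateAt I S (fun s => (x s ω, y s ω)) t).active a

/-- Expected cumulative regret after `T` rounds with respect to the best action of `A`. -/
noncomputable def regret {d : ℕ} {Ω : Type*} [MeasurableSpace Ω] (μ : Measure Ω)
    (A : Set (Vec d)) (θ : Vec d) (T : ℕ) (x : ℕ → Ω → Vec d) : ℝ :=
  ∫ ω, ∑ t ∈ Finset.range T,
    (sSup ((fun a => (inner ℝ a θ : ℝ)) '' A) - inner ℝ (x t ω) θ) ∂μ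

/-- The parameters allowed for the action set `A`. -/
def Admissible {d : ℕ} (A : Set (Vec d)) (θ : Vec d) : Prop :=
  ‖θ‖ ≤ 1 ∧ ∀ a ∈ A, |(inner ℝ a θ : ℝ)| ≤ 1

/-- `A₀` is a set of at most `T^{κ d}` elements of `A` such that the expected reward of each action
in `A` is within `1 / T` of that of an element of `A₀`, whatever the (unknown) parameter. -/
def IsRewardCover {d : ℕ} (A : Set (Vec d)) (T κ : ℕ) (A₀ : Finset (Vec d)) : Prop :=
  (∀ a ∈ A₀, a ∈ A) ∧ A₀.card ≤ T ^ (κ * d) ∧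
    ∀ x ∈ A, ∃ a ∈ A₀, ∀ θ, Admissible A θ →
      |(inner ℝ x θ : ℝ) - inner ℝ a θ| ≤ 1 / (T : ℝ)

/-- MED-PE on the arms `A₀` with `γ = T^{-2ε/(1+ε)}` and `β = 1`. -/
noncomputable def tunedInput {d : ℕ} (A₀ : Finset (Vec d)) (ε υ : ℝ) (T : ℕ) : Input d where
  actions := A₀
  γ := (T : ℝ) ^ (-(2 * ε / (1 + ε)))
  β := 1
  ε := ε
  υ := υ
  T := T

end HeavyTailBandit

namespace HeavyTailBandit

/-! ### Linear algebra of the regularized covariance -/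

/-! Write α = ε/(1+ε), let A be the regularized covariance of the design of a phase, and call aᵀA⁻¹a
the leverage of a. The proof rests on a design bound, a concentration bound and an elimination
argument.

Design: a design maximizing det A has leverage at most d on the whole active set
(`exists_design_invForm_le`). By Jensen's inequality the moments of order 1+ε are controlled by the
leverage, so the optimal value M is at most 2 d^((1+ε)/2) (`optValue_le`), that is, M^(1/(1+ε)) is
of order √d.

Concentration: given the past, the sample aᵀA⁻¹x y has mean ⟨a,θ⟩ up to a ridge bias of at most √γ
times the root of the leverage, and absolute moment of order 1+ε at most 2(1+υ)M. Truncated samples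
have exponential moments, which gives a Chernoff bound (`measureReal_sum_trunc_le`). The phase
length makes the statistical error and the ridge bias at most 2^(-l)/2 each (`phase_error_le`). A
union bound leaves a failure probability of at most 2/T, which costs a constant because each gap is
at most 2.

Elimination: when all estimates are accurate, the best arm survives and every active arm in phase l
has gap at most 16·2^(-l). Phase l lasts at most 2K·2^(l/α) rounds with K = `lengthFactor`, hence
the gap at time t is of order (K/t)^α (`gap_le_of_isAccurate`). Summation gives K^α T^(1-α), where
K^α is of order (1+υ)^(1/(1+ε)) √d log(2T³n)^α for n arms.

For a finite action set log(2T³n) is at most a multiple of log T · log n. For a cover, log n ≤ κ d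
log T contributes the extra factor d^α, while the approximation error 1/T per round costs 1 in
total. Covers exist by a volume comparison in the unit ball of the dual seminorm
(`card_le_of_separated`), which needs no boundedness of the action set. -/

lemma posSemidef_vecMulVec_self {d : ℕ} (u : Fin d → ℝ) :
    (Matrix.vecMulVec u u).PosSemidef := by
  simpa using Matrix.posSemidef_vecMulVec_self_star u

lemma posSemidef_sum_smul_vecMulVec {d : ℕ} {ι : Type*} (s : Finset ι) (c : ι → ℝ)
    (u : ι → Fin d → ℝ) (hc : ∀ i ∈ s, 0 ≤ c i) :
    (∑ i ∈ s, c i • Matrix.vecMulVec (u i) (u i)).PosSemidef :=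
  Matrix.posSemidef_sum _ fun i hi => (posSemidef_vecMulVec_self _).smul (hc i hi)

lemma regCov_posDef {d : ℕ} {γ : ℝ} (hγ : 0 < γ) {V : Finset (Vec d)} {w : Vec d → ℝ}
    (hw : ∀ a, 0 ≤ w a) : (regCov γ V w).PosDef :=
  (Matrix.PosDef.one.smul hγ).add_posSemidef
    (posSemidef_sum_smul_vecMulVec V w (fun x => x.ofLp) fun a _ => hw a)

lemma det_add_vecMulVec {d : ℕ} {A : Matrix (Fin d) (Fin d) ℝ} (hA : IsUnit A.det)
    (u v : Fin d → ℝ) :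
    (A + Matrix.vecMulVec u v).det = A.det * (1 + v ⬝ᵥ A⁻¹.mulVec u) := by
  rw [Matrix.vecMulVec_eq Unit, Matrix.det_add_replicateCol_mul_replicateRow hA]
  congr 1
  rw [Matrix.det_unique, Matrix.add_apply, Matrix.one_apply_eq, Matrix.mul_assoc,
    Matrix.mul_apply]
  congr 1

/-- By the matrix determinant lemma each rank-one summand multiplies the determinant by 1 + c uᵀB⁻¹u
≥ 1. -/
lemma det_le_det_add_sum {d : ℕ} {ι : Type*} (s : Finset ι) (c : ι → ℝ) (u : ι → Fin d → ℝ)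
    (hc : ∀ i ∈ s, 0 ≤ c i) {A : Matrix (Fin d) (Fin d) ℝ} (hA : A.PosDef) :
    A.det ≤ (A + ∑ i ∈ s, c i • Matrix.vecMulVec (u i) (u i)).det := by
  classical
  induction s using Finset.induction_on with
  | empty => simp
  | insert i s hi ih =>
    have hc' : ∀ j ∈ s, 0 ≤ c j := fun j hj => hc j (Finset.mem_insert_of_mem hj)
    have hB : (A + ∑ i ∈ s, c i • Matrix.vecMulVec (u i) (u i)).PosDef :=
      hA.add_posSemidef (posSemidef_sum_smul_vecMulVec s c u hc')
    refine (ih hc').trans ?_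
    rw [Finset.sum_insert hi, add_comm (c i • _), ← add_assoc, ← Matrix.vecMulVec_smul,
      det_add_vecMulVec hB.det_pos.ne'.isUnit]
    refine le_mul_of_one_le_right hB.det_pos.le ?_
    have := hB.inv.posSemidef.dotProduct_mulVec_nonneg (u i)
    have h2 : 0 ≤ c i * (u i ⬝ᵥ (A + ∑ i ∈ s, c i • Matrix.vecMulVec (u i) (u i))⁻¹.mulVec (u i)) :=
      mul_nonneg (hc i (Finset.mem_insert_self _ _)) (by simpa using this)
    simpa [smul_dotProduct] using h2

lemma regCov_mulVec_dotProduct {d : ℕ} (γ : ℝ) (V : Finset (Vec d)) (w : Vec d → ℝ)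
    (v z : Fin d → ℝ) :
    (regCov γ V w).mulVec v ⬝ᵥ z
      = γ * (v ⬝ᵥ z) + ∑ x ∈ V, w x * ((v ⬝ᵥ x.ofLp) * (x.ofLp ⬝ᵥ z)) := by
  rw [regCov, Matrix.add_mulVec, add_dotProduct, Matrix.smul_mulVec, Matrix.one_mulVec,
    smul_dotProduct, smul_eq_mul, Matrix.sum_mulVec, sum_dotProduct]
  congr 1
  refine Finset.sum_congr rfl fun x _ => ?_
  rw [Matrix.smul_mulVec, Matrix.vecMulVec_mulVec, smul_dotProduct]
  simp [dotProduct_comm v]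

/-- The vector `A⁻¹ a` which represents `invForm` at `a`. -/
noncomputable def invVec {d : ℕ} (γ : ℝ) (V : Finset (Vec d)) (w : Vec d → ℝ)
    (a : Vec d) : Fin d → ℝ :=
  (regCov γ V w)⁻¹.mulVec a.ofLp

lemma invForm_eq_dotProduct {d : ℕ} {γ : ℝ} (hγ : 0 < γ) {V : Finset (Vec d)} {w : Vec d → ℝ}
    (hw : ∀ a, 0 ≤ w a) (a x : Vec d) :
    invForm γ V w a x = invVec γ V w a ⬝ᵥ x.ofLp := by
  have h := (regCov_posDef hγ (V := V) hw).inv.isHermitian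
  rw [Matrix.IsHermitian, Matrix.conjTranspose_eq_transpose_of_trivial] at h
  rw [invForm, invVec, Matrix.dotProduct_mulVec, ← Matrix.mulVec_transpose, h]

/-- Expand A in a = A(A⁻¹a). The sum is the expectation of the weighted samples; the term with γ is
the ridge bias. -/
lemma dotProduct_eq_add_sum {d : ℕ} {γ : ℝ} (hγ : 0 < γ) {V : Finset (Vec d)} {w : Vec d → ℝ}
    (hw : ∀ a, 0 ≤ w a) (a : Vec d) (z : Fin d → ℝ) :
    a.ofLp ⬝ᵥ z = γ * (invVec γ V w a ⬝ᵥ z)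
      + ∑ x ∈ V, w x * (invForm γ V w a x * (x.ofLp ⬝ᵥ z)) := by
  simp_rw [invForm_eq_dotProduct hγ hw]
  rw [← regCov_mulVec_dotProduct, invVec, Matrix.mulVec_mulVec,
    Matrix.mul_nonsing_inv _ (regCov_posDef hγ hw).det_pos.ne'.isUnit, Matrix.one_mulVec]

lemma invForm_self_eq {d : ℕ} {γ : ℝ} (hγ : 0 < γ) {V : Finset (Vec d)} {w : Vec d → ℝ}
    (hw : ∀ a, 0 ≤ w a) (a : Vec d) :
    invForm γ V w a a = γ * (invVec γ V w a ⬝ᵥ invVec γ V w a)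
      + ∑ x ∈ V, w x * invForm γ V w a x ^ 2 := by
  rw [invForm_eq_dotProduct hγ hw a a, dotProduct_comm, dotProduct_eq_add_sum hγ hw a]
  congr 1
  refine Finset.sum_congr rfl fun x _ => ?_
  rw [dotProduct_comm, ← invForm_eq_dotProduct hγ hw, sq]

lemma sum_mul_invForm_sq_le {d : ℕ} {γ : ℝ} (hγ : 0 < γ) {V : Finset (Vec d)} {w : Vec d → ℝ}
    (hw : ∀ a, 0 ≤ w a) (a : Vec d) :
    ∑ x ∈ V, w x * invForm γ V w a x ^ 2 ≤ invForm γ V w a a := by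
  have h : 0 ≤ invVec γ V w a ⬝ᵥ invVec γ V w a := by
    simpa using dotProduct_star_self_nonneg (invVec γ V w a)
  rw [invForm_self_eq hγ hw]
  nlinarith

lemma invForm_self_nonneg {d : ℕ} {γ : ℝ} (hγ : 0 < γ) {V : Finset (Vec d)} {w : Vec d → ℝ}
    (hw : ∀ a, 0 ≤ w a) (a : Vec d) : 0 ≤ invForm γ V w a a :=
  (Finset.sum_nonneg fun x _ => mul_nonneg (hw x) (sq_nonneg _)).trans
    (sum_mul_invForm_sq_le hγ hw a)

lemma invForm_self_pos {d : ℕ} {γ : ℝ} (hγ : 0 < γ) {V : Finset (Vec d)} {w : Vec d → ℝ}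
    (hw : ∀ a, 0 ≤ w a) {a : Vec d} (ha : a ≠ 0) : 0 < invForm γ V w a a := by
  have h : a.ofLp ≠ 0 := fun h => ha (by ext i; simpa using congrFun h i)
  simpa [invForm] using (regCov_posDef hγ (V := V) hw).inv.dotProduct_mulVec_pos h

/-- The bias caused by the ridge parameter. -/
lemma abs_inner_sub_sum_le {d : ℕ} {γ : ℝ} (hγ : 0 < γ) {V : Finset (Vec d)} {w : Vec d → ℝ}
    (hw : ∀ a, 0 ≤ w a) (a θ : Vec d) (hθ : ‖θ‖ ≤ 1) :
    |inner ℝ a θ - ∑ x ∈ V, w x * (invForm γ V w a x * inner ℝ x θ)|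
      ≤ Real.sqrt γ * Real.sqrt (invForm γ V w a a) := by
  have hin : ∀ z : Vec d, inner ℝ z θ = z.ofLp ⬝ᵥ θ.ofLp := fun z => by
    simp [EuclideanSpace.inner_eq_star_dotProduct, dotProduct_comm]
  set v := invVec γ V w a with hv
  have h1 : inner ℝ a θ - ∑ x ∈ V, w x * (invForm γ V w a x * inner ℝ x θ)
      = γ * (v ⬝ᵥ θ.ofLp) := by
    simp_rw [hin]
    rw [dotProduct_eq_add_sum hγ hw a]
    ring
  have h2 : (v ⬝ᵥ θ.ofLp) = inner ℝ (WithLp.toLp 2 v : Vec d) θ := by rw [hin]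
  have h3 : |v ⬝ᵥ θ.ofLp| ≤ ‖(WithLp.toLp 2 v : Vec d)‖ := by
    rw [h2]
    exact (abs_real_inner_le_norm _ _).trans (mul_le_of_le_one_right (norm_nonneg _) hθ)
  have h4 : ‖(WithLp.toLp 2 v : Vec d)‖ ^ 2 = v ⬝ᵥ v := by
    rw [← real_inner_self_eq_norm_sq, EuclideanSpace.inner_eq_star_dotProduct]
    simp
  -- γ‖A⁻¹a‖² is one of two nonnegative parts of the leverage, so γ‖A⁻¹a‖ is at most √γ times the
  -- root of the leverage.
  have h5 : γ * (v ⬝ᵥ v) ≤ invForm γ V w a a := by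
    rw [invForm_self_eq hγ hw]
    have := Finset.sum_nonneg fun x (_ : x ∈ V) => mul_nonneg (hw x) (sq_nonneg (invForm γ V w a x))
    linarith
  rw [h1, abs_mul, abs_of_pos hγ, ← Real.sqrt_mul hγ.le]
  refine Real.le_sqrt_of_sq_le ?_
  have h6 : (v ⬝ᵥ θ.ofLp) ^ 2 ≤ v ⬝ᵥ v := by
    rw [← h4, ← sq_abs]
    exact pow_le_pow_left₀ (abs_nonneg _) h3 2
  rw [mul_pow, sq_abs, sq γ, mul_assoc]
  exact mul_le_mul_of_nonneg_left ((mul_le_mul_of_nonneg_left h6 hγ.le).trans h5) hγ.le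

/-! ### Optimal designs -/

/-- The first-order condition at s = 0: the left side equals 1 there and has derivative g - (n+1).
Bernoulli's inequality replaces the derivative. -/
lemma le_of_forall_pow_mul_le_one {n : ℕ} {g : ℝ}
    (h : ∀ s : ℝ, 0 < s → s < 1 → (1 - s) ^ n * (1 - s + s * g) ≤ 1) : g ≤ n + 1 := by
  by_contra! hg
  have hn : (0 : ℝ) ≤ n := Nat.cast_nonneg n
  -- After Bernoulli the product is 1 + s((g-(n+1)) - n(g-1)s). This s is small enough for the
  -- bracket to stay positive.
  set s : ℝ := (g - (n + 1)) / (2 * (n + 1) * g) with hs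
  have hgpos : 0 < g := by linarith
  have hs0 : 0 < s := div_pos (by linarith) (by positivity)
  have hs1 : s < 1 := by
    rw [hs, div_lt_one (by positivity)]
    nlinarith
  have h1 := h s hs0 hs1
  have h2 : 1 + (n : ℝ) * (-s) ≤ (1 + -s) ^ n := one_add_mul_le_pow (by linarith) n
  have h3 : (1 - n * s) * (1 - s + s * g) ≤ 1 := by
    refine le_trans (mul_le_mul_of_nonneg_right ?_ (by nlinarith)) h1
    rw [← sub_eq_add_neg] at h2
    linarith
  have h4 : s * (2 * (n + 1) * g) = g - (n + 1) := by
    rw [hs]; field_simp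
  have h5 : s * ((g - (n + 1)) - n * (g - 1) * s) ≤ 0 := by nlinarith
  have h6 : n * (g - 1) * s < g - (n + 1) := by
    rw [← h4]
    nlinarith [mul_pos hs0 hgpos, mul_nonneg hn hs0.le, mul_nonneg (mul_nonneg hn hs0.le) hgpos.le]
  nlinarith

/-- Moving mass `s` of a design to the arm `a` increases the determinant at least by this factor. -/
lemma det_regCov_ge {d : ℕ} {γ : ℝ} (hγ : 0 < γ) {V : Finset (Vec d)} {w : Vec d → ℝ}
    (hw : ∀ a, 0 ≤ w a) (a : Vec d) {s : ℝ} (hs0 : 0 < s) (hs1 : s < 1)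
    {w' : Vec d → ℝ}
    (hw' : regCov γ V w' = γ • (1 : Matrix (Fin d) (Fin d) ℝ)
      + ((1 - s) • ∑ x ∈ V, w x • Matrix.vecMulVec x.ofLp x.ofLp
        + s • Matrix.vecMulVec a.ofLp a.ofLp)) :
    (1 - s) ^ d * (1 + s * invForm γ V w a a / (1 - s)) * (regCov γ V w).det
      ≤ (regCov γ V w').det := by
  have hs : 0 < 1 - s := by linarith
  have hA := regCov_posDef hγ (V := V) hw
  have hsA : ((1 - s) • regCov γ V w).PosDef := hA.smul hs
  -- Scaling A by 1-s also shrinks its ridge part. The deficit sγI is written as a sum of rank-one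
  -- matrices, so that `det_le_det_add_sum` allows it to be dropped.
  have hone : (1 : Matrix (Fin d) (Fin d) ℝ)
      = ∑ i : Fin d, Matrix.vecMulVec (Pi.single i (1 : ℝ)) (Pi.single i (1 : ℝ)) := by
    ext i j
    simp [Matrix.sum_apply, Matrix.vecMulVec_apply, Matrix.one_apply, Pi.single_apply]
  have hdecomp : regCov γ V w' = ((1 - s) • regCov γ V w + Matrix.vecMulVec (s • a.ofLp) a.ofLp)
      + ∑ i : Fin d, (s * γ) • Matrix.vecMulVec (Pi.single i (1 : ℝ)) (Pi.single i (1 : ℝ)) := by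
    rw [hw', ← Finset.smul_sum, ← hone, regCov, Matrix.smul_vecMulVec, smul_add, smul_smul, mul_smul,
      smul_smul]
    have : γ • (1 : Matrix (Fin d) (Fin d) ℝ) = ((1 - s) * γ) • 1 + (s * γ) • 1 := by
      rw [← add_smul]; congr 1; ring
    rw [this]
    abel_nf
  rw [hdecomp]
  have hP : ((1 - s) • regCov γ V w + Matrix.vecMulVec (s • a.ofLp) a.ofLp).PosDef := by
    rw [Matrix.smul_vecMulVec]
    exact hsA.add_posSemidef ((posSemidef_vecMulVec_self _).smul hs0.le)
  refine le_trans (le_of_eq ?_) (det_le_det_add_sum Finset.univ (fun _ => s * γ) _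
    (fun _ _ => by positivity) hP)
  rw [det_add_vecMulVec hsA.det_pos.ne'.isUnit, Matrix.det_smul, Fintype.card_fin,
    Matrix.mulVec_smul, dotProduct_smul]
  have hinv : ((1 - s) • regCov γ V w)⁻¹ = (1 - s)⁻¹ • (regCov γ V w)⁻¹ := by
    refine Matrix.inv_eq_left_inv ?_
    rw [Matrix.smul_mul, Matrix.mul_smul, smul_smul, inv_mul_cancel₀ hs.ne', one_smul,
      Matrix.nonsing_inv_mul _ hA.det_pos.ne'.isUnit]
  rw [hinv, Matrix.smul_mulVec, dotProduct_smul, invForm]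
  simp only [smul_eq_mul]
  field_simp

/-- A regularized version of the Kiefer–Wolfowitz theorem. -/
lemma exists_design_invForm_le {d : ℕ} {γ : ℝ} (hγ : 0 < γ) {V : Finset (Vec d)}
    (hV : V.Nonempty) : ∃ w, IsDesign V w ∧ ∀ a ∈ V, invForm γ V w a a ≤ d := by
  classical
  let E : ({a // a ∈ V} → ℝ) → Vec d → ℝ := fun u a => if h : a ∈ V then u ⟨a, h⟩ else 0
  have hEmem : ∀ u (a : {a // a ∈ V}), E u a.1 = u a := fun u a => by simp [E, a.2]
  have hE : ∀ u ∈ stdSimplex ℝ {a // a ∈ V}, IsDesign V (E u) := by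
    intro u hu
    refine ⟨fun a => ?_, fun a ha => by simp [E, ha], ?_⟩
    · by_cases h : a ∈ V
      · simpa [E, h] using hu.1 _
      · simp [E, h]
    · rw [← Finset.sum_coe_sort V, ← hu.2]
      exact Finset.sum_congr rfl fun a _ => hEmem u a
  have hreg : ∀ u, regCov γ V (E u) = γ • (1 : Matrix (Fin d) (Fin d) ℝ)
      + ∑ x : {a // a ∈ V}, u x • Matrix.vecMulVec x.1.ofLp x.1.ofLp := by
    intro u
    rw [regCov, ← Finset.sum_coe_sort V]
    simp only [hEmem]
  have hcont : Continuous fun u => (regCov γ V (E u)).det := by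
    simp only [hreg]
    refine Continuous.matrix_det ?_
    fun_prop
  -- The D-optimal design: maximality of the determinant on segments towards the vertices of the
  -- simplex bounds the leverage of each arm.
  obtain ⟨u, hu, hmax⟩ := (isCompact_stdSimplex ℝ {a // a ∈ V}).exists_isMaxOn
    ⟨_, single_mem_stdSimplex ℝ (⟨_, hV.choose_spec⟩ : {a // a ∈ V})⟩ hcont.continuousOn
  refine ⟨E u, hE u hu, fun a ha => ?_⟩
  have hw := (hE u hu).1
  rcases Nat.eq_zero_or_pos d with rfl | hd
  · simp [invForm]
  -- One of the d factors 1-s clears the denominator of 1 + sg/(1-s); the remaining n = d-1 match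
  -- `le_of_forall_pow_mul_le_one`.
  obtain ⟨n, rfl⟩ : ∃ n, d = n + 1 := ⟨d - 1, by omega⟩
  push_cast
  refine le_of_forall_pow_mul_le_one fun s hs0 hs1 => ?_
  have hs : 0 < 1 - s := by linarith
  have hsingle := single_mem_stdSimplex ℝ (⟨a, ha⟩ : {a // a ∈ V})
  have hmem := convex_stdSimplex ℝ {a // a ∈ V} hu hsingle hs.le hs0.le (by ring)
  have hle := hmax hmem
  have hge := det_regCov_ge hγ hw a hs0 hs1 (w' := E ((1 - s) • u + s • Pi.single ⟨a, ha⟩ 1)) (by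
    rw [hreg, ← Finset.sum_coe_sort V]
    simp only [hEmem, Pi.add_apply, Pi.smul_apply, smul_eq_mul, add_smul, Finset.sum_add_distrib,
      mul_smul, ← Finset.smul_sum]
    congr 3
    simp [Pi.single_apply])
  have hdet := (regCov_posDef hγ (V := V) hw).det_pos
  have h1 := hge.trans hle
  have h2 : (1 - s) ^ (n + 1) * (1 + s * invForm γ V (E u) a a / (1 - s)) ≤ 1 :=
    le_of_mul_le_mul_right (by simpa using h1) hdet
  refine le_trans (le_of_eq ?_) h2
  rw [pow_succ]
  field_simp

lemma designTerm_le_designValue {d : ℕ} (ε γ β : ℝ) {V : Finset (Vec d)} (w : Vec d → ℝ)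
    {a : Vec d} (ha : a ∈ V) :
    ∑ x ∈ V, w x * |invForm γ V w a x| ^ (1 + ε)
      + β ^ (1 + ε) * Real.sqrt (invForm γ V w a a) ^ (1 + ε) ≤ designValue ε γ β V w :=
  le_ciSup (f := fun a : {a // a ∈ V} => ∑ x ∈ V, w x * |invForm γ V w a.1 x| ^ (1 + ε)
      + β ^ (1 + ε) * Real.sqrt (invForm γ V w a.1 a.1) ^ (1 + ε))
    (Set.finite_range _).bddAbove ⟨a, ha⟩

/-- Jensen's inequality with exponent 2/(1+ε) ≥ 1 passes to the second moment, which is the leverage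
without its ridge part. -/
lemma sum_mul_abs_invForm_rpow_le {d : ℕ} {ε γ : ℝ} (hε0 : 0 < ε) (hε1 : ε ≤ 1) (hγ : 0 < γ)
    {V : Finset (Vec d)} {w : Vec d → ℝ} (hw : IsDesign V w) (a : Vec d) :
    ∑ x ∈ V, w x * |invForm γ V w a x| ^ (1 + ε) ≤ invForm γ V w a a ^ ((1 + ε) / 2) := by
  have hp : (1 : ℝ) ≤ 2 / (1 + ε) := by rw [le_div_iff₀ (by linarith)]; linarith
  have h := Real.arith_mean_le_rpow_mean V w (fun x => |invForm γ V w a x| ^ (1 + ε))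
    (fun x _ => hw.1 x) hw.2.2 (fun x _ => by positivity) hp
  refine h.trans ?_
  rw [one_div_div]
  refine Real.rpow_le_rpow (Finset.sum_nonneg fun x _ => mul_nonneg (hw.1 x) (by positivity)) ?_
    (by linarith)
  refine le_trans (le_of_eq (Finset.sum_congr rfl fun x _ => ?_)) (sum_mul_invForm_sq_le hγ hw.1 a)
  rw [← Real.rpow_mul (abs_nonneg _), mul_div_cancel₀ _ (by linarith), Real.rpow_two, sq_abs]

lemma designValue_le {d : ℕ} {ε γ D : ℝ} (hε0 : 0 < ε) (hε1 : ε ≤ 1) (hγ : 0 < γ)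
    {V : Finset (Vec d)} (hV : V.Nonempty) {w : Vec d → ℝ} (hw : IsDesign V w)
    (hD : ∀ a ∈ V, invForm γ V w a a ≤ D) :
    designValue ε γ 1 V w ≤ 2 * D ^ ((1 + ε) / 2) := by
  have : Nonempty {a // a ∈ V} := ⟨⟨_, hV.choose_spec⟩⟩
  refine ciSup_le fun a => ?_
  have h0 := invForm_self_nonneg hγ (V := V) hw.1 a.1
  have h1 : invForm γ V w a a ^ ((1 + ε) / 2) ≤ D ^ ((1 + ε) / 2) :=
    Real.rpow_le_rpow h0 (hD _ a.2) (by linarith)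
  have h2 := sum_mul_abs_invForm_rpow_le hε0 hε1 hγ hw a.1
  have h3 : Real.sqrt (invForm γ V w a a) ^ (1 + ε) = invForm γ V w a a ^ ((1 + ε) / 2) := by
    rw [Real.sqrt_eq_rpow, ← Real.rpow_mul h0]
    congr 1
    ring
  rw [Real.one_rpow, one_mul, h3]
  linarith

/-- The selected design need not be D-optimal, but it minimizes M, so comparison with the D-optimal
design suffices. -/
lemma optValue_le {d : ℕ} {I : Input d} {S : Selection d} (hS : S.IsValid I) (hε0 : 0 < I.ε)
    (hε1 : I.ε ≤ 1) (hγ : 0 < I.γ) (hβ : I.β = 1) {V : Finset (Vec d)} (hVI : V ⊆ I.actions)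
    (hV : V.Nonempty) : optValue I S V ≤ 2 * (d : ℝ) ^ ((1 + I.ε) / 2) := by
  obtain ⟨w, hw, hwd⟩ := exists_design_invForm_le hγ hV
  refine (hS.design_le V hVI hV w hw).trans ?_
  rw [hβ]
  exact designValue_le hε0 hε1 hγ hV hw hwd

lemma sum_abs_invForm_rpow_le_optValue {d : ℕ} {I : Input d} {S : Selection d} (hβ : I.β = 1)
    {V : Finset (Vec d)} {a : Vec d} (ha : a ∈ V) :
    ∑ x ∈ V, S.design V x * |invForm I.γ V (S.design V) a x| ^ (1 + I.ε) ≤ optValue I S V := by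
  refine le_trans ?_ (designTerm_le_designValue I.ε I.γ I.β (S.design V) ha)
  rw [hβ, Real.one_rpow, one_mul]
  have : 0 ≤ Real.sqrt (invForm I.γ V (S.design V) a a) ^ (1 + I.ε) := by positivity
  linarith

lemma sqrt_invForm_le_optValue {d : ℕ} {I : Input d} {S : Selection d} (hS : S.IsValid I)
    (hβ : I.β = 1) {V : Finset (Vec d)} (hVI : V ⊆ I.actions) {a : Vec d} (ha : a ∈ V) :
    Real.sqrt (invForm I.γ V (S.design V) a a) ^ (1 + I.ε) ≤ optValue I S V := by
  refine le_trans ?_ (designTerm_le_designValue I.ε I.γ I.β (S.design V) ha)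
  rw [hβ, Real.one_rpow, one_mul]
  have hw := (hS.isDesign V hVI ⟨a, ha⟩).1
  have := Finset.sum_nonneg fun x (_ : x ∈ V) =>
    mul_nonneg (hw x) (Real.rpow_nonneg (abs_nonneg (invForm I.γ V (S.design V) a x)) (1 + I.ε))
  linarith

/-- Of two distinct arms at least one is nonzero and has positive leverage. Truncation levels and
phase lengths are therefore positive. -/
lemma optValue_pos {d : ℕ} {I : Input d} {S : Selection d} (hS : S.IsValid I) (hγ : 0 < I.γ)
    (hβ : I.β = 1) {V : Finset (Vec d)} (hVI : V ⊆ I.actions) (hV : 1 < V.card) :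
    0 < optValue I S V := by
  obtain ⟨a, ha, ha0⟩ := Finset.exists_mem_ne hV (0 : Vec d)
  have h := invForm_self_pos hγ (V := V) (hS.isDesign V hVI ⟨a, ha⟩).1 ha0
  exact lt_of_lt_of_le (Real.rpow_pos_of_pos (Real.sqrt_pos.2 h) _)
    (sqrt_invForm_le_optValue hS hβ hVI ha)

/-! ### Reward covers -/

/-- The unit ball of the seminorm dual to `Θ`, intersected with a Euclidean ball. -/
def polarBall {d : ℕ} (Θ : Set (Vec d)) (r : ℝ) : Set (Vec d) :=
  {z | ‖z‖ ≤ r ∧ ∀ θ ∈ Θ, |(inner ℝ z θ : ℝ)| ≤ 1}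

lemma isClosed_polarBall {d : ℕ} (Θ : Set (Vec d)) (r : ℝ) : IsClosed (polarBall Θ r) := by
  have : polarBall Θ r = {z | ‖z‖ ≤ r} ∩ ⋂ θ ∈ Θ, {z | |(inner ℝ z θ : ℝ)| ≤ 1} := by
    ext z; simp [polarBall]
  rw [this]
  refine (isClosed_le (by fun_prop) (by fun_prop)).inter
    (isClosed_biInter fun θ _ => isClosed_le (by fun_prop) (by fun_prop))

lemma convex_polarBall {d : ℕ} (Θ : Set (Vec d)) (r : ℝ) : Convex ℝ (polarBall Θ r) := by
  intro x hx y hy a b ha hb hab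
  refine ⟨?_, fun θ hθ => ?_⟩
  · refine (norm_add_le _ _).trans ?_
    rw [norm_smul, norm_smul, Real.norm_of_nonneg ha, Real.norm_of_nonneg hb]
    calc a * ‖x‖ + b * ‖y‖ ≤ a * r + b * r :=
          add_le_add (mul_le_mul_of_nonneg_left hx.1 ha) (mul_le_mul_of_nonneg_left hy.1 hb)
      _ = r := by rw [← add_mul, hab, one_mul]
  · rw [inner_add_left, inner_smul_left, inner_smul_left]
    refine (abs_add_le _ _).trans ?_
    simp only [conj_trivial, abs_mul, abs_of_nonneg ha, abs_of_nonneg hb]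
    calc a * _ + b * _ ≤ a * 1 + b * 1 :=
          add_le_add (mul_le_mul_of_nonneg_left (hx.2 θ hθ) ha)
            (mul_le_mul_of_nonneg_left (hy.2 θ hθ) hb)
      _ = 1 := by rw [mul_one, mul_one, hab]

open scoped Pointwise in
-- Volume comparison in K = `polarBall Θ r`, with ρ = 1/(2T). The bodies x + ρK are disjoint, since
-- a common point would give |⟨x-y,θ⟩| ≤ 2ρ = 1/T on Θ. By convexity they lie in K + ρK = (1+ρ)K.
-- Their number is thus at most ((1+ρ)/ρ)^d = (2T+1)^d.
lemma card_le_of_separated {d : ℕ} {Θ : Set (Vec d)} (hΘ : ∀ θ ∈ Θ, ‖θ‖ ≤ 1) {T : ℕ} (hT : 0 < T)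
    (S : Finset (Vec d)) (hS : ∀ x ∈ S, ∀ θ ∈ Θ, |(inner ℝ x θ : ℝ)| ≤ 1)
    (hsep : ∀ x ∈ S, ∀ y ∈ S, x ≠ y → ∃ θ ∈ Θ, 1 / (T : ℝ) < |(inner ℝ (x - y) θ : ℝ)|) :
    S.card ≤ (2 * T + 1) ^ d := by
  have hT' : (0 : ℝ) < T := by exact_mod_cast hT
  -- The radius only makes K bounded, hence of finite volume, even if Θ does not span; it does not
  -- enter the count.
  obtain ⟨r, hr1, hr⟩ : ∃ r : ℝ, 1 ≤ r ∧ ∀ x ∈ S, ‖x‖ ≤ r := by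
    refine ⟨1 + ∑ x ∈ S, ‖x‖, le_add_of_nonneg_right (Finset.sum_nonneg fun _ _ => norm_nonneg _),
      fun x hx => ?_⟩
    have := Finset.single_le_sum (f := fun x : Vec d => ‖x‖) (fun _ _ => norm_nonneg _) hx
    linarith
  set K := polarBall Θ r with hK
  set ρ : ℝ := 1 / (2 * T) with hρ
  have hρ0 : 0 < ρ := by positivity
  have hSK : ∀ x ∈ S, x ∈ K := fun x hx => ⟨hr x hx, hS x hx⟩
  have hball : Metric.closedBall (0 : Vec d) 1 ⊆ K := by
    intro z hz
    rw [mem_closedBall_zero_iff] at hz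
    refine ⟨hz.trans hr1, fun θ hθ => (abs_real_inner_le_norm _ _).trans ?_⟩
    exact mul_le_one₀ hz (norm_nonneg _) (hΘ θ hθ)
  have hpos : 0 < volume K :=
    lt_of_lt_of_le (Metric.measure_closedBall_pos volume 0 one_pos) (measure_mono hball)
  have hfin : volume K ≠ ⊤ := by
    refine ne_top_of_le_ne_top (measure_closedBall_lt_top (x := (0 : Vec d)) (r := r)).ne
      (measure_mono fun z hz => ?_)
    rw [mem_closedBall_zero_iff]
    exact hz.1
  have hmeas : ∀ x : Vec d, MeasurableSet ((fun z => x + ρ • z) '' K) := by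
    intro x
    have h2 : (fun z => x + ρ • z) '' K = (Homeomorph.smulOfNeZero ρ hρ0.ne').trans
        (Homeomorph.addLeft x) '' K := by
      ext; simp
    rw [h2]
    exact ((Homeomorph.isClosed_image _).2 (isClosed_polarBall Θ r)).measurableSet
  have hvol : ∀ x : Vec d, volume ((fun z => x + ρ • z) '' K) = ENNReal.ofReal (ρ ^ d) * volume K := by
    intro x
    have h2 : (fun z => x + ρ • z) '' K = (fun z => x + z) '' (ρ • K) := by
      rw [← Set.image_smul, Set.image_image]
    rw [h2, Set.image_add_left, measure_preimage_add, Measure.addHaar_smul_of_nonneg _ hρ0.le]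
    simp
  have hdisj : Set.PairwiseDisjoint (S : Set (Vec d)) fun x => (fun z => x + ρ • z) '' K := by
    intro x hx y hy hxy
    rw [Function.onFun, Set.disjoint_left]
    rintro _ ⟨z, hz, rfl⟩ ⟨z', hz', heq⟩
    obtain ⟨θ, hθ, hlt⟩ := hsep x hx y hy hxy
    have h1 : x - y = ρ • (z' - z) := by
      have h3 : y + ρ • z' = x + ρ • z := heq
      rw [smul_sub, sub_eq_sub_iff_add_eq_add, ← h3, add_comm]
    rw [h1, inner_smul_left, inner_sub_left] at hlt
    simp only [conj_trivial, abs_mul, abs_of_pos hρ0] at hlt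
    have h2 := (abs_sub (inner ℝ z' θ : ℝ) (inner ℝ z θ)).trans
      (add_le_add (hz'.2 θ hθ) (hz.2 θ hθ))
    have h4 : ρ * |(inner ℝ z' θ : ℝ) - inner ℝ z θ| ≤ ρ * (1 + 1) :=
      mul_le_mul_of_nonneg_left h2 hρ0.le
    have h5 : ρ * (1 + 1) = 1 / T := by rw [hρ]; field_simp; norm_num
    linarith
  have hsub : (⋃ x ∈ S, (fun z => x + ρ • z) '' K) ⊆ (1 + ρ) • K := by
    intro p hp
    simp only [Set.mem_iUnion] at hp
    obtain ⟨x, hx, z, hz, rfl⟩ := hp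
    have hadd := (convex_polarBall Θ r).add_smul zero_le_one hρ0.le
    rw [hadd, one_smul]
    exact Set.add_mem_add (hSK x hx) (Set.smul_mem_smul_set hz)
  have hle : (S.card : ENNReal) * (ENNReal.ofReal (ρ ^ d) * volume K)
      ≤ ENNReal.ofReal ((1 + ρ) ^ d) * volume K := by
    calc (S.card : ENNReal) * (ENNReal.ofReal (ρ ^ d) * volume K)
        = ∑ x ∈ S, volume ((fun z => x + ρ • z) '' K) := by simp [hvol]
      _ = volume (⋃ x ∈ S, (fun z => x + ρ • z) '' K) :=
          (measure_biUnion_finset hdisj fun x _ => hmeas x).symm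
      _ ≤ volume ((1 + ρ) • K) := measure_mono hsub
      _ = _ := by
          rw [Measure.addHaar_smul_of_nonneg _ (by positivity)]
          simp
  rw [← mul_assoc, ENNReal.mul_le_mul_iff_left hpos.ne' hfin] at hle
  rw [← ENNReal.ofReal_natCast, ← ENNReal.ofReal_mul (by positivity),
    ENNReal.ofReal_le_ofReal_iff (by positivity)] at hle
  have h6 : (1 + ρ) ^ d = ((2 * T + 1 : ℕ) : ℝ) ^ d * ρ ^ d := by
    rw [← mul_pow]
    congr 1
    rw [hρ]
    push_cast
    field_simp
  rw [h6] at hle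
  exact_mod_cast le_of_mul_le_mul_right hle (by positivity)

/-- A separated subset of largest cardinality is a cover: a point that it fails to represent could
be added to it. -/
lemma exists_isRewardCover {d T : ℕ} (hT : 2 ≤ T) (A : Set (Vec d)) :
    ∃ A₀ : Finset (Vec d), IsRewardCover A T 3 A₀ := by
  classical
  set Θ : Set (Vec d) := {θ | Admissible A θ}
  let P : ℕ → Prop := fun n => ∃ S : Finset (Vec d), S.card = n ∧ (∀ a ∈ S, a ∈ A) ∧
    ∀ x ∈ S, ∀ y ∈ S, x ≠ y → ∃ θ ∈ Θ, 1 / (T : ℝ) < |(inner ℝ (x - y) θ : ℝ)|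
  have hbound : ∀ n, P n → n ≤ (2 * T + 1) ^ d := by
    rintro _ ⟨S, rfl, hSA, hsep⟩
    exact card_le_of_separated (fun θ hθ => hθ.1) (by omega) S
      (fun x hx θ hθ => hθ.2 x (hSA x hx)) hsep
  have h0 : P 0 := ⟨∅, by simp⟩
  obtain ⟨S, hcard, hSA, hsep⟩ : P (Nat.findGreatest P ((2 * T + 1) ^ d)) :=
    Nat.findGreatest_spec (Nat.zero_le _) h0
  refine ⟨S, hSA, ?_, fun x hx => ?_⟩
  -- The source of κ = 3; it uses T ≥ 2.
  · have h1 : 2 * T + 1 ≤ T ^ 3 := by nlinarith [Nat.mul_le_mul hT hT]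
    rw [pow_mul, hcard]
    exact (Nat.findGreatest_le _).trans (Nat.pow_le_pow_left h1 d)
  · by_contra! hcon
    have hxS : x ∉ S := fun hxS => by
      obtain ⟨θ, -, h⟩ := hcon x hxS
      rw [sub_self, abs_zero] at h
      exact absurd h (not_lt.2 (by positivity))
    have hsep' : P (S.card + 1) := by
      refine ⟨insert x S, Finset.card_insert_of_notMem hxS, fun a ha => ?_, ?_⟩
      · rcases Finset.mem_insert.1 ha with rfl | ha
        exacts [hx, hSA a ha]
      · intro a ha b hb hab
        rcases Finset.mem_insert.1 ha with rfl | ha' <;>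
          rcases Finset.mem_insert.1 hb with rfl | hb'
        · exact absurd rfl hab
        · obtain ⟨θ, hθ, h⟩ := hcon b hb'
          exact ⟨θ, hθ, by rwa [inner_sub_left]⟩
        · obtain ⟨θ, hθ, h⟩ := hcon a ha'
          exact ⟨θ, hθ, by rwa [inner_sub_left, abs_sub_comm]⟩
        · exact hsep a ha' b hb' hab
    have := Nat.le_findGreatest (hbound _ hsep') hsep'
    omega

/-! ### Elementary inequalities -/

/-- Bernoulli's inequality for the exponent 1-α gives (1-α)(n+1)^(-α) ≤ (n+1)^(1-α) - n^(1-α), and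
2(1-α) ≥ 1 makes the sum telescope. -/
lemma sum_rpow_neg_le {α : ℝ} (h0 : 0 ≤ α) (h1 : α ≤ 1 / 2) (n : ℕ) :
    ∑ i ∈ Finset.range n, ((i : ℝ) + 1) ^ (-α) ≤ 2 * (n : ℝ) ^ (1 - α) := by
  induction n with
  | zero => simpa using Real.rpow_nonneg le_rfl _
  | succ n ih =>
    rw [Finset.sum_range_succ]
    have hn : (0 : ℝ) < (n : ℝ) + 1 := by positivity
    have hs : -1 ≤ -(1 / ((n : ℝ) + 1)) := by
      rw [neg_le_neg_iff, div_le_one hn]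
      linarith [Nat.cast_nonneg (α := ℝ) n]
    have hb := rpow_one_add_le_one_add_mul_self hs (p := 1 - α) (by linarith) (by linarith)
    have e1 : (n : ℝ) = ((n : ℝ) + 1) * (1 + -(1 / ((n : ℝ) + 1))) := by field_simp; ring
    have e2 : (n : ℝ) ^ (1 - α)
        = ((n : ℝ) + 1) ^ (1 - α) * (1 + -(1 / ((n : ℝ) + 1))) ^ (1 - α) := by
      conv_lhs => rw [e1]
      exact Real.mul_rpow hn.le (by linarith)
    have e3 : ((n : ℝ) + 1) ^ (1 - α) = ((n : ℝ) + 1) * ((n : ℝ) + 1) ^ (-α) := by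
      rw [sub_eq_add_neg, Real.rpow_add hn, Real.rpow_one]
    have h3 : (n : ℝ) ^ (1 - α)
        ≤ ((n : ℝ) + 1) ^ (1 - α) * (1 + (1 - α) * -(1 / ((n : ℝ) + 1))) := by
      rw [e2]; gcongr
    have h4 : ((n : ℝ) + 1) ^ (1 - α) * (1 + (1 - α) * -(1 / ((n : ℝ) + 1)))
        = ((n : ℝ) + 1) ^ (1 - α) - (1 - α) * ((n : ℝ) + 1) ^ (-α) := by
      rw [e3]; field_simp; ring
    have h5 : 0 ≤ ((n : ℝ) + 1) ^ (-α) := by positivity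
    push_cast
    nlinarith

/-! ### Deterministic properties of the algorithm -/

/-- The parameters with which MED-PE is analysed. -/
structure Input.IsTuned {d : ℕ} (I : Input d) : Prop where
  ε_pos : 0 < I.ε
  ε_le : I.ε ≤ 1
  υ_pos : 0 < I.υ
  two_le_T : 2 ≤ I.T
  γ_eq : I.γ = (I.T : ℝ) ^ (-(2 * I.ε / (1 + I.ε)))
  β_eq : I.β = 1

lemma Input.IsTuned.T_pos {d : ℕ} {I : Input d} (hI : I.IsTuned) : (0 : ℝ) < I.T := by
  have := hI.two_le_T
  positivity

lemma Input.IsTuned.γ_pos {d : ℕ} {I : Input d} (hI : I.IsTuned) : 0 < I.γ := by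
  rw [hI.γ_eq]
  exact Real.rpow_pos_of_pos hI.T_pos _

/-- The bound 8 = 2·1²·2·2 exceeds e, so the logarithm in the phase length is at least 1. -/
lemma eight_le_confidence {d : ℕ} {I : Input d} (hI : I.IsTuned) {l : ℕ} (hl : 1 ≤ l)
    {V : Finset (Vec d)} (hV : 1 < V.card) : (8 : ℝ) ≤ 2 * (l : ℝ) ^ 2 * V.card * I.T := by
  have h1 : (1 : ℝ) ≤ l := by exact_mod_cast hl
  have h2 : (2 : ℝ) ≤ V.card := by exact_mod_cast hV
  have h3 : (2 : ℝ) ≤ I.T := by exact_mod_cast hI.two_le_T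
  have h4 : (2 : ℝ) * 2 ≤ V.card * I.T := mul_le_mul h2 h3 (by norm_num) (by linarith)
  nlinarith [mul_le_mul (one_le_pow₀ h1 (n := 2)) h4 (by norm_num) (by positivity)]

lemma one_le_log_confidence {d : ℕ} {I : Input d} (hI : I.IsTuned) {l : ℕ} (hl : 1 ≤ l)
    {V : Finset (Vec d)} (hV : 1 < V.card) :
    1 ≤ Real.log (2 * (l : ℝ) ^ 2 * V.card * I.T) := by
  have h := eight_le_confidence hI hl hV
  rw [Real.le_log_iff_exp_le (by linarith)]
  linarith [Real.exp_one_lt_d9]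

lemma phaseLength_pos {d : ℕ} {I : Input d} {S : Selection d} (hS : S.IsValid I) (hI : I.IsTuned)
    {l : ℕ} (hl : 1 ≤ l) {V : Finset (Vec d)} (hVI : V ⊆ I.actions) (hV : 1 < V.card) :
    0 < phaseLength I S l V := by
  have h1 := optValue_pos hS hI.γ_pos hI.β_eq hVI hV
  have h2 := one_le_log_confidence hI hl hV
  have h3 := hI.υ_pos
  exact Nat.ceil_pos.2 (by positivity)

lemma eliminate_subset {d : ℕ} (I : Input d) (S : Selection d) (h : ℕ → Vec d × ℝ) (l : ℕ)
    (V : Finset (Vec d)) (s : ℕ) : eliminate I S h l V s ⊆ V :=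
  Finset.filter_subset _ _

lemma eliminate_nonempty {d : ℕ} (I : Input d) (S : Selection d) (h : ℕ → Vec d × ℝ) (l : ℕ)
    {V : Finset (Vec d)} (hV : V.Nonempty) (s : ℕ) : (eliminate I S h l V s).Nonempty := by
  have : Nonempty {a // a ∈ V} := ⟨⟨_, hV.choose_spec⟩⟩
  obtain ⟨a, ha⟩ := exists_eq_ciSup_of_finite
    (f := fun a : {a // a ∈ V} => (inner ℝ (S.fit V (rewardEstimate I S h l V s)) a.1 : ℝ))
  refine ⟨a.1, Finset.mem_filter.2 ⟨a.2, ?_⟩⟩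
  rw [← ha]
  have : (0 : ℝ) < (1 / 2) ^ l := by positivity
  linarith

lemma stateAt_succ {d : ℕ} (I : Input d) (S : Selection d) (h : ℕ → Vec d × ℝ) (t : ℕ) :
    stateAt I S h (t + 1) =
      if 1 < (stateAt I S h t).active.card ∧
          (stateAt I S h t).start
            + phaseLength I S (stateAt I S h t).phase (stateAt I S h t).active ≤ t + 1 then
        ⟨(stateAt I S h t).phase + 1,
          eliminate I S h (stateAt I S h t).phase (stateAt I S h t).active
            (stateAt I S h t).start, t + 1⟩
      else stateAt I S h t := rfl

/-- Invariants by induction on time. The last one traces the current state back to the start of its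
phase, where accuracy is formulated; `phase ≤ t + 1` keeps the number of phases within the horizon
finite. -/
lemma stateAt_basic {d : ℕ} {I : Input d} (S : Selection d) (hne : I.actions.Nonempty)
    (h : ℕ → Vec d × ℝ) (t : ℕ) :
    (stateAt I S h t).active ⊆ I.actions ∧ (stateAt I S h t).active.Nonempty ∧
      1 ≤ (stateAt I S h t).phase ∧ (stateAt I S h t).phase ≤ t + 1 ∧
      (stateAt I S h t).start ≤ t ∧
      stateAt I S h (stateAt I S h t).start = stateAt I S h t := by
  induction t with
  | zero => exact ⟨subset_rfl, hne, le_rfl, le_rfl, le_rfl, rfl⟩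
  | succ t ih =>
    obtain ⟨h1, h2, h3, h4, h5, h6⟩ := ih
    rw [stateAt_succ]
    split_ifs with hc
    · refine ⟨(eliminate_subset _ _ _ _ _ _).trans h1, eliminate_nonempty _ _ _ _ h2 _,
        by simp, by simpa using h4, le_rfl, ?_⟩
      simp only
      rw [stateAt_succ, if_pos hc]
    · exact ⟨h1, h2, h3, by omega, by omega, h6⟩

/-- Every change of the state increases the phase number, so equal phase numbers at two times force
equal states. -/
lemma stateAt_eq_or_phase_lt {d : ℕ} (I : Input d) (S : Selection d) (h : ℕ → Vec d × ℝ)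
    {s t : ℕ} (hst : s ≤ t) :
    stateAt I S h t = stateAt I S h s ∨ (stateAt I S h s).phase < (stateAt I S h t).phase := by
  induction t, hst using Nat.le_induction with
  | base => exact Or.inl rfl
  | succ t _ ih =>
    rw [stateAt_succ]
    split_ifs with hc
    · right
      rcases ih with ih | ih
      · rw [ih]; simp
      · simp only; omega
    · exact ih

/-- A phase begins at most once. -/
lemma stateAt_start_unique {d : ℕ} {I : Input d} {S : Selection d} {h : ℕ → Vec d × ℝ}
    {l s s' : ℕ} {V V' : Finset (Vec d)} (hs : stateAt I S h s = ⟨l, V, s⟩)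
    (hs' : stateAt I S h s' = ⟨l, V', s'⟩) : s = s' ∧ V = V' := by
  wlog hle : s ≤ s' generalizing s s' V V'
  · exact (this hs' hs (by omega)).imp Eq.symm Eq.symm
  rcases stateAt_eq_or_phase_lt I S h hle with he | he
  · rw [hs, hs'] at he
    injection he with _ h2 h3
    exact ⟨h3.symm, h2.symm⟩
  · rw [hs, hs'] at he
    exact absurd he (lt_irrefl _)

lemma stateAt_add_of_lt {d : ℕ} {I : Input d} {S : Selection d} {h : ℕ → Vec d × ℝ}
    {l s : ℕ} {V : Finset (Vec d)} (hs : stateAt I S h s = ⟨l, V, s⟩) {k : ℕ}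
    (hk : k < phaseLength I S l V) : stateAt I S h (s + k) = ⟨l, V, s⟩ := by
  induction k with
  | zero => exact hs
  | succ k ih =>
    rw [← add_assoc, stateAt_succ, ih (by omega), if_neg]
    simp only
    omega

lemma lt_start_add_phaseLength {d : ℕ} {I : Input d} {S : Selection d} (hS : S.IsValid I)
    (hI : I.IsTuned) (hne : I.actions.Nonempty) (h : ℕ → Vec d × ℝ) (t : ℕ)
    (hc : 1 < (stateAt I S h t).active.card) :
    t < (stateAt I S h t).start
      + phaseLength I S (stateAt I S h t).phase (stateAt I S h t).active := by
  have hb := stateAt_basic S hne h t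
  have hpos := phaseLength_pos hS hI hb.2.2.1 hb.1 hc
  by_contra! hcon
  set P := stateAt I S h t with hP
  have hlt : P.start < t := by omega
  obtain ⟨u, rfl⟩ : ∃ u, t = u + 1 := ⟨t - 1, by omega⟩
  -- The time u lies between the start of the phase and t, so the state was already P at u, and the
  -- update from u to t would have ended the phase.
  have hu : stateAt I S h u = P := by
    rcases stateAt_eq_or_phase_lt I S h (Nat.lt_succ_iff.1 hlt) with he | he
    · rw [he, hb.2.2.2.2.2]
    · rcases stateAt_eq_or_phase_lt I S h (Nat.le_succ u) with he' | he'
      · exact he'.symm.trans hP.symm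
      · rw [hb.2.2.2.2.2] at he
        rw [← Nat.succ_eq_add_one] at hP
        rw [← hP] at he'
        omega
  have hnext := stateAt_succ I S h u
  rw [hu, if_pos ⟨hc, hcon⟩, ← hP] at hnext
  rw [hnext] at hlt
  exact lt_irrefl _ hlt

/-- All estimates of all completed phases are accurate. -/
def IsAccurate {d : ℕ} (I : Input d) (S : Selection d) (θ : Vec d) (h : ℕ → Vec d × ℝ) : Prop :=
  ∀ s l V, stateAt I S h s = ⟨l, V, s⟩ → 1 < V.card → s + phaseLength I S l V ≤ I.T →
    ∀ a ∈ V, |rewardEstimate I S h l V s a - inner ℝ a θ| ≤ (1 / 2 : ℝ) ^ l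

/-- With e = 2^(-l), the true parameter fits the estimates within e, hence so does the minimizer,
whose predictions are then within 2e of the true rewards. The best arm thus trails the predicted
maximum by at most 4e, and a surviving arm has gap at most 2e + 4e + 2e. -/
lemma eliminate_spec {d : ℕ} {I : Input d} {S : Selection d} (hS : S.IsValid I) {θ : Vec d}
    {h : ℕ → Vec d × ℝ} {l s : ℕ} {V : Finset (Vec d)} (hVI : V ⊆ I.actions)
    (hacc : ∀ a ∈ V, |rewardEstimate I S h l V s a - inner ℝ a θ| ≤ (1 / 2 : ℝ) ^ l)
    {b : Vec d} (hbV : b ∈ V) (hb : ∀ a ∈ V, (inner ℝ a θ : ℝ) ≤ inner ℝ b θ) :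
    b ∈ eliminate I S h l V s ∧
      ∀ a ∈ eliminate I S h l V s, (inner ℝ b θ : ℝ) - inner ℝ a θ ≤ 8 * (1 / 2 : ℝ) ^ l := by
  have hne : Nonempty {a // a ∈ V} := ⟨⟨b, hbV⟩⟩
  set W := rewardEstimate I S h l V s with hW
  set e : ℝ := (1 / 2 : ℝ) ^ l with he
  have he0 : 0 < e := by positivity
  have hfit : ∀ a ∈ V, |(inner ℝ (S.fit V W) a : ℝ) - inner ℝ a θ| ≤ 2 * e := by
    intro a ha
    have h1 : |(inner ℝ (S.fit V W) a : ℝ) - W a| ≤ e := by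
      refine (le_ciSup (f := fun a : {a // a ∈ V} => |(inner ℝ (S.fit V W) a.1 : ℝ) - W a.1|)
        (Set.finite_range _).bddAbove ⟨a, ha⟩).trans ?_
      refine (hS.fit_le V hVI ⟨b, hbV⟩ W θ).trans (ciSup_le fun a' => ?_)
      rw [abs_sub_comm, real_inner_comm]
      exact hacc _ a'.2
    have h2 := hacc a ha
    rw [abs_le] at h1 h2 ⊢
    constructor <;> linarith
  have hsup : ∀ a ∈ V, (inner ℝ (S.fit V W) a : ℝ)
      ≤ ⨆ a' : {a' // a' ∈ V}, inner ℝ (S.fit V W) a'.1 := fun a ha =>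
    le_ciSup (f := fun a : {a // a ∈ V} => (inner ℝ (S.fit V W) a.1 : ℝ))
      (Set.finite_range _).bddAbove ⟨a, ha⟩
  refine ⟨Finset.mem_filter.2 ⟨hbV, ?_⟩, fun a ha => ?_⟩
  · rw [sub_le_iff_le_add]
    refine ciSup_le fun a' => ?_
    have h1 := abs_le.1 (hfit _ a'.2)
    have h2 := abs_le.1 (hfit _ hbV)
    have h3 := hb _ a'.2
    rw [← he]
    linarith
  · obtain ⟨haV, ha⟩ := Finset.mem_filter.1 ha
    have h1 := abs_le.1 (hfit _ haV)
    have h2 := abs_le.1 (hfit _ hbV)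
    have h3 := hsup b hbV
    rw [← he] at ha
    linarith

/-- A bound for the number of pulls in phase `l`, up to the factor `2 ^ (l (1 + ε) / ε)`. -/
noncomputable def lengthFactor {d : ℕ} (I : Input d) : ℝ :=
  (32 : ℝ) ^ ((1 + I.ε) / I.ε) * (1 + I.υ) ^ (1 / I.ε)
    * (2 * (d : ℝ) ^ ((1 + I.ε) / 2)) ^ (1 / I.ε)
    * Real.log (2 * (I.T : ℝ) ^ 3 * (I.actions.card : ℝ))

lemma one_le_lengthFactor {d : ℕ} {I : Input d} (hI : I.IsTuned) (hd : 1 ≤ d)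
    (hne : I.actions.Nonempty) : 1 ≤ lengthFactor I := by
  have hε := hI.ε_pos
  have hυ := hI.υ_pos
  have h3 : (2 : ℝ) ≤ I.T := by exact_mod_cast hI.two_le_T
  have h4 : (1 : ℝ) ≤ I.actions.card := by exact_mod_cast hne.card_pos
  have h5 : (1 : ℝ) ≤ d := by exact_mod_cast hd
  have hlog : 1 ≤ Real.log (2 * (I.T : ℝ) ^ 3 * (I.actions.card : ℝ)) := by
    have h8 : (2 : ℝ) ^ 3 ≤ (I.T : ℝ) ^ 3 := pow_le_pow_left₀ (by norm_num) h3 3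
    have h9 : (16 : ℝ) ≤ 2 * (I.T : ℝ) ^ 3 * (I.actions.card : ℝ) := by nlinarith
    rw [Real.le_log_iff_exp_le (by linarith)]
    linarith [Real.exp_one_lt_d9]
  have a1 : (1 : ℝ) ≤ (32 : ℝ) ^ ((1 + I.ε) / I.ε) :=
    Real.one_le_rpow (by norm_num) (by positivity)
  have a2 : (1 : ℝ) ≤ (1 + I.υ) ^ (1 / I.ε) := Real.one_le_rpow (by linarith) (by positivity)
  have a3 : (1 : ℝ) ≤ (2 * (d : ℝ) ^ ((1 + I.ε) / 2)) ^ (1 / I.ε) := by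
    refine Real.one_le_rpow ?_ (by positivity)
    have : (1 : ℝ) ≤ (d : ℝ) ^ ((1 + I.ε) / 2) := Real.one_le_rpow h5 (by positivity)
    linarith
  exact one_le_mul_of_one_le_of_one_le (one_le_mul_of_one_le_of_one_le
    (one_le_mul_of_one_le_of_one_le a1 a2) a3) hlog

lemma phaseLength_le {d : ℕ} {I : Input d} {S : Selection d} (hS : S.IsValid I) (hI : I.IsTuned)
    (hd : 1 ≤ d) {l : ℕ} (hl : 1 ≤ l) (hlT : l ≤ I.T) {V : Finset (Vec d)}
    (hVI : V ⊆ I.actions) (hV : 1 < V.card) :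
    (phaseLength I S l V : ℝ) ≤ 2 * lengthFactor I * ((2 : ℝ) ^ l) ^ ((1 + I.ε) / I.ε) := by
  have hε := hI.ε_pos
  have hυ := hI.υ_pos
  have hVne : V.Nonempty := Finset.card_pos.1 (by omega)
  have hM0 := optValue_pos hS hI.γ_pos hI.β_eq hVI hV
  have hM := optValue_le hS hε hI.ε_le hI.γ_pos hI.β_eq hVI hVne
  have hlog0 := one_le_log_confidence hI hl hV
  have hT0 := hI.T_pos
  have hlog : Real.log (2 * (l : ℝ) ^ 2 * V.card * I.T)
      ≤ Real.log (2 * (I.T : ℝ) ^ 3 * (I.actions.card : ℝ)) := by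
    refine Real.log_le_log (by linarith [eight_le_confidence hI hl hV]) ?_
    have h1 : (l : ℝ) ≤ I.T := by exact_mod_cast hlT
    have h2 : (V.card : ℝ) ≤ I.actions.card := by exact_mod_cast Finset.card_le_card hVI
    calc 2 * (l : ℝ) ^ 2 * V.card * I.T ≤ 2 * (I.T : ℝ) ^ 2 * I.actions.card * I.T := by gcongr
      _ = _ := by ring
  set p := (1 + I.ε) / I.ε with hp
  have hp0 : 0 < p := by positivity
  have hpow : ((1 / 2 : ℝ) ^ l) ^ (-p) = ((2 : ℝ) ^ l) ^ p := by
    rw [Real.rpow_neg (by positivity), ← Real.inv_rpow (by positivity), ← inv_pow]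
    norm_num
  have hle : (32 : ℝ) ^ p * (1 + I.υ) ^ (1 / I.ε) * ((1 / 2 : ℝ) ^ l) ^ (-p)
      * optValue I S V ^ (1 / I.ε) * Real.log (2 * (l : ℝ) ^ 2 * (V.card : ℝ) * (I.T : ℝ))
      ≤ lengthFactor I * ((2 : ℝ) ^ l) ^ p := by
    rw [hpow, lengthFactor, ← hp]
    calc _ ≤ (32 : ℝ) ^ p * (1 + I.υ) ^ (1 / I.ε) * ((2 : ℝ) ^ l) ^ p
          * (2 * (d : ℝ) ^ ((1 + I.ε) / 2)) ^ (1 / I.ε)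
          * Real.log (2 * (I.T : ℝ) ^ 3 * (I.actions.card : ℝ)) := by gcongr
      _ = _ := by ring
  -- Rounding up adds at most 1, which is at most the bound itself; hence the factor 2.
  have h1 : 1 ≤ lengthFactor I * ((2 : ℝ) ^ l) ^ p :=
    one_le_mul_of_one_le_of_one_le (one_le_lengthFactor hI hd (hVne.mono hVI))
      (Real.one_le_rpow (one_le_pow₀ (by norm_num)) hp0.le)
  have h2 := (Nat.ceil_lt_add_one (a := _) (by positivity)).le.trans (add_le_add_left hle 1)
  refine h2.trans ?_
  linarith

/-- What is known about the state at time `t` when all estimates are accurate. -/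
lemma stateAt_accurate {d : ℕ} {I : Input d} {S : Selection d} (hS : S.IsValid I)
    (hI : I.IsTuned) (hd : 1 ≤ d) {θ b : Vec d} (hbI : b ∈ I.actions)
    (hb : ∀ a ∈ I.actions, (inner ℝ a θ : ℝ) ≤ inner ℝ b θ)
    (hθ : ∀ a ∈ I.actions, |(inner ℝ a θ : ℝ)| ≤ 1) {h : ℕ → Vec d × ℝ}
    (hacc : IsAccurate I S θ h) {t : ℕ} (ht : t ≤ I.T) :
    b ∈ (stateAt I S h t).active ∧
      (∀ a ∈ (stateAt I S h t).active,
        (inner ℝ b θ : ℝ) - inner ℝ a θ ≤ 16 * (1 / 2 : ℝ) ^ (stateAt I S h t).phase) ∧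
      ((stateAt I S h t).start : ℝ) ≤ 2 * lengthFactor I
        * ((2 : ℝ) ^ (stateAt I S h t).phase) ^ ((1 + I.ε) / I.ε) := by
  have hne : I.actions.Nonempty := ⟨b, hbI⟩
  have hK := one_le_lengthFactor hI hd hne
  induction t with
  | zero =>
    refine ⟨hbI, fun a ha => ?_, ?_⟩
    · have h1 := abs_le.1 (hθ a ha)
      have h2 := abs_le.1 (hθ b hbI)
      simp only [stateAt]
      norm_num
      linarith
    · simp only [stateAt, Nat.cast_zero]
      positivity
  | succ t ih =>
    obtain ⟨ih1, ih2, ih3⟩ := ih (by omega)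
    have hbas := stateAt_basic S hne h t
    have hlt := lt_start_add_phaseLength hS hI hne h t
    rw [stateAt_succ]
    split_ifs with hc
    · have hlen := phaseLength_le hS hI hd hbas.2.2.1 (by omega) hbas.1 hc.1
      have hlt := hlt hc.1
      set P := stateAt I S h t with hP
      have hstart : stateAt I S h P.start = ⟨P.phase, P.active, P.start⟩ := hbas.2.2.2.2.2
      have hspec := eliminate_spec hS hbas.1
        (hacc P.start P.phase P.active hstart hc.1 (by omega)) ih1 fun a ha => hb a (hbas.1 ha)
      refine ⟨hspec.1, fun a ha => (hspec.2 a ha).trans (le_of_eq ?_), ?_⟩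
      -- 8·2^(-l) = 16·2^(-(l+1)): the gap bound is expressed in the new phase number.
      · simp only [pow_succ]; ring
      · simp only
        have h1 : ((t + 1 : ℕ) : ℝ) ≤ P.start + phaseLength I S P.phase P.active := by
          exact_mod_cast hlt
        -- Exponent at least 1 means that the length bound at least doubles per phase, so old start
        -- plus old length stays below the bound for the new start.
        have hp : (1 : ℝ) ≤ (1 + I.ε) / I.ε := by
          rw [le_div_iff₀ hI.ε_pos]; linarith
        have h2 : (2 : ℝ) * ((2 : ℝ) ^ P.phase) ^ ((1 + I.ε) / I.ε)
            ≤ ((2 : ℝ) ^ (P.phase + 1)) ^ ((1 + I.ε) / I.ε) := by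
          rw [pow_succ, Real.mul_rpow (by positivity) (by norm_num), mul_comm]
          refine mul_le_mul_of_nonneg_left ?_ (by positivity)
          simpa using Real.rpow_le_rpow_of_exponent_le (by norm_num : (1 : ℝ) ≤ 2) hp
        calc ((t + 1 : ℕ) : ℝ) ≤ P.start + phaseLength I S P.phase P.active := h1
          _ ≤ 2 * lengthFactor I * (2 * ((2 : ℝ) ^ P.phase) ^ ((1 + I.ε) / I.ε)) := by linarith
          _ ≤ _ := mul_le_mul_of_nonneg_left h2 (by positivity)
    · exact ⟨ih1, ih2, ih3⟩

/-- The current phase l ends by time 4K·2^(l(1+ε)/ε), so t+1 is at most this. Solving for 2^(-l)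
turns the gap bound of the phase into one in t alone. If a single arm is left, it is the best one.
-/
lemma gap_le_of_isAccurate {d : ℕ} {I : Input d} {S : Selection d} (hS : S.IsValid I)
    (hI : I.IsTuned) (hd : 1 ≤ d) {θ b : Vec d} (hbI : b ∈ I.actions)
    (hb : ∀ a ∈ I.actions, (inner ℝ a θ : ℝ) ≤ inner ℝ b θ)
    (hθ : ∀ a ∈ I.actions, |(inner ℝ a θ : ℝ)| ≤ 1) {h : ℕ → Vec d × ℝ}
    (hacc : IsAccurate I S θ h) {t : ℕ} (ht : t < I.T) {a : Vec d}
    (ha : a ∈ (stateAt I S h t).active) :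
    (inner ℝ b θ : ℝ) - inner ℝ a θ ≤
      16 * (4 * lengthFactor I) ^ (I.ε / (1 + I.ε)) * ((t : ℝ) + 1) ^ (-(I.ε / (1 + I.ε))) := by
  have hne : I.actions.Nonempty := ⟨b, hbI⟩
  have hK := one_le_lengthFactor hI hd hne
  have hε := hI.ε_pos
  obtain ⟨h1, h2, h3⟩ := stateAt_accurate hS hI hd hbI hb hθ hacc ht.le
  have hbas := stateAt_basic S hne h t
  have hlt := lt_start_add_phaseLength hS hI hne h t
  set P := stateAt I S h t with hP
  rcases Nat.lt_or_ge 1 P.active.card with hc | hc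
  · have hlen := phaseLength_le hS hI hd hbas.2.2.1 (by omega) hbas.1 hc
    have h4 : (t : ℝ) + 1 ≤ P.start + phaseLength I S P.phase P.active := by
      exact_mod_cast hlt hc
    have h5 : (t : ℝ) + 1 ≤ 4 * lengthFactor I * ((2 : ℝ) ^ P.phase) ^ ((1 + I.ε) / I.ε) := by
      linarith
    have h6 := Real.rpow_le_rpow (by positivity) h5 (z := I.ε / (1 + I.ε)) (by positivity)
    rw [Real.mul_rpow (by positivity) (by positivity), ← Real.rpow_mul (by positivity),
      show (1 + I.ε) / I.ε * (I.ε / (1 + I.ε)) = 1 by field_simp, Real.rpow_one] at h6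
    refine (h2 a ha).trans ?_
    rw [Real.rpow_neg (by positivity), mul_assoc, ← div_eq_mul_inv, one_div, inv_pow]
    refine mul_le_mul_of_nonneg_left ?_ (by norm_num)
    rw [le_div_iff₀ (by positivity), inv_mul_le_iff₀ (by positivity), mul_comm]
    exact h6
  · have hab : a = b := Finset.card_le_one.1 hc a ha b h1
    rw [hab, sub_self]
    positivity

/-- The power ε/(1+ε) turns the exponents (1+ε)/ε and 1/ε, unbounded as ε → 0, into 1 and 1/(1+ε),
so the constant 256 = 4·32·2 is absolute. -/
lemma lengthFactor_rpow_le {d : ℕ} {I : Input d} (hI : I.IsTuned)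
    (hne : I.actions.Nonempty) :
    (4 * lengthFactor I) ^ (I.ε / (1 + I.ε)) ≤ 256 * (1 + I.υ) ^ (1 / (1 + I.ε)) * Real.sqrt d
      * Real.log (2 * (I.T : ℝ) ^ 3 * (I.actions.card : ℝ)) ^ (I.ε / (1 + I.ε)) := by
  have hε := hI.ε_pos
  have hε1 := hI.ε_le
  have hυ := hI.υ_pos
  have hT : (2 : ℝ) ≤ I.T := by exact_mod_cast hI.two_le_T
  have hc : (1 : ℝ) ≤ I.actions.card := by exact_mod_cast hne.card_pos
  have hlog : 0 ≤ Real.log (2 * (I.T : ℝ) ^ 3 * (I.actions.card : ℝ)) := by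
    refine Real.log_nonneg ?_
    have := one_le_pow₀ (by linarith : (1 : ℝ) ≤ I.T) (n := 3)
    nlinarith
  rw [lengthFactor]
  rw [Real.mul_rpow (by norm_num) (by positivity), Real.mul_rpow (by positivity) hlog,
    Real.mul_rpow (by positivity) (by positivity), Real.mul_rpow (by positivity) (by positivity),
    ← Real.rpow_mul (by positivity), ← Real.rpow_mul (by positivity),
    ← Real.rpow_mul (by positivity),
    show (1 + I.ε) / I.ε * (I.ε / (1 + I.ε)) = 1 by field_simp,
    show 1 / I.ε * (I.ε / (1 + I.ε)) = 1 / (1 + I.ε) by field_simp,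
    Real.rpow_one, Real.mul_rpow (by norm_num) (by positivity), ← Real.rpow_mul (by positivity),
    show (1 + I.ε) / 2 * (1 / (1 + I.ε)) = 1 / 2 by field_simp, ← Real.sqrt_eq_rpow]
  have h4 : (4 : ℝ) ^ (I.ε / (1 + I.ε)) ≤ 4 := by
    conv_rhs => rw [← Real.rpow_one 4]
    refine Real.rpow_le_rpow_of_exponent_le (by norm_num) ?_
    rw [div_le_one (by positivity)]
    linarith
  have h2 : (2 : ℝ) ^ (1 / (1 + I.ε)) ≤ 2 := by
    conv_rhs => rw [← Real.rpow_one 2]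
    refine Real.rpow_le_rpow_of_exponent_le (by norm_num) ?_
    rw [div_le_one (by positivity)]
    linarith
  calc _ ≤ 4 * (32 * (1 + I.υ) ^ (1 / (1 + I.ε)) * (2 * Real.sqrt d)
        * Real.log (2 * (I.T : ℝ) ^ 3 * (I.actions.card : ℝ)) ^ (I.ε / (1 + I.ε))) := by gcongr
    _ = _ := by ring

/-- The regret bound on the event that all estimates are accurate. -/
lemma sum_gap_le_of_isAccurate {d : ℕ} {I : Input d} {S : Selection d} (hS : S.IsValid I)
    (hI : I.IsTuned) (hd : 1 ≤ d) {θ b : Vec d} (hbI : b ∈ I.actions)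
    (hb : ∀ a ∈ I.actions, (inner ℝ a θ : ℝ) ≤ inner ℝ b θ)
    (hθ : ∀ a ∈ I.actions, |(inner ℝ a θ : ℝ)| ≤ 1) {h : ℕ → Vec d × ℝ}
    (hacc : IsAccurate I S θ h)
    (hmem : ∀ t < I.T, (h t).1 ∈ (stateAt I S h t).active) :
    ∑ t ∈ Finset.range I.T, ((inner ℝ b θ : ℝ) - inner ℝ (h t).1 θ) ≤
      8192 * (1 + I.υ) ^ (1 / (1 + I.ε)) * Real.sqrt d
      * Real.log (2 * (I.T : ℝ) ^ 3 * (I.actions.card : ℝ)) ^ (I.ε / (1 + I.ε))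
      * (I.T : ℝ) ^ (1 / (1 + I.ε)) := by
  have hε := hI.ε_pos
  have hε1 := hI.ε_le
  have hK := one_le_lengthFactor hI hd ⟨b, hbI⟩
  set α := I.ε / (1 + I.ε) with hα
  have hα0 : 0 ≤ α := by positivity
  have hα1 : α ≤ 1 / 2 := by
    rw [hα, div_le_div_iff₀ (by positivity) (by norm_num)]; linarith
  have h1α : 1 - α = 1 / (1 + I.ε) := by rw [hα]; field_simp; ring
  calc ∑ t ∈ Finset.range I.T, ((inner ℝ b θ : ℝ) - inner ℝ (h t).1 θ)
      ≤ ∑ t ∈ Finset.range I.T, 16 * (4 * lengthFactor I) ^ α * ((t : ℝ) + 1) ^ (-α) :=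
        Finset.sum_le_sum fun t ht => gap_le_of_isAccurate hS hI hd hbI hb hθ hacc
          (Finset.mem_range.1 ht) (hmem t (Finset.mem_range.1 ht))
    _ = 16 * (4 * lengthFactor I) ^ α * ∑ t ∈ Finset.range I.T, ((t : ℝ) + 1) ^ (-α) := by
        rw [Finset.mul_sum]
    -- The constant 8192 is 16·256·2.
    _ ≤ 16 * (256 * (1 + I.υ) ^ (1 / (1 + I.ε)) * Real.sqrt d
      * Real.log (2 * (I.T : ℝ) ^ 3 * (I.actions.card : ℝ)) ^ α)
        * (2 * (I.T : ℝ) ^ (1 - α)) := by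
        refine mul_le_mul ?_ (sum_rpow_neg_le hα0 hα1 _)
          (Finset.sum_nonneg fun _ _ => by positivity) ?_
        · exact mul_le_mul_of_nonneg_left (lengthFactor_rpow_le hI ⟨b, hbI⟩) (by norm_num)
        · refine mul_nonneg (by norm_num) (le_trans ?_ (lengthFactor_rpow_le hI ⟨b, hbI⟩))
          positivity
    _ = _ := by rw [h1α]; ring

/-! ### Exponential moments of truncated variables -/

/-- A kept X satisfies exp z ≤ 1 + z + z² with |z| ≤ 1 and X² ≤ D^(1-ε)|X|^(1+ε). For a discarded X
the left side is 1, and B^(-ε)|X|^(1+ε) ≥ |X| compensates σX. The bound thus involves only the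
untruncated X, whose conditional mean is known. -/
lemma exp_trunc_le {ε B D σ : ℝ} (hε0 : 0 < ε) (hε1 : ε ≤ 1) (hB : 0 < B) (hBD : B ≤ D)
    (hσ : |σ| = 1) (X : ℝ) :
    Real.exp (σ * (if |X| ≤ B then X else 0) / D)
      ≤ 1 + (σ * X + B ^ (-ε) * |X| ^ (1 + ε)) / D + D ^ (-(1 + ε)) * |X| ^ (1 + ε) := by
  have hD : 0 < D := hB.trans_le hBD
  have hp : 0 ≤ |X| ^ (1 + ε) := by positivity
  split_ifs with h
  · have hz : |σ * X / D| ≤ 1 := by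
      rw [abs_div, abs_mul, hσ, one_mul, abs_of_pos hD, div_le_one hD]
      exact h.trans hBD
    have h1 := (abs_le.1 (Real.abs_exp_sub_one_sub_id_le hz)).2
    have h2 : (σ * X / D) ^ 2 ≤ D ^ (-(1 + ε)) * |X| ^ (1 + ε) := by
      have hX : X ^ 2 ≤ D ^ (1 - ε) * |X| ^ (1 + ε) := by
        have e1 : X ^ 2 = |X| ^ (1 - ε) * |X| ^ (1 + ε) := by
          rw [← Real.rpow_add' (abs_nonneg X) (by ring_nf; norm_num), ← sq_abs, ← Real.rpow_two]
          congr 1; ring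
        rw [e1]
        exact mul_le_mul_of_nonneg_right
          (Real.rpow_le_rpow (abs_nonneg X) (h.trans hBD) (by linarith)) hp
      have e2 : D ^ (-(1 + ε)) = D ^ (1 - ε) / D ^ 2 := by
        rw [← Real.rpow_two, ← Real.rpow_sub hD]
        congr 1; ring
      rw [e2, div_pow, mul_pow, ← sq_abs σ, hσ, one_pow, one_mul, div_mul_eq_mul_div]
      gcongr
    have h3 : 0 ≤ B ^ (-ε) * |X| ^ (1 + ε) / D := by positivity
    rw [add_div]
    linarith
  · push Not at h
    have hX0 : 0 < |X| := hB.trans h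
    have h1 : |X| ≤ B ^ (-ε) * |X| ^ (1 + ε) := by
      rw [Real.rpow_add hX0, Real.rpow_one, Real.rpow_neg hB.le, mul_left_comm]
      refine le_mul_of_one_le_right hX0.le ?_
      rw [inv_mul_eq_div, one_le_div (by positivity)]
      exact Real.rpow_le_rpow hB.le h.le hε0.le
    have h2 : -|X| ≤ σ * X := by
      have := neg_abs_le (σ * X)
      rwa [abs_mul, hσ, one_mul] at this
    have h3 : 0 ≤ (σ * X + B ^ (-ε) * |X| ^ (1 + ε)) / D := div_nonneg (by linarith) hD.le
    have h4 : 0 ≤ D ^ (-(1 + ε)) * |X| ^ (1 + ε) := by positivity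
    simp only [mul_zero, zero_div, Real.exp_zero]
    linarith

/-- One step of the exponential supermartingale argument: Z collects the earlier factors, and the
conditional mean and moment of X enter as integrals against Z. The last inequality is 1 + z ≤ exp z.
-/
lemma integral_mul_exp_trunc_le {Ω : Type*} [MeasurableSpace Ω] {μ : Measure Ω}
    {ε B D σ m u : ℝ} (hε0 : 0 < ε) (hε1 : ε ≤ 1) (hB : 0 < B) (hBD : B ≤ D) (hσ : |σ| = 1)
    {Z X : Ω → ℝ} (hZ0 : ∀ ω, 0 ≤ Z ω) (hZ : Integrable Z μ)
    (hZX : Integrable (fun ω => Z ω * X ω) μ)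
    (hZp : Integrable (fun ω => Z ω * |X ω| ^ (1 + ε)) μ)
    (hmean : ∫ ω, Z ω * X ω ∂μ = m * ∫ ω, Z ω ∂μ)
    (hmom : ∫ ω, Z ω * |X ω| ^ (1 + ε) ∂μ ≤ u * ∫ ω, Z ω ∂μ) :
    ∫ ω, Z ω * Real.exp (σ * (if |X ω| ≤ B then X ω else 0) / D) ∂μ
      ≤ Real.exp ((σ * m + u * B ^ (-ε)) / D + u * D ^ (-(1 + ε))) * ∫ ω, Z ω ∂μ := by
  have hD : 0 < D := hB.trans_le hBD
  set c : ℝ := B ^ (-ε) / D + D ^ (-(1 + ε)) with hc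
  have hc0 : 0 ≤ c := by positivity
  have hbound : ∀ ω, Z ω * Real.exp (σ * (if |X ω| ≤ B then X ω else 0) / D)
      ≤ Z ω + (σ / D) * (Z ω * X ω) + c * (Z ω * |X ω| ^ (1 + ε)) := by
    intro ω
    refine (mul_le_mul_of_nonneg_left (exp_trunc_le hε0 hε1 hB hBD hσ (X ω)) (hZ0 ω)).trans
      (le_of_eq ?_)
    rw [hc]
    field_simp
    ring
  have hle : ∫ ω, Z ω * Real.exp (σ * (if |X ω| ≤ B then X ω else 0) / D) ∂μ
      ≤ ∫ ω, (Z ω + (σ / D) * (Z ω * X ω) + c * (Z ω * |X ω| ^ (1 + ε))) ∂μ :=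
    integral_mono_of_nonneg
      (Filter.Eventually.of_forall fun ω => mul_nonneg (hZ0 ω) (Real.exp_nonneg _))
      ((hZ.add (hZX.const_mul _)).add (hZp.const_mul _)) (Filter.Eventually.of_forall hbound)
  have hI0 : 0 ≤ ∫ ω, Z ω ∂μ := integral_nonneg hZ0
  rw [integral_add (f := fun ω => Z ω + (σ / D) * (Z ω * X ω)) (hZ.add (hZX.const_mul _))
      (hZp.const_mul _), integral_add hZ (hZX.const_mul _), integral_const_mul,
    integral_const_mul, hmean] at hle
  refine hle.trans ?_
  calc _ ≤ ∫ ω, Z ω ∂μ + σ / D * (m * ∫ ω, Z ω ∂μ) + c * (u * ∫ ω, Z ω ∂μ) :=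
        add_le_add_right (mul_le_mul_of_nonneg_left hmom hc0) _
    _ = ((σ * m + u * B ^ (-ε)) / D + u * D ^ (-(1 + ε)) + 1) * ∫ ω, Z ω ∂μ := by
        rw [hc]; field_simp; ring
    _ ≤ _ := mul_le_mul_of_nonneg_right (Real.add_one_le_exp _) hI0

/-! ### Measurability of the algorithm -/

lemma measurable_invForm {d : ℕ} (γ : ℝ) (V : Finset (Vec d)) (w : Vec d → ℝ) (a : Vec d) :
    Measurable (invForm γ V w a) := by
  unfold invForm Matrix.mulVec dotProduct
  fun_prop

lemma measurable_trunc {Ω : Type*} [MeasurableSpace Ω] {X : Ω → ℝ} (hX : Measurable X) (B : ℝ) :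
    Measurable fun ω => if |X ω| ≤ B then X ω else 0 :=
  Measurable.ite (measurableSet_le hX.abs measurable_const) hX measurable_const

lemma measurable_rewardEstimate {d : ℕ} {Ω : Type*} [MeasurableSpace Ω] (I : Input d)
    (S : Selection d) {x : ℕ → Ω → Vec d} {y : ℕ → Ω → ℝ} {t l s : ℕ} {V : Finset (Vec d)}
    (hx : ∀ i < t, Measurable (x i)) (hy : ∀ i < t, Measurable (y i))
    (hst : s + phaseLength I S l V ≤ t) (a : Vec d) :
    Measurable fun ω => rewardEstimate I S (fun i => (x i ω, y i ω)) l V s a := by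
  unfold rewardEstimate truncMean
  refine Measurable.const_mul (Finset.measurable_sum _ fun i hi => ?_) _
  have hi' : s + i < t := by have := Finset.mem_range.1 hi; omega
  exact measurable_trunc (((measurable_invForm _ _ _ _).comp (hx _ hi')).mul (hy _ hi')) _

lemma measurableSet_eliminate_eq {d : ℕ} {Ω : Type*} [MeasurableSpace Ω] {I : Input d}
    {S : Selection d} (hS : S.IsValid I) {x : ℕ → Ω → Vec d} {y : ℕ → Ω → ℝ} {t l s : ℕ}
    {V : Finset (Vec d)} (hVI : V ⊆ I.actions) (hV : V.Nonempty)
    (hx : ∀ i < t, Measurable (x i)) (hy : ∀ i < t, Measurable (y i))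
    (hst : s + phaseLength I S l V ≤ t) (U : Finset (Vec d)) :
    MeasurableSet {ω | eliminate I S (fun i => (x i ω, y i ω)) l V s = U} := by
  have hfit : Measurable fun ω =>
      S.fit V (rewardEstimate I S (fun i => (x i ω, y i ω)) l V s) :=
    (hS.fit_measurable V hVI hV).comp
      (measurable_pi_lambda _ fun a => measurable_rewardEstimate I S hx hy hst a)
  have hin : ∀ a : Vec d, Measurable fun ω =>
      (inner ℝ (S.fit V (rewardEstimate I S (fun i => (x i ω, y i ω)) l V s)) a : ℝ) :=
    fun a => hfit.inner_const
  -- Outside V ∪ U neither set has elements, so equality is decided by finitely many membership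
  -- events.
  have hset : {ω | eliminate I S (fun i => (x i ω, y i ω)) l V s = U}
      = ⋂ a : Vec d, ⋂ _ : a ∈ V ∪ U,
        {ω | a ∈ eliminate I S (fun i => (x i ω, y i ω)) l V s ↔ a ∈ U} := by
    ext ω
    simp only [Set.mem_ofPred_eq, Set.mem_iInter]
    refine ⟨fun h a _ => by rw [h], fun h => Finset.ext fun a => ?_⟩
    by_cases ha : a ∈ V ∪ U
    · exact h a ha
    · rw [Finset.mem_union, not_or] at ha
      exact iff_of_false (fun h' => ha.1 (eliminate_subset _ _ _ _ _ _ h')) ha.2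
  rw [hset]
  refine Finset.measurableSet_biInter _ fun a _ => ?_
  have h1 : MeasurableSet {ω | a ∈ eliminate I S (fun i => (x i ω, y i ω)) l V s} := by
    simp only [eliminate, Finset.mem_filter]
    by_cases ha : a ∈ V
    · simp only [ha, true_and]
      exact measurableSet_le ((Measurable.iSup fun a' => hin _).sub_const _) (hin a)
    · simp [ha]
  by_cases ha : a ∈ U
  · simpa [ha] using h1
  · simp only [ha, iff_false]
    exact h1.compl

/-- The states that can occur at time `t`. -/
def possibleStates {d : ℕ} (I : Input d) (t : ℕ) : Set (PhaseState d) :=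
  {P | P.phase ≤ t + 1 ∧ P.active ⊆ I.actions ∧ P.active.Nonempty ∧ P.start ≤ t}

lemma finite_possibleStates {d : ℕ} (I : Input d) (t : ℕ) : (possibleStates I t).Finite := by
  classical
  refine ((Finset.range (t + 2) ×ˢ I.actions.powerset ×ˢ Finset.range (t + 1)).finite_toSet.image
    fun q => (⟨q.1, q.2.1, q.2.2⟩ : PhaseState d)).subset ?_
  rintro ⟨l, V, s⟩ ⟨h1, h2, -, h3⟩
  simp only at h1 h2 h3
  refine ⟨(l, V, s), ?_, rfl⟩
  simp only [Finset.coe_product, Set.mem_prod, Finset.mem_coe, Finset.mem_range,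
    Finset.mem_powerset]
  exact ⟨by omega, h2, by omega⟩

lemma stateAt_mem_possibleStates {d : ℕ} {I : Input d} (S : Selection d)
    (hne : I.actions.Nonempty) (h : ℕ → Vec d × ℝ) (t : ℕ) :
    stateAt I S h t ∈ possibleStates I t := by
  obtain ⟨h1, h2, -, h3, h4, -⟩ := stateAt_basic S hne h t
  exact ⟨h3, h1, h2, h4⟩

/-- Only the first t observations need to be measurable, so the σ-algebra may be taken to be
`pastInfo x y t` itself. -/
lemma measurableSet_stateAt_eq {d : ℕ} {Ω : Type*} [MeasurableSpace Ω] {I : Input d}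
    {S : Selection d} (hS : S.IsValid I) (hne : I.actions.Nonempty) {x : ℕ → Ω → Vec d}
    {y : ℕ → Ω → ℝ} {t : ℕ} (hx : ∀ i < t, Measurable (x i)) (hy : ∀ i < t, Measurable (y i))
    (P : PhaseState d) :
    MeasurableSet {ω | stateAt I S (fun i => (x i ω, y i ω)) t = P} := by
  induction t generalizing P with
  | zero => exact MeasurableSet.const (⟨1, I.actions, 0⟩ = P)
  | succ t ih =>
    have ih := ih (fun i hi => hx i (by omega)) (fun i hi => hy i (by omega))
    have hset : {ω | stateAt I S (fun i => (x i ω, y i ω)) (t + 1) = P}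
        = ⋃ Q ∈ possibleStates I t, {ω | stateAt I S (fun i => (x i ω, y i ω)) t = Q} ∩
          {ω | (if 1 < Q.active.card ∧ Q.start + phaseLength I S Q.phase Q.active ≤ t + 1 then
            ⟨Q.phase + 1, eliminate I S (fun i => (x i ω, y i ω)) Q.phase Q.active Q.start, t + 1⟩
            else Q) = P} := by
      ext ω
      simp only [Set.mem_ofPred_eq, Set.mem_iUnion, Set.mem_inter_iff, stateAt_succ]
      constructor
      · exact fun h => ⟨_, stateAt_mem_possibleStates S hne _ t, rfl, h⟩
      · rintro ⟨Q, -, rfl, h⟩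
        exact h
    rw [hset]
    refine MeasurableSet.biUnion (finite_possibleStates I t).countable fun Q hQ => (ih Q).inter ?_
    split_ifs with hc
    · have : {ω | (⟨Q.phase + 1, eliminate I S (fun i => (x i ω, y i ω)) Q.phase Q.active Q.start,
          t + 1⟩ : PhaseState d) = P}
          = {_ω | Q.phase + 1 = P.phase} ∩
            {ω | eliminate I S (fun i => (x i ω, y i ω)) Q.phase Q.active Q.start = P.active}
            ∩ {_ω | t + 1 = P.start} := by
        ext ω
        obtain ⟨l, V, s⟩ := P
        simp [and_assoc]
      rw [this]
      exact ((MeasurableSet.const _).inter (measurableSet_eliminate_eq hS hQ.2.1 hQ.2.2.1 hx hy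
        hc.2 _)).inter (MeasurableSet.const _)
    · exact MeasurableSet.const _

/-! ### Conditioning on the past -/

section Past

variable {d : ℕ} {Ω : Type*} {x : ℕ → Ω → Vec d} {y : ℕ → Ω → ℝ}

lemma measurable_action_pastInfo {i t : ℕ} (hi : i < t) : Measurable[pastInfo x y t] (x i) :=
  ((measurable_fst.comp (measurable_pi_apply (⟨i, hi⟩ : Fin t))).comp
    (comap_measurable fun ω (s : Fin t) => (x s ω, y s ω)) :)

lemma measurable_reward_pastInfo {i t : ℕ} (hi : i < t) : Measurable[pastInfo x y t] (y i) :=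
  ((measurable_snd.comp (measurable_pi_apply (⟨i, hi⟩ : Fin t))).comp
    (comap_measurable fun ω (s : Fin t) => (x s ω, y s ω)) :)

lemma pastInfo_le [MeasurableSpace Ω] (hx : ∀ t, Measurable (x t)) (hy : ∀ t, Measurable (y t))
    (t : ℕ) : pastInfo x y t ≤ ‹MeasurableSpace Ω› :=
  Measurable.comap_le (measurable_pi_lambda _ fun s => (hx s).prodMk (hy s))

lemma pastInfoWithAction_le [MeasurableSpace Ω] (hx : ∀ t, Measurable (x t))
    (hy : ∀ t, Measurable (y t)) (t : ℕ) : pastInfoWithAction x y t ≤ ‹MeasurableSpace Ω› :=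
  sup_le (pastInfo_le hx hy t) (hx t).comap_le

lemma measurableSet_action_eq (t : ℕ) (b : Vec d) :
    MeasurableSet[pastInfoWithAction x y t] {ω | x t ω = b} := by
  have h : MeasurableSet[MeasurableSpace.comap (x t) inferInstance] {ω | x t ω = b} :=
    ⟨{b}, measurableSet_singleton b, rfl⟩
  exact (le_sup_right : _ ≤ pastInfoWithAction x y t) _ h

end Past

lemma integral_mul_condExp_of_bound {Ω : Type*} {m m0 : MeasurableSpace Ω} {μ : Measure Ω}
    [IsFiniteMeasure μ] (hm : m ≤ m0) {Z f : Ω → ℝ} (hZ : Measurable[m] Z) (C : ℝ)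
    (hC : ∀ ω, |Z ω| ≤ C) (hf : Integrable f μ) :
    ∫ ω, Z ω * f ω ∂μ = ∫ ω, Z ω * (μ[f | m]) ω ∂μ := by
  rw [← integral_condExp hm]
  exact integral_congr_ae (condExp_stronglyMeasurable_mul_of_bound hm hZ.stronglyMeasurable hf C
    (Filter.Eventually.of_forall hC))

/-- The indicator function of the event that the action of time `t` is `b`. -/
noncomputable def actionInd {d : ℕ} {Ω : Type*} (x : ℕ → Ω → Vec d) (t : ℕ) (b : Vec d) :
    Ω → ℝ :=
  Set.indicator {ω | x t ω = b} fun _ => 1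

lemma actionInd_nonneg {d : ℕ} {Ω : Type*} (x : ℕ → Ω → Vec d) (t : ℕ) (b : Vec d) (ω : Ω) :
    0 ≤ actionInd x t b ω :=
  Set.indicator_nonneg (fun _ _ => zero_le_one) ω

lemma abs_actionInd_le {d : ℕ} {Ω : Type*} (x : ℕ → Ω → Vec d) (t : ℕ) (b : Vec d) (ω : Ω) :
    |actionInd x t b ω| ≤ 1 := by
  unfold actionInd Set.indicator
  split_ifs <;> simp

lemma measurable_actionInd {d : ℕ} {Ω : Type*} [MeasurableSpace Ω] {x : ℕ → Ω → Vec d} {t : ℕ}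
    (hx : Measurable (x t)) (b : Vec d) : Measurable (actionInd x t b) :=
  measurable_const.indicator (hx (measurableSet_singleton b))

lemma measurable_mul_actionInd {d : ℕ} {Ω : Type*} {x : ℕ → Ω → Vec d} {y : ℕ → Ω → ℝ}
    {t : ℕ} {Z : Ω → ℝ} (hZ : Measurable[pastInfo x y t] Z) (b : Vec d) :
    Measurable[pastInfoWithAction x y t] fun ω => Z ω * actionInd x t b ω :=
  (hZ.mono le_sup_left le_rfl).mul (measurable_const.indicator (measurableSet_action_eq t b))

lemma abs_mul_actionInd_le {d : ℕ} {Ω : Type*} (x : ℕ → Ω → Vec d) (t : ℕ) {Z : Ω → ℝ} {C : ℝ}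
    (hC : ∀ ω, |Z ω| ≤ C) (b : Vec d) (ω : Ω) :
    |Z ω * actionInd x t b ω| ≤ C := by
  rw [abs_mul]
  exact (mul_le_of_le_one_right (abs_nonneg _) (abs_actionInd_le x t b ω)).trans (hC ω)

section Run

variable {d : ℕ} {Ω : Type*} [MeasurableSpace Ω] {μ : Measure Ω} [IsProbabilityMeasure μ]
  {I : Input d} {S : Selection d} {θ : Vec d} {x : ℕ → Ω → Vec d} {y : ℕ → Ω → ℝ}

/-- Wherever Z does not vanish the active set is V, so the conditional probability of b is the
constant `S.design V b`. -/
lemma integral_mul_actionInd (hR : IsRun μ I S θ x y) {t : ℕ} (ht : t < I.T) {Z : Ω → ℝ}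
    (hZ : Measurable[pastInfo x y t] Z) {C : ℝ} (hC : ∀ ω, |Z ω| ≤ C) {V : Finset (Vec d)}
    (hV : ∀ ω, Z ω ≠ 0 → (stateAt I S (fun s => (x s ω, y s ω)) t).active = V) {b : Vec d}
    (hb : b ∈ I.actions) :
    ∫ ω, Z ω * actionInd x t b ω ∂μ = S.design V b * ∫ ω, Z ω ∂μ := by
  have hx := hR.bandit.measurable_action
  have hy := hR.bandit.measurable_reward
  have hint : Integrable (actionInd x t b) μ :=
    Integrable.of_bound (measurable_actionInd (hx t) b).aestronglyMeasurable 1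
      (Filter.Eventually.of_forall (abs_actionInd_le x t b))
  rw [integral_mul_condExp_of_bound (pastInfo_le hx hy t) hZ C hC hint, ← integral_const_mul]
  refine integral_congr_ae ?_
  filter_upwards [hR.draw t ht b hb] with ω hω
  change Z ω * (μ[Set.indicator {ω | x t ω = b} (fun _ => (1 : ℝ)) | pastInfo x y t]) ω = _
  rw [hω]
  by_cases h0 : Z ω = 0
  · simp [h0]
  · rw [hV ω h0, mul_comm]

end Run

/-- Convexity of the power at the midpoint of 1 and |η|, with 2^(1+ε) ≤ 4. This produces the factor
2(1+υ) in the moment of a reward. -/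
lemma one_add_abs_rpow_le {ε c η : ℝ} (hε0 : 0 < ε) (hε1 : ε ≤ 1) (hc : |c| ≤ 1) :
    |c + η| ^ (1 + ε) ≤ 2 * (1 + |η| ^ (1 + ε)) := by
  have h1 : |c + η| ≤ 2 * (1 / 2 * 1 + 1 / 2 * |η|) := by
    have := abs_add_le c η
    linarith
  have h2 := (convexOn_rpow (p := 1 + ε) (by linarith)).2 (Set.mem_Ici.2 zero_le_one)
    (Set.mem_Ici.2 (abs_nonneg η)) (by norm_num : (0 : ℝ) ≤ 1 / 2) (by norm_num : (0 : ℝ) ≤ 1 / 2)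
    (by norm_num)
  simp only [smul_eq_mul] at h2
  have h3 : (2 : ℝ) ^ (1 + ε) ≤ 4 := by
    calc (2 : ℝ) ^ (1 + ε) ≤ 2 ^ (2 : ℝ) :=
          Real.rpow_le_rpow_of_exponent_le (by norm_num) (by linarith)
      _ = 4 := by norm_num
  calc |c + η| ^ (1 + ε) ≤ (2 * (1 / 2 * 1 + 1 / 2 * |η|)) ^ (1 + ε) :=
        Real.rpow_le_rpow (abs_nonneg _) h1 (by linarith)
    _ = 2 ^ (1 + ε) * (1 / 2 * 1 + 1 / 2 * |η|) ^ (1 + ε) :=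
        Real.mul_rpow (by norm_num) (by positivity)
    _ ≤ 4 * (1 / 2 * 1 ^ (1 + ε) + 1 / 2 * |η| ^ (1 + ε)) := by gcongr
    _ = _ := by rw [Real.one_rpow]; ring

lemma sum_mul_actionInd_eq {d : ℕ} {Ω : Type*} (x : ℕ → Ω → Vec d) (t : ℕ) {V : Finset (Vec d)}
    (f : Vec d → ℝ) {ω : Ω} (hω : x t ω ∈ V) :
    ∑ b ∈ V, f b * actionInd x t b ω = f (x t ω) := by
  rw [Finset.sum_eq_single (x t ω)]
  · simp [actionInd]
  · intro b _ hb
    have : ω ∉ {ω | x t ω = b} := fun h => hb (h : x t ω = b).symm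
    simp [actionInd, Set.indicator_of_notMem this]
  · exact fun h => absurd hω h

lemma pastInfo_mono {d : ℕ} {Ω : Type*} {x : ℕ → Ω → Vec d} {y : ℕ → Ω → ℝ} {s t : ℕ}
    (hst : s ≤ t) : pastInfo x y s ≤ pastInfo x y t := by
  refine measurable_iff_comap_le.1 (@measurable_pi_lambda _ _ _ (pastInfo x y t) _ _ fun i => ?_)
  exact (measurable_action_pastInfo (i.2.trans_le hst)).prodMk
    (measurable_reward_pastInfo (i.2.trans_le hst))

lemma measurableSet_stateAt_eq_pastInfo {d : ℕ} {Ω : Type*} {I : Input d} {S : Selection d}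
    (hS : S.IsValid I) (hne : I.actions.Nonempty) {x : ℕ → Ω → Vec d} {y : ℕ → Ω → ℝ} (t : ℕ)
    (P : PhaseState d) :
    MeasurableSet[pastInfo x y t] {ω | stateAt I S (fun i => (x i ω, y i ω)) t = P} :=
  @measurableSet_stateAt_eq d Ω (pastInfo x y t) I S hS hne x y t
    (fun _ hi => measurable_action_pastInfo hi) (fun _ hi => measurable_reward_pastInfo hi) P

section Run

variable {d : ℕ} {Ω : Type*} [MeasurableSpace Ω] {μ : Measure Ω} [IsProbabilityMeasure μ]
  {I : Input d} {S : Selection d} {θ : Vec d} {x : ℕ → Ω → Vec d} {y : ℕ → Ω → ℝ}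

/-- The weight is determined once the action of time t is chosen, so the mean-zero condition given
past and action applies. -/
lemma integral_mul_actionInd_mul_noise (hR : IsRun μ I S θ x y) {t : ℕ} (ht : t < I.T)
    {Z : Ω → ℝ} (hZ : Measurable[pastInfo x y t] Z) {C : ℝ} (hC : ∀ ω, |Z ω| ≤ C) (b : Vec d) :
    ∫ ω, Z ω * actionInd x t b ω * (y t ω - inner ℝ (x t ω) θ) ∂μ = 0 := by
  have hx := hR.bandit.measurable_action
  have hy := hR.bandit.measurable_reward
  rw [integral_mul_condExp_of_bound (pastInfoWithAction_le hx hy t)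
    (measurable_mul_actionInd hZ b) C (abs_mul_actionInd_le x t hC b)
    (hR.bandit.integrable_noise t ht)]
  refine integral_eq_zero_of_ae ?_
  filter_upwards [hR.bandit.noise_mean t ht] with ω hω
  rw [hω]
  simp

lemma integral_mul_actionInd_mul_moment_le (hR : IsRun μ I S θ x y) {t : ℕ} (ht : t < I.T)
    {Z : Ω → ℝ} (hZ : Measurable[pastInfo x y t] Z) {C : ℝ} (hC : ∀ ω, |Z ω| ≤ C)
    (hZ0 : ∀ ω, 0 ≤ Z ω) (b : Vec d) :
    ∫ ω, Z ω * actionInd x t b ω * |y t ω - inner ℝ (x t ω) θ| ^ (1 + I.ε) ∂μ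
      ≤ I.υ * ∫ ω, Z ω * actionInd x t b ω ∂μ := by
  have hx := hR.bandit.measurable_action
  have hy := hR.bandit.measurable_reward
  have hle := pastInfoWithAction_le hx hy t
  have hm := measurable_mul_actionInd hZ b
  have hint : Integrable (fun ω => Z ω * actionInd x t b ω) μ :=
    Integrable.of_bound (hm.mono hle le_rfl).aestronglyMeasurable C
      (Filter.Eventually.of_forall (abs_mul_actionInd_le x t hC b))
  rw [integral_mul_condExp_of_bound hle hm C (abs_mul_actionInd_le x t hC b)
    (hR.bandit.integrable_moment t ht), ← integral_const_mul]
  refine integral_mono_ae ?_ (hint.const_mul _) ?_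
  · exact integrable_condExp.bdd_mul (hm.mono hle le_rfl).aestronglyMeasurable
      (Filter.Eventually.of_forall (abs_mul_actionInd_le x t hC b))
  · filter_upwards [hR.bandit.noise_moment t ht] with ω hω
    rw [mul_comm I.υ]
    exact mul_le_mul_of_nonneg_left hω (mul_nonneg (hZ0 ω) (actionInd_nonneg x t b ω))

/-- The conditional probabilities of the active arms sum to one, so on each of the finitely many
possible states the event of leaving the active set has probability zero. -/
lemma ae_action_mem_active (hS : S.IsValid I) (hne : I.actions.Nonempty)
    (hR : IsRun μ I S θ x y) :
    ∀ᵐ ω ∂μ, ∀ t < I.T, x t ω ∈ (stateAt I S (fun s => (x s ω, y s ω)) t).active := by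
  have hx := hR.bandit.measurable_action
  have hy := hR.bandit.measurable_reward
  rw [ae_all_iff]
  intro t
  by_cases ht : t < I.T
  swap
  · exact Filter.Eventually.of_forall fun ω h => absurd h ht
  have key : ∀ P ∈ possibleStates I t, ∀ᵐ ω ∂μ,
      stateAt I S (fun s => (x s ω, y s ω)) t = P → x t ω ∈ P.active := by
    intro P hP
    have hmeas := measurableSet_stateAt_eq_pastInfo (x := x) (y := y) hS hne t P
    set B := {ω | stateAt I S (fun s => (x s ω, y s ω)) t = P} with hB
    have hZ : Measurable[pastInfo x y t] (B.indicator fun _ => (1 : ℝ)) :=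
      measurable_const.indicator hmeas
    have hC : ∀ ω, |B.indicator (fun _ => (1 : ℝ)) ω| ≤ 1 := fun ω => by
      unfold Set.indicator
      split_ifs <;> simp
    have hsupp : ∀ ω, B.indicator (fun _ => (1 : ℝ)) ω ≠ 0 →
        (stateAt I S (fun s => (x s ω, y s ω)) t).active = P.active := fun ω h => by
      have : ω ∈ B := Set.mem_of_indicator_ne_zero h
      rw [show stateAt I S (fun s => (x s ω, y s ω)) t = P from this]
    have hZ' := hZ.mono (pastInfo_le hx hy t) le_rfl
    have hZi : Integrable (B.indicator fun _ => (1 : ℝ)) μ :=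
      Integrable.of_bound hZ'.aestronglyMeasurable 1 (Filter.Eventually.of_forall hC)
    have hbi : ∀ b, Integrable (fun ω => B.indicator (fun _ => (1 : ℝ)) ω * actionInd x t b ω) μ :=
      fun b => Integrable.of_bound
        (hZ'.mul (measurable_actionInd (hx t) b)).aestronglyMeasurable 1
        (Filter.Eventually.of_forall (abs_mul_actionInd_le x t hC b))
    have hsum0 : ∀ ω, 0 ≤ 1 - ∑ b ∈ P.active, actionInd x t b ω := by
      intro ω
      by_cases h : x t ω ∈ P.active
      · have := sum_mul_actionInd_eq x t (fun _ => 1) h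
        simp only [one_mul] at this
        rw [this, sub_self]
      · rw [Finset.sum_eq_zero]
        · norm_num
        · intro b hb
          have : ω ∉ {ω | x t ω = b} := fun h' => h ((h' : x t ω = b) ▸ hb)
          simp [actionInd, Set.indicator_of_notMem this]
    have hint : ∫ ω, B.indicator (fun _ => (1 : ℝ)) ω
        * (1 - ∑ b ∈ P.active, actionInd x t b ω) ∂μ = 0 := by
      simp only [mul_sub, mul_one, Finset.mul_sum]
      rw [integral_sub hZi (integrable_finsetSum _ fun b _ => hbi b),
        integral_finsetSum _ fun b _ => hbi b,
        Finset.sum_congr rfl fun b hb =>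
          integral_mul_actionInd hR ht hZ hC hsupp (hP.2.1 hb),
        ← Finset.sum_mul, (hS.isDesign _ hP.2.1 hP.2.2.1).2.2, one_mul, sub_self]
    rw [integral_eq_zero_iff_of_nonneg] at hint
    · filter_upwards [hint] with ω hω hst
      have hωB : ω ∈ B := hst
      have h1 : B.indicator (fun _ => (1 : ℝ)) ω = 1 := Set.indicator_of_mem hωB _
      by_contra hcon
      rw [h1, one_mul, Finset.sum_eq_zero] at hω
      · simp at hω
      · intro b hb
        have : ω ∉ {ω | x t ω = b} := fun h' => hcon ((h' : x t ω = b) ▸ hb)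
        simp [actionInd, Set.indicator_of_notMem this]
    · intro ω
      exact mul_nonneg (Set.indicator_nonneg (fun _ _ => zero_le_one) _) (hsum0 ω)
    · simp only [mul_sub, mul_one, Finset.mul_sum]
      exact hZi.sub (integrable_finsetSum _ fun b _ => hbi b)
  filter_upwards [(ae_ball_iff (finite_possibleStates I t).countable).2 key] with ω hω _
  exact hω _ (stateAt_mem_possibleStates S hne _ t) rfl

/-- First moment of the samples of one phase. -/
lemma integral_mul_sample (hS : S.IsValid I) (hne : I.actions.Nonempty)
    (hR : IsRun μ I S θ x y) {t : ℕ} (ht : t < I.T) {Z : Ω → ℝ}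
    (hZ : Measurable[pastInfo x y t] Z) {C : ℝ} (hC : ∀ ω, |Z ω| ≤ C) {V : Finset (Vec d)}
    (hVI : V ⊆ I.actions)
    (hV : ∀ ω, Z ω ≠ 0 → (stateAt I S (fun s => (x s ω, y s ω)) t).active = V) (g : Vec d → ℝ) :
    Integrable (fun ω => Z ω * (g (x t ω) * y t ω)) μ ∧
      ∫ ω, Z ω * (g (x t ω) * y t ω) ∂μ
        = (∑ b ∈ V, S.design V b * (g b * inner ℝ b θ)) * ∫ ω, Z ω ∂μ := by
  have hx := hR.bandit.measurable_action
  have hy := hR.bandit.measurable_reward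
  have hZ' := hZ.mono (pastInfo_le hx hy t) le_rfl
  have hmb : ∀ b, AEStronglyMeasurable (fun ω => Z ω * actionInd x t b ω) μ := fun b =>
    (hZ'.mul (measurable_actionInd (hx t) b)).aestronglyMeasurable
  have hbi : ∀ b, Integrable (fun ω => Z ω * actionInd x t b ω) μ := fun b =>
    Integrable.of_bound (hmb b) C (Filter.Eventually.of_forall (abs_mul_actionInd_le x t hC b))
  have hbn : ∀ b, Integrable
      (fun ω => Z ω * actionInd x t b ω * (y t ω - inner ℝ (x t ω) θ)) μ := fun b =>
    (hR.bandit.integrable_noise t ht).bdd_mul (hmb b)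
      (Filter.Eventually.of_forall (abs_mul_actionInd_le x t hC b))
  -- Splitting by the arm played makes g and the mean reward constant in each summand; only
  -- indicator and noise remain random besides Z.
  have hae : (fun ω => Z ω * (g (x t ω) * y t ω)) =ᵐ[μ]
      fun ω => ∑ b ∈ V, ((g b * inner ℝ b θ) * (Z ω * actionInd x t b ω)
        + g b * (Z ω * actionInd x t b ω * (y t ω - inner ℝ (x t ω) θ))) := by
    filter_upwards [ae_action_mem_active hS hne hR] with ω hω
    by_cases h0 : Z ω = 0
    · simp [h0]
    have hmem : x t ω ∈ V := hV ω h0 ▸ hω t ht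
    have hsum := sum_mul_actionInd_eq x t (fun b => Z ω * (g b * inner ℝ b θ)
      + Z ω * g b * (y t ω - inner ℝ (x t ω) θ)) hmem
    calc Z ω * (g (x t ω) * y t ω) = _ := by ring
      _ = _ := hsum.symm
      _ = _ := Finset.sum_congr rfl fun b _ => by ring
  have hterm : ∀ b ∈ V, Integrable (fun ω => (g b * inner ℝ b θ) * (Z ω * actionInd x t b ω)
        + g b * (Z ω * actionInd x t b ω * (y t ω - inner ℝ (x t ω) θ))) μ := fun b _ =>
    ((hbi b).const_mul _).add ((hbn b).const_mul _)
  refine ⟨(integrable_finsetSum _ hterm).congr hae.symm, ?_⟩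
  rw [integral_congr_ae hae, integral_finsetSum _ hterm, Finset.sum_mul]
  refine Finset.sum_congr rfl fun b hb => ?_
  rw [integral_add ((hbi b).const_mul _) ((hbn b).const_mul _), integral_const_mul,
    integral_const_mul, integral_mul_actionInd_mul_noise hR ht hZ hC b,
    integral_mul_actionInd hR ht hZ hC hV (hVI hb)]
  ring

/-- Absolute moment of order `1 + ε` of the samples of one phase. -/
lemma integral_mul_abs_sample_rpow_le (hI : I.IsTuned) (hS : S.IsValid I)
    (hne : I.actions.Nonempty) (hθ : ∀ a ∈ I.actions, |(inner ℝ a θ : ℝ)| ≤ 1)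
    (hR : IsRun μ I S θ x y) {t : ℕ} (ht : t < I.T) {Z : Ω → ℝ}
    (hZ : Measurable[pastInfo x y t] Z) {C : ℝ} (hC : ∀ ω, |Z ω| ≤ C) (hZ0 : ∀ ω, 0 ≤ Z ω)
    {V : Finset (Vec d)} (hVI : V ⊆ I.actions)
    (hV : ∀ ω, Z ω ≠ 0 → (stateAt I S (fun s => (x s ω, y s ω)) t).active = V)
    {g : Vec d → ℝ} (hg : Measurable g) :
    Integrable (fun ω => Z ω * |g (x t ω) * y t ω| ^ (1 + I.ε)) μ ∧
      ∫ ω, Z ω * |g (x t ω) * y t ω| ^ (1 + I.ε) ∂μ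
        ≤ (2 * (1 + I.υ) * ∑ b ∈ V, S.design V b * |g b| ^ (1 + I.ε)) * ∫ ω, Z ω ∂μ := by
  have hx := hR.bandit.measurable_action
  have hy := hR.bandit.measurable_reward
  have hZ' := hZ.mono (pastInfo_le hx hy t) le_rfl
  have hmb : ∀ b, AEStronglyMeasurable (fun ω => Z ω * actionInd x t b ω) μ := fun b =>
    (hZ'.mul (measurable_actionInd (hx t) b)).aestronglyMeasurable
  have hbi : ∀ b, Integrable (fun ω => Z ω * actionInd x t b ω) μ := fun b =>
    Integrable.of_bound (hmb b) C (Filter.Eventually.of_forall (abs_mul_actionInd_le x t hC b))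
  have hbn : ∀ b, Integrable
      (fun ω => Z ω * actionInd x t b ω * |y t ω - inner ℝ (x t ω) θ| ^ (1 + I.ε)) μ := fun b =>
    (hR.bandit.integrable_moment t ht).bdd_mul (hmb b)
      (Filter.Eventually.of_forall (abs_mul_actionInd_le x t hC b))
  set F : Vec d → Ω → ℝ := fun b ω => (2 * |g b| ^ (1 + I.ε)) * (Z ω * actionInd x t b ω
    + Z ω * actionInd x t b ω * |y t ω - inner ℝ (x t ω) θ| ^ (1 + I.ε)) with hF
  have hterm : ∀ b ∈ V, Integrable (F b) μ := fun b _ => ((hbi b).add (hbn b)).const_mul _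
  have h0 : ∀ ω, 0 ≤ Z ω * |g (x t ω) * y t ω| ^ (1 + I.ε) := fun ω =>
    mul_nonneg (hZ0 ω) (by positivity)
  have hae : ∀ᵐ ω ∂μ, Z ω * |g (x t ω) * y t ω| ^ (1 + I.ε) ≤ ∑ b ∈ V, F b ω := by
    filter_upwards [ae_action_mem_active hS hne hR] with ω hω
    by_cases hz : Z ω = 0
    · simp [hF, hz]
    have hmem : x t ω ∈ V := hV ω hz ▸ hω t ht
    have hsum : ∑ b ∈ V, F b ω = Z ω * (|g (x t ω)| ^ (1 + I.ε)
        * (2 * (1 + |y t ω - inner ℝ (x t ω) θ| ^ (1 + I.ε)))) := by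
      rw [← sum_mul_actionInd_eq x t (fun b => Z ω * (|g b| ^ (1 + I.ε)
        * (2 * (1 + |y t ω - inner ℝ (x t ω) θ| ^ (1 + I.ε))))) hmem]
      exact Finset.sum_congr rfl fun b _ => by rw [hF]; ring
    rw [hsum, abs_mul, Real.mul_rpow (abs_nonneg _) (abs_nonneg _)]
    refine mul_le_mul_of_nonneg_left (mul_le_mul_of_nonneg_left ?_ (by positivity)) (hZ0 ω)
    have := one_add_abs_rpow_le (η := y t ω - inner ℝ (x t ω) θ) hI.ε_pos hI.ε_le
      (hθ _ (hVI hmem))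
    rwa [add_sub_cancel] at this
  have hmeas : AEStronglyMeasurable (fun ω => Z ω * |g (x t ω) * y t ω| ^ (1 + I.ε)) μ :=
    (hZ'.mul (((hg.comp (hx t)).mul (hy t)).abs.pow_const _)).aestronglyMeasurable
  have hsumint : Integrable (fun ω => ∑ b ∈ V, F b ω) μ := integrable_finsetSum _ hterm
  refine ⟨hsumint.mono' hmeas ?_, ?_⟩
  · filter_upwards [hae] with ω hω
    rwa [Real.norm_of_nonneg (h0 ω)]
  refine (integral_mono_of_nonneg (Filter.Eventually.of_forall h0) hsumint hae).trans ?_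
  rw [integral_finsetSum _ hterm, mul_assoc, Finset.sum_mul, Finset.mul_sum]
  refine Finset.sum_le_sum fun b hb => ?_
  simp only [hF]
  rw [integral_const_mul, integral_add (hbi b) (hbn b)]
  have h1 := integral_mul_actionInd_mul_moment_le hR ht hZ hC hZ0 b
  have h2 := integral_mul_actionInd hR ht hZ hC hV (hVI hb)
  rw [h2] at h1 ⊢
  have h3 : 0 ≤ 2 * |g b| ^ (1 + I.ε) := by positivity
  refine (mul_le_mul_of_nonneg_left (add_le_add_right h1 _) h3).trans (le_of_eq (by ring))

end Run

/-! ### Deviation of the estimates of one phase -/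

/-- With D the largest truncation level, the truncation biases sum to at most 2L by
`sum_rpow_neg_le`. Each second-order term equals L/n, which adds L in total. -/
lemma sum_trunc_exponent_le {ε u L : ℝ} (hε0 : 0 < ε) (hε1 : ε ≤ 1) (hu : 0 < u) (hL : 0 < L)
    {n : ℕ} (hn : 0 < n) (c : ℝ) :
    ∑ i ∈ Finset.range n,
        ((c + u * ((u * ((i : ℝ) + 1) / L) ^ (1 / (1 + ε))) ^ (-ε)) / (u * n / L) ^ (1 / (1 + ε))
          + u * ((u * n / L) ^ (1 / (1 + ε))) ^ (-(1 + ε)))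
      ≤ n * c / (u * n / L) ^ (1 / (1 + ε)) + 3 * L := by
  have hn' : (0 : ℝ) < n := by exact_mod_cast hn
  set α := ε / (1 + ε) with hα
  have hα0 : 0 ≤ α := by positivity
  have hα1 : α ≤ 1 / 2 := by
    rw [hα, div_le_div_iff₀ (by positivity) (by norm_num)]; linarith
  have h1α : 1 / (1 + ε) = 1 - α := by rw [hα]; field_simp; ring
  set D := (u * n / L) ^ (1 / (1 + ε)) with hD
  have hD0 : 0 < D := by positivity
  have e1 : u * D ^ (-(1 + ε)) = L / n := by
    rw [hD, ← Real.rpow_mul (by positivity), show 1 / (1 + ε) * -(1 + ε) = -1 by field_simp,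
      Real.rpow_neg_one]
    field_simp
  have e2 : ∀ i : ℕ, u * ((u * ((i : ℝ) + 1) / L) ^ (1 / (1 + ε))) ^ (-ε)
      = u * (u / L) ^ (-α) * ((i : ℝ) + 1) ^ (-α) := by
    intro i
    rw [← Real.rpow_mul (by positivity), show 1 / (1 + ε) * -ε = -α by rw [hα]; ring,
      mul_div_right_comm, Real.mul_rpow (by positivity) (by positivity), mul_assoc]
  have e3 : u * (u / L) ^ (-α) * (n : ℝ) ^ (1 - α) = L * D := by
    rw [hD, h1α, mul_div_right_comm, Real.mul_rpow (by positivity) (by positivity),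
      sub_eq_add_neg, Real.rpow_add (show 0 < u / L by positivity), Real.rpow_one]
    field_simp
  have hsum := sum_rpow_neg_le hα0 hα1 n
  have hle : ∑ i ∈ Finset.range n, u * ((u * ((i : ℝ) + 1) / L) ^ (1 / (1 + ε))) ^ (-ε)
      ≤ 2 * (L * D) := by
    simp only [e2, ← Finset.mul_sum]
    rw [← e3]
    have := mul_le_mul_of_nonneg_left hsum (show 0 ≤ u * (u / L) ^ (-α) by positivity)
    linarith
  rw [e1, Finset.sum_add_distrib, ← Finset.sum_div, Finset.sum_add_distrib, Finset.sum_const,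
    Finset.sum_const, Finset.card_range, nsmul_eq_mul, nsmul_eq_mul, mul_div_cancel₀ _ hn'.ne',
    add_div]
  have h5 : (∑ i ∈ Finset.range n, u * ((u * ((i : ℝ) + 1) / L) ^ (1 / (1 + ε))) ^ (-ε)) / D
      ≤ 2 * L := by
    rw [div_le_iff₀ hD0]
    linarith
  linarith

section Run

variable {d : ℕ} {Ω : Type*} [MeasurableSpace Ω] {μ : Measure Ω} [IsProbabilityMeasure μ]
  {I : Input d} {S : Selection d} {θ : Vec d} {x : ℕ → Ω → Vec d} {y : ℕ → Ω → ℝ}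

/-- Induction on the number of samples, each step using the conditional law given the past. Keeping
the indicator of the event that the phase begins at s with active set V fixes the design and leaves
the probability of this event as a factor, which the union bound needs. -/
lemma integral_exp_sum_trunc_le (hI : I.IsTuned) (hS : S.IsValid I) (hne : I.actions.Nonempty)
    (hθ : ∀ a ∈ I.actions, |(inner ℝ a θ : ℝ)| ≤ 1) (hR : IsRun μ I S θ x y) {l s : ℕ}
    {V : Finset (Vec d)} (hVI : V ⊆ I.actions) (hsT : s + phaseLength I S l V ≤ I.T)
    {g : Vec d → ℝ} (hg : Measurable g) {u D σ : ℝ} (hσ : |σ| = 1)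
    (hu : 2 * (1 + I.υ) * ∑ b ∈ V, S.design V b * |g b| ^ (1 + I.ε) ≤ u) {B : ℕ → ℝ}
    (hB : ∀ i < phaseLength I S l V, 0 < B i ∧ B i ≤ D) {k : ℕ}
    (hk : k ≤ phaseLength I S l V) :
    ∫ ω, {ω | stateAt I S (fun i => (x i ω, y i ω)) s = ⟨l, V, s⟩}.indicator (fun _ => (1 : ℝ)) ω
        * Real.exp (∑ i ∈ Finset.range k, σ * (if |g (x (s + i) ω) * y (s + i) ω| ≤ B i then
          g (x (s + i) ω) * y (s + i) ω else 0) / D) ∂μ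
      ≤ Real.exp (∑ i ∈ Finset.range k,
          ((σ * (∑ b ∈ V, S.design V b * (g b * inner ℝ b θ)) + u * B i ^ (-I.ε)) / D
            + u * D ^ (-(1 + I.ε))))
        * μ.real {ω | stateAt I S (fun i => (x i ω, y i ω)) s = ⟨l, V, s⟩} := by
  have hx := hR.bandit.measurable_action
  have hy := hR.bandit.measurable_reward
  have hmeasB := measurableSet_stateAt_eq_pastInfo (x := x) (y := y) hS hne s ⟨l, V, s⟩
  set E := {ω | stateAt I S (fun i => (x i ω, y i ω)) s = ⟨l, V, s⟩} with hE
  induction k with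
  | zero =>
    simp only [Finset.range_zero, Finset.sum_empty, Real.exp_zero, mul_one, one_mul]
    rw [integral_indicator_const _ (pastInfo_le hx hy s _ hmeasB)]
    simp
  | succ k ih =>
    have ih := ih (by omega)
    have hD : 0 < D := (hB k hk).1.trans_le (hB k hk).2
    set Z : Ω → ℝ := fun ω => E.indicator (fun _ => (1 : ℝ)) ω
        * Real.exp (∑ i ∈ Finset.range k, σ * (if |g (x (s + i) ω) * y (s + i) ω| ≤ B i then
          g (x (s + i) ω) * y (s + i) ω else 0) / D) with hZdef
    have hmono : pastInfo x y s ≤ pastInfo x y (s + k) :=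
      @pastInfo_mono d Ω x y s (s + k) (by omega)
    have hZ : Measurable[pastInfo x y (s + k)] Z := by
      refine Measurable.mul (measurable_const.indicator (hmono _ hmeasB)) (Real.measurable_exp.comp
        (Finset.measurable_sum _ fun i hi => ?_))
      have hi := Finset.mem_range.1 hi
      refine Measurable.div_const (Measurable.const_mul (@measurable_trunc Ω
        (pastInfo x y (s + k)) _ ?_ _) _) _
      exact (hg.comp (measurable_action_pastInfo (by omega))).mul
        (measurable_reward_pastInfo (by omega))
    have hZ0 : ∀ ω, 0 ≤ Z ω := fun ω =>
      mul_nonneg (Set.indicator_nonneg (fun _ _ => zero_le_one) _) (Real.exp_nonneg _)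
    -- Each truncated sample is at most `B i ≤ D` in absolute value, so each of the k exponents is
    -- at most 1.
    have hC : ∀ ω, |Z ω| ≤ Real.exp k := by
      intro ω
      rw [abs_of_nonneg (hZ0 ω)]
      refine (mul_le_of_le_one_left (Real.exp_nonneg _) ?_).trans (Real.exp_le_exp.2 ?_)
      · exact Set.indicator_le_self' (fun _ _ => zero_le_one) _
      · calc _ ≤ ∑ i ∈ Finset.range k, (1 : ℝ) := Finset.sum_le_sum fun i hi => by
              have hi := hB i (by have := Finset.mem_range.1 hi; omega)
              refine (le_abs_self _).trans ?_
              rw [abs_div, abs_mul, hσ, one_mul, abs_of_pos hD, div_le_one hD]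
              split_ifs with h
              · exact h.trans hi.2
              · simpa using hD.le
          _ = k := by simp
    have hV : ∀ ω, Z ω ≠ 0 →
        (stateAt I S (fun i => (x i ω, y i ω)) (s + k)).active = V := by
      intro ω hω
      have hωE : ω ∈ E := Set.mem_of_indicator_ne_zero (left_ne_zero_of_mul hω)
      rw [stateAt_add_of_lt hωE (by omega)]
    have hZi : Integrable Z μ := Integrable.of_bound
      (hZ.mono (pastInfo_le hx hy _) le_rfl).aestronglyMeasurable _
      (Filter.Eventually.of_forall hC)
    have ht : s + k < I.T := by omega
    obtain ⟨hXi, hX⟩ := integral_mul_sample hS hne hR ht hZ hC hVI hV g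
    obtain ⟨hPi, hP⟩ := integral_mul_abs_sample_rpow_le hI hS hne hθ hR ht hZ hC hZ0 hVI hV hg
    have hstep := integral_mul_exp_trunc_le hI.ε_pos hI.ε_le (hB k (by omega)).1
      (hB k (by omega)).2 hσ hZ0 hZi hXi hPi hX
      (hP.trans (mul_le_mul_of_nonneg_right hu (integral_nonneg hZ0)))
    rw [Finset.sum_range_succ, Real.exp_add]
    calc _ = ∫ ω, Z ω * Real.exp (σ * (if |g (x (s + k) ω) * y (s + k) ω| ≤ B k then
            g (x (s + k) ω) * y (s + k) ω else 0) / D) ∂μ := by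
          refine integral_congr_ae (Filter.Eventually.of_forall fun ω => ?_)
          simp only [hZdef]
          rw [Finset.sum_range_succ, Real.exp_add, mul_assoc]
      _ ≤ _ := hstep
      _ ≤ _ := mul_le_mul_of_nonneg_left ih (Real.exp_nonneg _)
      _ = _ := by ring

/-- Chernoff's bound with parameter 1/D, where D is the truncation level of the last sample: the
threshold 4L beats the exponent 3L by L. -/
lemma measureReal_sum_trunc_le (hI : I.IsTuned) (hS : S.IsValid I) (hne : I.actions.Nonempty)
    (hθ : ∀ a ∈ I.actions, |(inner ℝ a θ : ℝ)| ≤ 1) (hR : IsRun μ I S θ x y) {l s : ℕ}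
    {V : Finset (Vec d)} (hVI : V ⊆ I.actions) (hsT : s + phaseLength I S l V ≤ I.T)
    (hpos : 0 < phaseLength I S l V)
    {g : Vec d → ℝ} (hg : Measurable g) {u L σ : ℝ} (hu0 : 0 < u) (hL : 0 < L) (hσ : |σ| = 1)
    (hu : 2 * (1 + I.υ) * ∑ b ∈ V, S.design V b * |g b| ^ (1 + I.ε) ≤ u) :
    μ.real ({ω | stateAt I S (fun i => (x i ω, y i ω)) s = ⟨l, V, s⟩} ∩
        {ω | phaseLength I S l V * (σ * (∑ b ∈ V, S.design V b * (g b * inner ℝ b θ)))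
            + 4 * L * (u * phaseLength I S l V / L) ^ (1 / (1 + I.ε)) <
          σ * ∑ i ∈ Finset.range (phaseLength I S l V),
            (if |g (x (s + i) ω) * y (s + i) ω| ≤ (u * ((i : ℝ) + 1) / L) ^ (1 / (1 + I.ε)) then
              g (x (s + i) ω) * y (s + i) ω else 0)})
      ≤ Real.exp (-L)
        * μ.real {ω | stateAt I S (fun i => (x i ω, y i ω)) s = ⟨l, V, s⟩} := by
  have hε := hI.ε_pos
  have hx := hR.bandit.measurable_action
  have hy := hR.bandit.measurable_reward
  have hmeasB := pastInfo_le hx hy s _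
    (measurableSet_stateAt_eq_pastInfo (x := x) (y := y) hS hne s ⟨l, V, s⟩)
  set n := phaseLength I S l V with hn
  have hn' : (0 : ℝ) < n := by exact_mod_cast hpos
  set D := (u * n / L) ^ (1 / (1 + I.ε)) with hD
  have hD0 : 0 < D := by positivity
  set m := ∑ b ∈ V, S.design V b * (g b * inner ℝ b θ) with hm
  have hexp := integral_exp_sum_trunc_le hI hS hne hθ hR hVI hsT hg (D := D) hσ hu
    (B := fun i => (u * ((i : ℝ) + 1) / L) ^ (1 / (1 + I.ε))) (fun i hi => ⟨by positivity, by
      have : (i : ℝ) + 1 ≤ n := by exact_mod_cast hi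
      rw [hD]
      gcongr⟩) le_rfl
  rw [← hn] at hexp
  have hbound := hexp.trans (mul_le_mul_of_nonneg_right (Real.exp_le_exp.2
    (sum_trunc_exponent_le hε hI.ε_le hu0 hL hpos (σ * m))) measureReal_nonneg)
  rw [← hD] at hbound
  set E := {ω | stateAt I S (fun i => (x i ω, y i ω)) s = ⟨l, V, s⟩} with hE
  set Y : ℕ → Ω → ℝ := fun i ω => if |g (x (s + i) ω) * y (s + i) ω|
    ≤ (u * ((i : ℝ) + 1) / L) ^ (1 / (1 + I.ε)) then g (x (s + i) ω) * y (s + i) ω else 0 with hY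
  have hYm : ∀ i, Measurable (Y i) := fun i =>
    measurable_trunc ((hg.comp (hx _)).mul (hy _)) _
  set F := {ω | n * (σ * m) + 4 * L * D < σ * ∑ i ∈ Finset.range n, Y i ω} with hF
  have hFm : MeasurableSet F :=
    measurableSet_lt measurable_const ((Finset.measurable_sum _ fun i _ => hYm i).const_mul σ)
  have hpt : ∀ ω, (E ∩ F).indicator (fun _ => (1 : ℝ)) ω
      ≤ Real.exp (-(n * (σ * m) / D + 4 * L)) * (E.indicator (fun _ => (1 : ℝ)) ω
        * Real.exp (∑ i ∈ Finset.range n, σ * Y i ω / D)) := by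
    intro ω
    by_cases h : ω ∈ E ∩ F
    · rw [Set.indicator_of_mem h, Set.indicator_of_mem h.1, one_mul, ← Real.exp_add]
      refine Real.one_le_exp ?_
      have h2 : n * (σ * m) + 4 * L * D < σ * ∑ i ∈ Finset.range n, Y i ω := h.2
      rw [← Finset.sum_div, ← Finset.mul_sum, neg_add_eq_sub, sub_nonneg, le_div_iff₀ hD0,
        add_mul, div_mul_cancel₀ _ hD0.ne']
      exact h2.le
    · rw [Set.indicator_of_notMem h]
      exact mul_nonneg (Real.exp_nonneg _)
        (mul_nonneg (Set.indicator_nonneg (fun _ _ => zero_le_one) _) (Real.exp_nonneg _))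
  have hint : Integrable (fun ω => E.indicator (fun _ => (1 : ℝ)) ω
        * Real.exp (∑ i ∈ Finset.range n, σ * Y i ω / D)) μ := by
    refine Integrable.of_bound ((measurable_const.indicator hmeasB).mul (Real.measurable_exp.comp
      (Finset.measurable_sum _ fun i _ => ((hYm i).const_mul σ).div_const D))).aestronglyMeasurable
      (Real.exp (∑ i ∈ Finset.range n, (u * ((i : ℝ) + 1) / L) ^ (1 / (1 + I.ε)) / D))
      (Filter.Eventually.of_forall fun ω => ?_)
    rw [norm_mul, Real.norm_of_nonneg (Real.exp_nonneg _),
      Real.norm_of_nonneg (Set.indicator_nonneg (fun _ _ => zero_le_one) _)]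
    refine (mul_le_of_le_one_left (Real.exp_nonneg _) (Set.indicator_le_self'
      (fun _ _ => zero_le_one) _)).trans (Real.exp_le_exp.2 (Finset.sum_le_sum fun i _ => ?_))
    refine div_le_div_of_nonneg_right ((le_abs_self _).trans ?_) hD0.le
    rw [abs_mul, hσ, one_mul]
    simp only [hY]
    split_ifs with h
    · exact h
    · rw [abs_zero]; positivity
  have h1 : μ.real (E ∩ F) = ∫ ω, (E ∩ F).indicator (fun _ => (1 : ℝ)) ω ∂μ := by
    rw [integral_indicator_const _ (hmeasB.inter hFm)]
    simp
  rw [h1]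
  refine (integral_mono_of_nonneg (Filter.Eventually.of_forall
    (Set.indicator_nonneg fun _ _ => zero_le_one)) (hint.const_mul _)
    (Filter.Eventually.of_forall hpt)).trans ?_
  rw [integral_const_mul]
  refine (mul_le_mul_of_nonneg_left hbound (Real.exp_nonneg _)).trans (le_of_eq ?_)
  rw [← mul_assoc, ← Real.exp_add]
  congr 2
  ring

end Run

lemma log_one_div_confLevel {d : ℕ} (I : Input d) (l : ℕ) (V : Finset (Vec d)) :
    Real.log (1 / confLevel I l V) = Real.log (2 * (l : ℝ) ^ 2 * V.card * I.T) := by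
  rw [confLevel, one_div_one_div, mul_right_comm]

/-- The length of a phase makes the statistical error and the ridge bias at most `2 ^ (-l) / 2`. -/
lemma phase_error_le {d : ℕ} {I : Input d} {S : Selection d} (hS : S.IsValid I) (hI : I.IsTuned)
    {l : ℕ} (hl : 1 ≤ l) {V : Finset (Vec d)} (hVI : V ⊆ I.actions) (hV : 1 < V.card)
    (hT : phaseLength I S l V ≤ I.T) :
    4 * Real.log (1 / confLevel I l V)
        * (4 * (1 + I.υ) * optValue I S V * phaseLength I S l V
            / Real.log (1 / confLevel I l V)) ^ (1 / (1 + I.ε))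
        ≤ phaseLength I S l V * ((1 / 2 : ℝ) ^ l / 2) ∧
      Real.sqrt I.γ * optValue I S V ^ (1 / (1 + I.ε)) ≤ (1 / 2 : ℝ) ^ l / 2 := by
  have hε := hI.ε_pos
  have hε1 := hI.ε_le
  have hυ := hI.υ_pos
  have hM := optValue_pos hS hI.γ_pos hI.β_eq hVI hV
  have hn := phaseLength_pos hS hI hl hVI hV
  have hL := one_le_log_confidence hI hl hV
  rw [log_one_div_confLevel]
  have hlen : (32 : ℝ) ^ ((1 + I.ε) / I.ε) * (1 + I.υ) ^ (1 / I.ε)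
      * ((1 / 2 : ℝ) ^ l) ^ (-((1 + I.ε) / I.ε)) * optValue I S V ^ (1 / I.ε)
      * Real.log (2 * (l : ℝ) ^ 2 * V.card * I.T) ≤ phaseLength I S l V := Nat.le_ceil _
  set M := optValue I S V with hMdef
  set L := Real.log (2 * (l : ℝ) ^ 2 * V.card * I.T) with hLdef
  set n := phaseLength I S l V with hndef
  have hn' : (0 : ℝ) < n := by exact_mod_cast hn
  have hT' : (n : ℝ) ≤ I.T := by exact_mod_cast hT
  set α := I.ε / (1 + I.ε) with hα
  have h1α : 1 / (1 + I.ε) = 1 - α := by rw [hα]; field_simp; ring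
  have hα0 : 0 < α := by positivity
  have hα1 : α ≤ 1 := by rw [hα, div_le_one (by positivity)]; linarith
  -- The definition of the phase length, raised to the power α.
  have hbase : 32 * (1 + I.υ) ^ (1 - α) * (2 : ℝ) ^ l * M ^ (1 - α) * L ^ α ≤ (n : ℝ) ^ α := by
    refine le_trans (le_of_eq ?_) (Real.rpow_le_rpow (by positivity) hlen hα0.le)
    rw [Real.mul_rpow (by positivity) (by positivity), Real.mul_rpow (by positivity) (by positivity),
      Real.mul_rpow (by positivity) (by positivity), Real.mul_rpow (by positivity) (by positivity),
      ← Real.rpow_mul (by positivity), ← Real.rpow_mul (by positivity),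
      ← Real.rpow_mul (by positivity), ← Real.rpow_mul (by positivity),
      show (1 + I.ε) / I.ε * α = 1 by rw [hα]; field_simp,
      show 1 / I.ε * α = 1 - α by rw [← h1α, hα]; field_simp,
      show -((1 + I.ε) / I.ε) * α = -1 by rw [hα]; field_simp,
      Real.rpow_one, Real.rpow_neg_one, ← inv_pow]
    norm_num
  have hυ1 : 1 ≤ (1 + I.υ) ^ (1 - α) := Real.one_le_rpow (by linarith) (by linarith)
  have hLα : 1 ≤ L ^ α := Real.one_le_rpow hL hα0.le
  have h4 : (4 : ℝ) ^ (1 - α) ≤ 4 := by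
    conv_rhs => rw [← Real.rpow_one 4]
    exact Real.rpow_le_rpow_of_exponent_le (by norm_num) (by linarith)
  have h2l : (1 / 2 : ℝ) ^ l = ((2 : ℝ) ^ l)⁻¹ := by rw [one_div, inv_pow]
  have h2l0 : (0 : ℝ) < 2 ^ l := by positivity
  rw [h1α, h2l]
  set q := (1 + I.υ) ^ (1 - α) * M ^ (1 - α) * L ^ α with hq
  have hq0 : 0 < q := by positivity
  have hqn : 32 * 2 ^ l * q ≤ (n : ℝ) ^ α := by
    refine le_trans (le_of_eq ?_) hbase
    rw [hq]; ring
  constructor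
  · have hL0 : 0 < L := by linarith
    have e0 : L = L ^ (1 - α) * L ^ α := by rw [← Real.rpow_add hL0]; simp
    have e1 : 4 * L * (4 * (1 + I.υ) * M * n / L) ^ (1 - α)
        = 4 * (4 : ℝ) ^ (1 - α) * q * (n : ℝ) ^ (1 - α) := by
      rw [Real.div_rpow (by positivity) (by positivity), Real.mul_rpow (by positivity)
        (by positivity), Real.mul_rpow (by positivity) (by positivity),
        Real.mul_rpow (by positivity) (by positivity)]
      have hLne : L ^ (1 - α) ≠ 0 := by positivity
      rw [mul_div_assoc', div_eq_iff hLne, hq]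
      nth_rewrite 1 [e0]
      ring
    have e2 : (n : ℝ) = (n : ℝ) ^ α * (n : ℝ) ^ (1 - α) := by
      rw [← Real.rpow_add hn']; simp
    rw [e1]
    nth_rewrite 2 [e2]
    rw [mul_right_comm ((n : ℝ) ^ α)]
    -- After cancelling n^(1-α), the claim is 4·4^(1-α)·q ≤ n^α·2^(-l)/2. The left side is at most
    -- 16q, which is the origin of the 32 in the phase length.
    refine mul_le_mul_of_nonneg_right ?_ (by positivity)
    calc 4 * (4 : ℝ) ^ (1 - α) * q ≤ 4 * 4 * q := by gcongr
      _ = 32 * 2 ^ l * q * (((2 : ℝ) ^ l)⁻¹ / 2) := by field_simp; norm_num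
      _ ≤ (n : ℝ) ^ α * (((2 : ℝ) ^ l)⁻¹ / 2) := mul_le_mul_of_nonneg_right hqn (by positivity)
  -- Since √γ = T^(-α) and the phase fits into the horizon, n^α ≤ T^α, and the lower bound on n^α
  -- also controls the bias.
  · have hγ : Real.sqrt I.γ = ((I.T : ℝ) ^ α)⁻¹ := by
      rw [hI.γ_eq, Real.sqrt_eq_rpow, ← Real.rpow_mul hI.T_pos.le, ← Real.rpow_neg hI.T_pos.le]
      congr 1
      rw [hα]; ring
    have hMq : M ^ (1 - α) ≤ q := by
      rw [hq, mul_right_comm]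
      exact le_mul_of_one_le_left (by positivity) (one_le_mul_of_one_le_of_one_le hυ1 hLα)
    have hnT : (n : ℝ) ^ α ≤ (I.T : ℝ) ^ α := Real.rpow_le_rpow hn'.le hT' hα0.le
    have hTα : 0 < (I.T : ℝ) ^ α := Real.rpow_pos_of_pos hI.T_pos _
    rw [hγ, inv_mul_le_iff₀ hTα]
    calc M ^ (1 - α) ≤ q := hMq
      _ ≤ 32 * 2 ^ l * q * (((2 : ℝ) ^ l)⁻¹ / 2) := by
        have : 32 * 2 ^ l * q * (((2 : ℝ) ^ l)⁻¹ / 2) = 16 * q := by field_simp; norm_num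
        rw [this]; linarith
      _ ≤ _ := mul_le_mul_of_nonneg_right (hqn.trans hnT) (by positivity)

/-! ### ### Union bound and expected regret -/

lemma sum_one_div_sq_le (n : ℕ) : ∑ l ∈ Finset.Icc 1 n, 1 / (l : ℝ) ^ 2 ≤ 2 := by
  have h : ∀ n : ℕ, 1 ≤ n → ∑ l ∈ Finset.Icc 1 n, 1 / (l : ℝ) ^ 2 ≤ 2 - 1 / (n : ℝ) := by
    intro n hn
    induction n, hn using Nat.le_induction with
    | base => norm_num
    | succ n hn ih =>
      rw [Finset.sum_Icc_succ_top (by omega)]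
      have hn' : (0 : ℝ) < n := by exact_mod_cast hn
      have : 1 / ((n + 1 : ℕ) : ℝ) ^ 2 ≤ 1 / (n : ℝ) - 1 / ((n + 1 : ℕ) : ℝ) := by
        push_cast
        rw [div_sub_div _ _ hn'.ne' (by positivity), div_le_div_iff₀ (by positivity) (by positivity)]
        nlinarith
      linarith
  rcases Nat.eq_zero_or_pos n with rfl | hn
  · simp
  · have : (0 : ℝ) ≤ 1 / (n : ℝ) := by positivity
    linarith [h n hn]

section Run

variable {d : ℕ} {Ω : Type*} [MeasurableSpace Ω] {μ : Measure Ω} [IsProbabilityMeasure μ]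
  {I : Input d} {S : Selection d} {θ : Vec d} {x : ℕ → Ω → Vec d} {y : ℕ → Ω → ℝ}

/-- The estimate of the reward of one arm in one phase is rarely inaccurate. -/
lemma measureReal_estimate_inaccurate_le (hI : I.IsTuned) (hS : S.IsValid I)
    (hne : I.actions.Nonempty) (hθ1 : ‖θ‖ ≤ 1)
    (hθ : ∀ a ∈ I.actions, |(inner ℝ a θ : ℝ)| ≤ 1) (hR : IsRun μ I S θ x y) {l s : ℕ}
    (hl : 1 ≤ l) {V : Finset (Vec d)} (hVI : V ⊆ I.actions) (hV : 1 < V.card)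
    (hsT : s + phaseLength I S l V ≤ I.T) {a : Vec d} (ha : a ∈ V) :
    μ.real ({ω | stateAt I S (fun i => (x i ω, y i ω)) s = ⟨l, V, s⟩} ∩
        {ω | (1 / 2 : ℝ) ^ l
          < |rewardEstimate I S (fun i => (x i ω, y i ω)) l V s a - inner ℝ a θ|})
      ≤ 1 / ((l : ℝ) ^ 2 * I.T * V.card)
        * μ.real {ω | stateAt I S (fun i => (x i ω, y i ω)) s = ⟨l, V, s⟩} := by
  have hε := hI.ε_pos
  have hυ := hI.υ_pos
  have hM := optValue_pos hS hI.γ_pos hI.β_eq hVI hV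
  have hn := phaseLength_pos hS hI hl hVI hV
  obtain ⟨herr, hbias⟩ := phase_error_le hS hI hl hVI hV (by omega)
  have hL : 0 < Real.log (1 / confLevel I l V) := by
    rw [log_one_div_confLevel]
    linarith [one_le_log_confidence hI hl hV]
  have hexpL : Real.exp (-Real.log (1 / confLevel I l V))
      = 1 / (2 * ((l : ℝ) ^ 2 * I.T * V.card)) := by
    have h8 := eight_le_confidence hI hl hV
    rw [log_one_div_confLevel, Real.exp_neg, Real.exp_log (by linarith), one_div]
    congr 1; ring
  have hw := (hS.isDesign V hVI ⟨a, ha⟩).1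
  -- The samples need only 2(1+υ)M; the truncation level used by the algorithm has a factor 2 to
  -- spare.
  have hu : 2 * (1 + I.υ) * ∑ b ∈ V, S.design V b
      * |invForm I.γ V (S.design V) a b| ^ (1 + I.ε) ≤ 4 * (1 + I.υ) * optValue I S V := by
    have h1 := sum_abs_invForm_rpow_le_optValue (I := I) (S := S) hI.β_eq ha
    have h2 := mul_le_mul_of_nonneg_left h1 (show 0 ≤ 2 * (1 + I.υ) by positivity)
    have h3 : 0 ≤ 2 * (1 + I.υ) * optValue I S V := by positivity
    linarith
  have hridge : |inner ℝ a θ - ∑ b ∈ V, S.design V b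
      * (invForm I.γ V (S.design V) a b * inner ℝ b θ)| ≤ (1 / 2 : ℝ) ^ l / 2 := by
    refine (abs_inner_sub_sum_le hI.γ_pos hw a θ hθ1).trans (le_trans ?_ hbias)
    refine mul_le_mul_of_nonneg_left ?_ (Real.sqrt_nonneg _)
    have h1 := sqrt_invForm_le_optValue hS hI.β_eq hVI ha
    have h2 := Real.rpow_le_rpow (by positivity) h1 (z := 1 / (1 + I.ε)) (by positivity)
    rwa [← Real.rpow_mul (Real.sqrt_nonneg _), mul_one_div_cancel (by positivity),
      Real.rpow_one] at h2
  have hg := measurable_invForm I.γ V (S.design V) a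
  -- Upper and lower tail are σ = 1 and σ = -1. Each has probability at most `confLevel` times that
  -- of the phase event, and the sum removes the 2 from the denominator.
  set G : ℝ → Set Ω := fun σ => {ω | stateAt I S (fun i => (x i ω, y i ω)) s = ⟨l, V, s⟩} ∩
        {ω | phaseLength I S l V * (σ * (∑ b ∈ V, S.design V b
              * (invForm I.γ V (S.design V) a b * inner ℝ b θ)))
            + 4 * Real.log (1 / confLevel I l V) * (4 * (1 + I.υ) * optValue I S V
              * phaseLength I S l V / Real.log (1 / confLevel I l V)) ^ (1 / (1 + I.ε)) <
          σ * ∑ i ∈ Finset.range (phaseLength I S l V),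
            (if |invForm I.γ V (S.design V) a (x (s + i) ω) * y (s + i) ω|
                ≤ (4 * (1 + I.υ) * optValue I S V * ((i : ℝ) + 1)
                  / Real.log (1 / confLevel I l V)) ^ (1 / (1 + I.ε)) then
              invForm I.γ V (S.design V) a (x (s + i) ω) * y (s + i) ω else 0)} with hG
  have htail : ∀ σ : ℝ, |σ| = 1 → μ.real (G σ) ≤ Real.exp (-Real.log (1 / confLevel I l V))
        * μ.real {ω | stateAt I S (fun i => (x i ω, y i ω)) s = ⟨l, V, s⟩} :=
    fun σ hσ => measureReal_sum_trunc_le hI hS hne hθ hR hVI hsT hn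
    hg (σ := σ) (show 0 < 4 * (1 + I.υ) * optValue I S V by positivity) hL hσ hu
  have hp := htail 1 abs_one
  have hm := htail (-1) (by norm_num)
  rw [hexpL] at hp hm
  set L := Real.log (1 / confLevel I l V) with hLdef
  set u := 4 * (1 + I.υ) * optValue I S V with hudef
  set n := phaseLength I S l V with hndef
  have hn' : (0 : ℝ) < n := by exact_mod_cast hn
  set m := ∑ b ∈ V, S.design V b * (invForm I.γ V (S.design V) a b * inner ℝ b θ) with hmdef
  have hsub : ({ω | stateAt I S (fun i => (x i ω, y i ω)) s = ⟨l, V, s⟩} ∩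
        {ω | (1 / 2 : ℝ) ^ l
          < |rewardEstimate I S (fun i => (x i ω, y i ω)) l V s a - inner ℝ a θ|}) ⊆ G 1 ∪ G (-1) := by
    rintro ω ⟨hω, hbad⟩
    rw [Set.mem_union]
    have hbad : (1 / 2 : ℝ) ^ l
      < |rewardEstimate I S (fun i => (x i ω, y i ω)) l V s a - inner ℝ a θ| := hbad
    set Y := ∑ i ∈ Finset.range n,
      (if |invForm I.γ V (S.design V) a (x (s + i) ω) * y (s + i) ω|
          ≤ (u * ((i : ℝ) + 1) / L) ^ (1 / (1 + I.ε)) then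
        invForm I.γ V (S.design V) a (x (s + i) ω) * y (s + i) ω else 0) with hY
    have hW : rewardEstimate I S (fun i => (x i ω, y i ω)) l V s a = 1 / n * Y := rfl
    have hWn : n * (1 / n * Y) = Y := by field_simp
    rw [hW] at hbad
    rcases lt_abs.1 hbad with h | h
    · left
      refine ⟨hω, ?_⟩
      change n * (1 * m) + 4 * L * (u * n / L) ^ (1 / (1 + I.ε)) < 1 * Y
      have h1 := (abs_le.1 hridge).1
      have h2 : n * ((1 / 2 : ℝ) ^ l / 2 + m) < n * (1 / n * Y) :=
        mul_lt_mul_of_pos_left (by linarith) hn'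
      rw [hWn] at h2
      linarith
    · right
      refine ⟨hω, ?_⟩
      change n * (-1 * m) + 4 * L * (u * n / L) ^ (1 / (1 + I.ε)) < -1 * Y
      have h1 := (abs_le.1 hridge).2
      have h2 : n * (1 / n * Y) < n * (m - (1 / 2 : ℝ) ^ l / 2) :=
        mul_lt_mul_of_pos_left (by linarith) hn'
      rw [hWn] at h2
      linarith
  refine (measureReal_mono hsub).trans ((measureReal_union_le _ _).trans
    ((add_le_add hp hm).trans (le_of_eq ?_)))
  rw [← two_mul, ← mul_assoc]
  congr 1
  have := hI.T_pos
  have : (0 : ℝ) < V.card := by exact_mod_cast (by omega : 0 < V.card)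
  field_simp

/-- With high probability all estimates are accurate. -/
lemma measureReal_not_isAccurate_le (hI : I.IsTuned) (hS : S.IsValid I)
    (hne : I.actions.Nonempty) (hθ1 : ‖θ‖ ≤ 1)
    (hθ : ∀ a ∈ I.actions, |(inner ℝ a θ : ℝ)| ≤ 1) (hR : IsRun μ I S θ x y) :
    μ.real {ω | ¬ IsAccurate I S θ (fun i => (x i ω, y i ω))} ≤ 2 / I.T := by
  classical
  have hx := hR.bandit.measurable_action
  have hy := hR.bandit.measurable_reward
  have hT := hI.T_pos
  let B : ℕ → ℕ × Finset (Vec d) → Set Ω := fun l q =>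
    {ω | stateAt I S (fun i => (x i ω, y i ω)) q.1 = ⟨l, q.2, q.1⟩}
  let F : ℕ → ℕ × Finset (Vec d) → Vec d → Set Ω := fun l q a =>
    {ω | (1 < q.2.card ∧ q.1 + phaseLength I S l q.2 ≤ I.T) ∧ ω ∈ B l q ∩
      {ω | (1 / 2 : ℝ) ^ l
          < |rewardEstimate I S (fun i => (x i ω, y i ω)) l q.2 q.1 a - inner ℝ a θ|}}
  set J := Finset.range I.T ×ˢ I.actions.powerset with hJ
  have hsub : {ω | ¬ IsAccurate I S θ (fun i => (x i ω, y i ω))}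
      ⊆ ⋃ l ∈ Finset.Icc 1 I.T, ⋃ q ∈ J, ⋃ a ∈ q.2, F l q a := by
    intro ω hω
    have hω : ¬ IsAccurate I S θ (fun i => (x i ω, y i ω)) := hω
    unfold IsAccurate at hω
    push Not at hω
    obtain ⟨s, l, V, hst, hcard, hlen, a, ha, hbad⟩ := hω
    have hb := stateAt_basic S hne (fun i => (x i ω, y i ω)) s
    rw [hst] at hb
    have hpos : 0 < phaseLength I S l V := phaseLength_pos hS hI hb.2.2.1 hb.1 hcard
    have hls : l ≤ s + 1 := hb.2.2.2.1
    simp only [Set.mem_iUnion]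
    refine ⟨l, Finset.mem_Icc.2 ⟨hb.2.2.1, by omega⟩, (s, V), ?_, a, ha, ⟨hcard, hlen⟩, hst, hbad⟩
    exact Finset.mem_product.2 ⟨Finset.mem_range.2 (by omega),
      Finset.mem_powerset.2 hb.1⟩
  have hF : ∀ l ∈ Finset.Icc 1 I.T, ∀ q ∈ J, ∀ a ∈ q.2,
      μ.real (F l q a) ≤ 1 / ((l : ℝ) ^ 2 * I.T * q.2.card) * μ.real (B l q) := by
    intro l hl q hq a ha
    by_cases h : 1 < q.2.card ∧ q.1 + phaseLength I S l q.2 ≤ I.T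
    · have : F l q a = B l q ∩ {ω | (1 / 2 : ℝ) ^ l
          < |rewardEstimate I S (fun i => (x i ω, y i ω)) l q.2 q.1 a - inner ℝ a θ|} :=
        Set.ext fun ω => and_iff_right h
      rw [this]
      exact measureReal_estimate_inaccurate_le hI hS hne hθ1 hθ hR (Finset.mem_Icc.1 hl).1
        (Finset.mem_powerset.1 (Finset.mem_product.1 hq).2) h.1 h.2 ha
    · have : F l q a = ∅ := Set.eq_empty_of_forall_notMem fun ω hω => h hω.1
      rw [this, measureReal_empty]
      positivity
  -- For fixed l these events are disjoint, because a phase begins at most once. The union over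
  -- start times and active sets therefore costs nothing, however many active sets there are.
  have hB : ∀ l, ∑ q ∈ J, μ.real (B l q) ≤ 1 := by
    intro l
    rw [← measureReal_biUnion_finset]
    · exact measureReal_le_one
    · intro q _ q' _ hqq'
      refine Set.disjoint_left.2 fun ω h h' => hqq' ?_
      exact Prod.ext (stateAt_start_unique h h').1 (stateAt_start_unique h h').2
    · exact fun q _ => pastInfo_le hx hy q.1 _ (measurableSet_stateAt_eq_pastInfo hS hne q.1 _)
  have hq : ∀ l ∈ Finset.Icc 1 I.T, ∀ q ∈ J,
      μ.real (⋃ a ∈ q.2, F l q a) ≤ 1 / ((l : ℝ) ^ 2 * I.T) * μ.real (B l q) := by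
    intro l hl q hq
    refine (measureReal_biUnion_finset_le _ _).trans ((Finset.sum_le_sum (hF l hl q hq)).trans ?_)
    rw [Finset.sum_const, nsmul_eq_mul, ← mul_assoc]
    refine mul_le_mul_of_nonneg_right ?_ measureReal_nonneg
    rcases Nat.eq_zero_or_pos q.2.card with h0 | h0
    · rw [h0]; simp only [Nat.cast_zero, zero_mul]; positivity
    · have h1 : (0 : ℝ) < q.2.card := by exact_mod_cast h0
      have h2 : (0 : ℝ) < l := by exact_mod_cast (Finset.mem_Icc.1 hl).1
      refine le_of_eq ?_
      field_simp
  calc μ.real {ω | ¬ IsAccurate I S θ (fun i => (x i ω, y i ω))}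
      ≤ μ.real (⋃ l ∈ Finset.Icc 1 I.T, ⋃ q ∈ J, ⋃ a ∈ q.2, F l q a) :=
        measureReal_mono hsub (measure_ne_top _ _)
    _ ≤ ∑ l ∈ Finset.Icc 1 I.T, ∑ q ∈ J, μ.real (⋃ a ∈ q.2, F l q a) :=
        (measureReal_biUnion_finset_le _ _).trans
          (Finset.sum_le_sum fun l _ => measureReal_biUnion_finset_le _ _)
    _ ≤ ∑ l ∈ Finset.Icc 1 I.T, 1 / ((l : ℝ) ^ 2 * I.T) := by
        refine Finset.sum_le_sum fun l hl => (Finset.sum_le_sum (hq l hl)).trans ?_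
        rw [← Finset.mul_sum]
        exact mul_le_of_le_one_right (by positivity) (hB l)
    _ = (∑ l ∈ Finset.Icc 1 I.T, 1 / (l : ℝ) ^ 2) / I.T := by
        rw [Finset.sum_div]
        exact Finset.sum_congr rfl fun l _ => by rw [div_div]
    _ ≤ 2 / I.T := div_le_div_of_nonneg_right (sum_one_div_sq_le _) hT.le

/-- The expected regret for a benchmark `v` slightly above the best reward. -/
lemma integral_regret_le (hI : I.IsTuned) (hS : S.IsValid I) (hd : 1 ≤ d) (hθ1 : ‖θ‖ ≤ 1)
    (hθ : ∀ a ∈ I.actions, |(inner ℝ a θ : ℝ)| ≤ 1) (hR : IsRun μ I S θ x y) {b : Vec d}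
    (hbI : b ∈ I.actions) (hb : ∀ a ∈ I.actions, (inner ℝ a θ : ℝ) ≤ inner ℝ b θ) {v c : ℝ}
    (hv : inner ℝ b θ ≤ v) (hvc : v ≤ inner ℝ b θ + c) :
    ∫ ω, ∑ t ∈ Finset.range I.T, (v - inner ℝ (x t ω) θ) ∂μ ≤ I.T * c +
      8192 * (1 + I.υ) ^ (1 / (1 + I.ε)) * Real.sqrt d
      * Real.log (2 * (I.T : ℝ) ^ 3 * (I.actions.card : ℝ)) ^ (I.ε / (1 + I.ε))
      * (I.T : ℝ) ^ (1 / (1 + I.ε)) + 4 := by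
  have hne : I.actions.Nonempty := ⟨b, hbI⟩
  have hT := hI.T_pos
  have hυ := hI.υ_pos
  -- A measurable hull has the same measure, so measurability of the accuracy event is not needed.
  set N := toMeasurable μ {ω | ¬ IsAccurate I S θ (fun i => (x i ω, y i ω))} with hN
  have hNm : MeasurableSet N := measurableSet_toMeasurable _ _
  have hNle : μ.real N ≤ 2 / I.T := by
    rw [Measure.real, hN, measure_toMeasurable]
    exact measureReal_not_isAccurate_le hI hS hne hθ1 hθ hR
  set K := 8192 * (1 + I.υ) ^ (1 / (1 + I.ε)) * Real.sqrt d
      * Real.log (2 * (I.T : ℝ) ^ 3 * (I.actions.card : ℝ)) ^ (I.ε / (1 + I.ε))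
      * (I.T : ℝ) ^ (1 / (1 + I.ε)) with hK
  have hK0 : 0 ≤ K := by
    have h1 : (1 : ℝ) ≤ I.actions.card := by exact_mod_cast hne.card_pos
    have h2 : (2 : ℝ) ≤ I.T := by exact_mod_cast hI.two_le_T
    have h3 := one_le_pow₀ (by linarith : (1 : ℝ) ≤ I.T) (n := 3)
    have : 0 ≤ Real.log (2 * (I.T : ℝ) ^ 3 * (I.actions.card : ℝ)) :=
      Real.log_nonneg (by nlinarith)
    positivity
  have hmem : ∀ᵐ ω ∂μ, ∀ t < I.T,
      x t ω ∈ (stateAt I S (fun s => (x s ω, y s ω)) t).active :=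
    ae_action_mem_active hS hne hR
  have hsplit : ∀ ω, ∑ t ∈ Finset.range I.T, (v - inner ℝ (x t ω) θ)
      = I.T * (v - inner ℝ b θ)
        + ∑ t ∈ Finset.range I.T, ((inner ℝ b θ : ℝ) - inner ℝ (x t ω) θ) := by
    intro ω
    rw [← nsmul_eq_mul, ← Finset.card_range I.T, ← Finset.sum_const, Finset.card_range,
      ← Finset.sum_add_distrib]
    exact Finset.sum_congr rfl fun t _ => by ring
  have hact : ∀ ω, (∀ t < I.T, x t ω ∈ (stateAt I S (fun s => (x s ω, y s ω)) t).active) →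
      ∀ t < I.T, x t ω ∈ I.actions := fun ω h t ht =>
    (stateAt_basic S hne (fun s => (x s ω, y s ω)) t).1 (h t ht)
  have hTc : I.T * (v - inner ℝ b θ) ≤ I.T * c :=
    mul_le_mul_of_nonneg_left (by linarith) hT.le
  have hle : ∀ᵐ ω ∂μ, ∑ t ∈ Finset.range I.T, (v - inner ℝ (x t ω) θ)
      ≤ (I.T * c + K) + N.indicator (fun _ => 2 * (I.T : ℝ)) ω := by
    filter_upwards [hmem] with ω hω
    rw [hsplit]
    by_cases hωN : ω ∈ N
    · rw [Set.indicator_of_mem hωN]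
      have : ∑ t ∈ Finset.range I.T, ((inner ℝ b θ : ℝ) - inner ℝ (x t ω) θ)
          ≤ ∑ t ∈ Finset.range I.T, (2 : ℝ) := Finset.sum_le_sum fun t ht => by
        have h1 := abs_le.1 (hθ _ (hact ω hω t (Finset.mem_range.1 ht)))
        have h2 := abs_le.1 (hθ b hbI)
        linarith
      rw [Finset.sum_const, Finset.card_range, nsmul_eq_mul] at this
      linarith
    · rw [Set.indicator_of_notMem hωN]
      have hacc : IsAccurate I S θ (fun i => (x i ω, y i ω)) := by
        by_contra h
        exact hωN (subset_toMeasurable _ _ h)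
      have := sum_gap_le_of_isAccurate hS hI hd hbI hb hθ hacc hω
      linarith
  -- Nonnegativity allows the integrals to be compared without integrability of the regret.
  have h0 : ∀ᵐ ω ∂μ, 0 ≤ ∑ t ∈ Finset.range I.T, (v - inner ℝ (x t ω) θ) := by
    filter_upwards [hmem] with ω hω
    refine Finset.sum_nonneg fun t ht => ?_
    have := hb _ (hact ω hω t (Finset.mem_range.1 ht))
    linarith
  have hint : Integrable (N.indicator fun _ => 2 * (I.T : ℝ)) μ :=
    (integrable_const _).indicator hNm
  refine (integral_mono_of_nonneg h0 ((integrable_const _).add hint) hle).trans ?_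
  have hcalc : ∫ ω, ((I.T * c + K) + N.indicator (fun _ => 2 * (I.T : ℝ)) ω) ∂μ
      = (I.T * c + K) + μ.real N * (2 * I.T) := by
    rw [integral_add (integrable_const _) hint, integral_const, integral_indicator_const _ hNm]
    simp
  refine (le_of_eq hcalc).trans ?_
  -- Failure probability 2/T times the largest possible total gap 2T: the additive 4.
  have : μ.real N * (2 * I.T) ≤ 2 / I.T * (2 * I.T) :=
    mul_le_mul_of_nonneg_right hNle (by positivity)
  have h4 : 2 / (I.T : ℝ) * (2 * I.T) = 4 := by field_simp; norm_num
  linarith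

/-- With a single arm there is no regret beyond that of the benchmark. -/
lemma integral_regret_le_of_card_eq_one (hS : S.IsValid I) (hR : IsRun μ I S θ x y) {b : Vec d}
    (hI1 : I.actions = {b}) (v : ℝ) :
    ∫ ω, ∑ t ∈ Finset.range I.T, (v - inner ℝ (x t ω) θ) ∂μ = I.T * (v - inner ℝ b θ) := by
  have hne : I.actions.Nonempty := hI1 ▸ Finset.singleton_nonempty b
  have hae : (fun ω => ∑ t ∈ Finset.range I.T, (v - inner ℝ (x t ω) θ))
      =ᵐ[μ] fun _ => I.T * (v - inner ℝ b θ) := by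
    filter_upwards [ae_action_mem_active hS hne hR] with ω hω
    rw [← nsmul_eq_mul, ← Finset.card_range I.T, ← Finset.sum_const, Finset.card_range]
    refine Finset.sum_congr rfl fun t ht => ?_
    have := (stateAt_basic S hne (fun s => (x s ω, y s ω)) t).1 (hω t (Finset.mem_range.1 ht))
    rw [hI1, Finset.mem_singleton] at this
    rw [this]
  rw [integral_congr_ae hae]
  simp

end Run

/-! ### ### The two regret bounds -/

lemma tunedInput_isTuned {d : ℕ} (A₀ : Finset (Vec d)) {ε υ : ℝ} {T : ℕ} (hε0 : 0 < ε)
    (hε1 : ε ≤ 1) (hυ : 0 < υ) (hT : 2 ≤ T) : (tunedInput A₀ ε υ T).IsTuned :=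
  ⟨hε0, hε1, hυ, hT, rfl, rfl⟩

lemma one_le_dim_of_one_lt_card {d : ℕ} {A : Finset (Vec d)} (h : 1 < A.card) : 1 ≤ d := by
  rcases Nat.eq_zero_or_pos d with rfl | hd
  · exact absurd (Finset.card_le_one.2 fun a _ b _ => Subsingleton.elim a b) (not_le.2 h)
  · exact hd

/-- Since 1/2 < log 2 < 1, powers of exponent at most 1 stay above log 2. This lets the main term
absorb additive constants. -/
lemma half_le_rpow_log {T : ℕ} (hT : 2 ≤ T) {α : ℝ} (h0 : 0 ≤ α) (h1 : α ≤ 1) :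
    1 / 2 ≤ Real.log T ^ α := by
  have hlog2 := Real.log_two_gt_d9
  have hlog2' := Real.log_two_lt_d9
  have hle : Real.log 2 ≤ Real.log T :=
    Real.log_le_log (by norm_num) (by exact_mod_cast hT)
  calc (1 / 2 : ℝ) ≤ Real.log 2 := by linarith
    _ = Real.log 2 ^ (1 : ℝ) := (Real.rpow_one _).symm
    _ ≤ Real.log 2 ^ α := Real.rpow_le_rpow_of_exponent_ge (by linarith) (by linarith) h1
    _ ≤ Real.log T ^ α := Real.rpow_le_rpow (by linarith) hle h0

lemma log_confidence_eq {T n : ℕ} (hT : 2 ≤ T) (hn : 1 ≤ n) :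
    Real.log (2 * (T : ℝ) ^ 3 * (n : ℝ)) = Real.log 2 + 3 * Real.log T + Real.log n := by
  have hT' : (0 : ℝ) < T := by exact_mod_cast (by omega : 0 < T)
  have hn' : (0 : ℝ) < n := by exact_mod_cast hn
  rw [Real.log_mul (by positivity) hn'.ne', Real.log_mul (by norm_num) (by positivity),
    Real.log_pow]
  norm_num

/-- Powers between zero and one do not increase constants above one. -/
lemma mul_rpow_le {c z α : ℝ} (hc : 1 ≤ c) (hz : 0 ≤ z) (h1 : α ≤ 1) :
    (c * z) ^ α ≤ c * z ^ α := by
  rw [Real.mul_rpow (by linarith) hz]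
  refine mul_le_mul_of_nonneg_right ?_ (by positivity)
  conv_rhs => rw [← Real.rpow_one c]
  exact Real.rpow_le_rpow_of_exponent_le hc h1

lemma exists_isMaxOn_inner {d : ℕ} {A : Finset (Vec d)} (hA : A.Nonempty) (θ : Vec d) :
    ∃ b ∈ A, ∀ a ∈ A, (inner ℝ a θ : ℝ) ≤ inner ℝ b θ :=
  A.exists_max_image _ hA

section Regret

variable {d T : ℕ} {ε υ : ℝ} {Ω : Type*} [MeasurableSpace Ω] {μ : Measure Ω}
  [IsProbabilityMeasure μ] {θ : Vec d} {x : ℕ → Ω → Vec d} {y : ℕ → Ω → ℝ}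

theorem regret_le_of_isRewardCover {κ : ℕ} (hT : 2 ≤ T) (hε0 : 0 < ε) (hε1 : ε ≤ 1)
    (hυ : 0 < υ) {A : Set (Vec d)} {A₀ : Finset (Vec d)} (hA : A.Nonempty)
    (hcov : IsRewardCover A T κ A₀) {S : Selection d} (hS : S.IsValid (tunedInput A₀ ε υ T))
    (hθ : Admissible A θ) (hR : IsRun μ (tunedInput A₀ ε υ T) S θ x y) :
    regret μ A θ T x ≤ (8192 * (4 + κ) + 10) * (1 + υ) ^ (1 / (1 + ε))
      * (Real.log T) ^ (ε / (1 + ε)) * (d : ℝ) ^ ((1 + 3 * ε) / (2 * (1 + ε)))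
      * (T : ℝ) ^ (1 / (1 + ε)) := by
  have hT' : (2 : ℝ) ≤ T := by exact_mod_cast hT
  have hlog2 := Real.log_two_gt_d9
  have hlogT : Real.log 2 ≤ Real.log T := Real.log_le_log (by norm_num) hT'
  rcases Nat.eq_zero_or_pos d with rfl | hd
  -- In dimension zero all rewards vanish, so the regret is zero.
  · have h0 : ∀ z : Vec 0, (inner ℝ z θ : ℝ) = 0 := fun z => by
      rw [Subsingleton.elim z 0, inner_zero_left]
    have hnn : 0 ≤ (8192 * (4 + (κ : ℝ)) + 10) * (1 + υ) ^ (1 / (1 + ε))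
      * (Real.log T) ^ (ε / (1 + ε)) * ((0 : ℕ) : ℝ) ^ ((1 + 3 * ε) / (2 * (1 + ε)))
      * (T : ℝ) ^ (1 / (1 + ε)) := by
      have : 0 ≤ Real.log T := by linarith
      positivity
    refine le_trans (le_of_eq ?_) hnn
    simp [regret, h0, hA.image_const]
  set α := ε / (1 + ε) with hα
  have hα0 : 0 ≤ α := by positivity
  have hα1 : α ≤ 1 := by rw [hα, div_le_one (by positivity)]; linarith
  have hd' : (1 : ℝ) ≤ d := by exact_mod_cast hd
  obtain ⟨hsub, hcard, happ⟩ := hcov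
  have hne : A₀.Nonempty := by
    obtain ⟨z, hz⟩ := hA
    obtain ⟨a, ha, -⟩ := happ z hz
    exact ⟨a, ha⟩
  obtain ⟨b, hb, hmax⟩ := exists_isMaxOn_inner hne θ
  have hθ0 : ∀ a ∈ A₀, |(inner ℝ a θ : ℝ)| ≤ 1 := fun a ha => hθ.2 a (hsub a ha)
  have hbdd : BddAbove ((fun a => (inner ℝ a θ : ℝ)) '' A) := by
    refine ⟨1, ?_⟩
    rintro _ ⟨a, ha, rfl⟩
    exact (abs_le.1 (hθ.2 a ha)).2
  have hv : inner ℝ b θ ≤ sSup ((fun a => (inner ℝ a θ : ℝ)) '' A) :=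
    le_csSup hbdd ⟨b, hsub b hb, rfl⟩
  have hvc : sSup ((fun a => (inner ℝ a θ : ℝ)) '' A) ≤ inner ℝ b θ + 1 / T := by
    refine csSup_le (hA.image _) ?_
    rintro _ ⟨z, hz, rfl⟩
    obtain ⟨a, ha, h⟩ := happ z hz
    have h1 := (abs_le.1 (h θ hθ)).2
    have h2 := hmax a ha
    simp only
    linarith
  have hI := tunedInput_isTuned A₀ hε0 hε1 hυ hT
  have hreg := integral_regret_le hI hS hd hθ.1 hθ0 hR hb hmax hv hvc
  have hn : (1 : ℝ) ≤ A₀.card := by exact_mod_cast hne.card_pos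
  have hlogn : Real.log A₀.card ≤ κ * d * Real.log T := by
    calc Real.log A₀.card ≤ Real.log ((T : ℝ) ^ (κ * d)) :=
          Real.log_le_log (by linarith) (by exact_mod_cast hcard)
      _ = κ * d * Real.log T := by rw [Real.log_pow]; push_cast; ring
  have hΛ : Real.log (2 * (T : ℝ) ^ 3 * (A₀.card : ℝ)) ≤ (4 + κ) * (d * Real.log T) := by
    rw [log_confidence_eq hT hne.card_pos]
    have : Real.log T ≤ d * Real.log T := le_mul_of_one_le_left (by linarith) hd'
    linarith
  have hΛ0 : 0 ≤ Real.log (2 * (T : ℝ) ^ 3 * (A₀.card : ℝ)) := by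
    rw [log_confidence_eq hT hne.card_pos]
    linarith [Real.log_nonneg hn]
  have hlog0 : 0 ≤ Real.log T := by linarith
  have hΛα : Real.log (2 * (T : ℝ) ^ 3 * (A₀.card : ℝ)) ^ α
      ≤ (4 + κ) * ((d : ℝ) ^ α * Real.log T ^ α) := by
    rw [← Real.mul_rpow (by positivity) hlog0]
    exact (Real.rpow_le_rpow hΛ0 hΛ hα0).trans
      (mul_rpow_le (by linarith [Nat.cast_nonneg (α := ℝ) κ]) (by positivity) hα1)
  -- The exponent of the dimension is 1/2 from the design plus ε/(1+ε) from the logarithm of the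
  -- size of the cover.
  have hdim : Real.sqrt d * (d : ℝ) ^ α = (d : ℝ) ^ ((1 + 3 * ε) / (2 * (1 + ε))) := by
    rw [Real.sqrt_eq_rpow, ← Real.rpow_add (by linarith)]
    congr 1
    rw [hα]; field_simp; ring
  have hp1 : 1 ≤ (1 + υ) ^ (1 / (1 + ε)) := Real.one_le_rpow (by linarith) (by positivity)
  have hp2 : 1 ≤ (T : ℝ) ^ (1 / (1 + ε)) := Real.one_le_rpow (by linarith) (by positivity)
  have hp3 : 1 ≤ (d : ℝ) ^ ((1 + 3 * ε) / (2 * (1 + ε))) := Real.one_le_rpow hd' (by positivity)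
  have hp4 := half_le_rpow_log hT hα0 hα1
  have hR1 : regret μ A θ T x ≤ 1 + 8192 * (1 + υ) ^ (1 / (1 + ε)) * Real.sqrt d
      * Real.log (2 * (T : ℝ) ^ 3 * (A₀.card : ℝ)) ^ α * (T : ℝ) ^ (1 / (1 + ε)) + 4 := by
    refine hreg.trans (le_of_eq ?_)
    have : (T : ℝ) * (1 / T) = 1 := mul_one_div_cancel (by linarith)
    simp only [tunedInput, this, hα]
  -- The additive 5 = 1 + 4, from the cover and the failure event, is at most 10 times this product.
  have hbig : 1 / 2 ≤ (1 + υ) ^ (1 / (1 + ε)) * Real.log T ^ α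
      * (d : ℝ) ^ ((1 + 3 * ε) / (2 * (1 + ε))) * (T : ℝ) ^ (1 / (1 + ε)) := by
    have h1 : 1 / 2 ≤ (1 + υ) ^ (1 / (1 + ε)) * Real.log T ^ α :=
      hp4.trans (le_mul_of_one_le_left (by positivity) hp1)
    exact h1.trans ((le_mul_of_one_le_right (by positivity) hp3).trans
      (le_mul_of_one_le_right (by positivity) hp2))
  calc regret μ A θ T x ≤ _ := hR1
    _ ≤ 1 + 8192 * (1 + υ) ^ (1 / (1 + ε)) * Real.sqrt d
      * ((4 + κ) * ((d : ℝ) ^ α * Real.log T ^ α)) * (T : ℝ) ^ (1 / (1 + ε)) + 4 := by gcongr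
    _ = 8192 * (4 + κ) * ((1 + υ) ^ (1 / (1 + ε)) * Real.log T ^ α
      * (d : ℝ) ^ ((1 + 3 * ε) / (2 * (1 + ε))) * (T : ℝ) ^ (1 / (1 + ε))) + 5 := by
        rw [← hdim]; ring
    _ ≤ _ := by linarith

theorem regret_le_of_finset (hT : 2 ≤ T) (hε0 : 0 < ε) (hε1 : ε ≤ 1) (hυ : 0 < υ)
    {A : Finset (Vec d)} (hA : A.Nonempty) {S : Selection d}
    (hS : S.IsValid (tunedInput A ε υ T)) (hθ : Admissible (A : Set (Vec d)) θ)
    (hR : IsRun μ (tunedInput A ε υ T) S θ x y) :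
    regret μ (A : Set (Vec d)) θ T x ≤ 65552 * (1 + υ) ^ (1 / (1 + ε))
      * (Real.log T) ^ (ε / (1 + ε)) * Real.sqrt d * (Real.log A.card) ^ (ε / (1 + ε))
      * (T : ℝ) ^ (1 / (1 + ε)) := by
  have hT' : (2 : ℝ) ≤ T := by exact_mod_cast hT
  have hlog2 := Real.log_two_gt_d9
  have hlogT : Real.log 2 ≤ Real.log T := Real.log_le_log (by norm_num) hT'
  obtain ⟨b, hb, hmax⟩ := exists_isMaxOn_inner hA θ
  have hsup : sSup ((fun a => (inner ℝ a θ : ℝ)) '' (A : Set (Vec d))) = inner ℝ b θ := by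
    refine IsGreatest.csSup_eq ⟨⟨b, hb, rfl⟩, ?_⟩
    rintro _ ⟨a, ha, rfl⟩
    exact hmax a ha
  set α := ε / (1 + ε) with hα
  have hα0 : 0 ≤ α := by positivity
  have hα1 : α ≤ 1 := by rw [hα, div_le_one (by positivity)]; linarith
  have hlog0 : 0 ≤ Real.log T := by linarith
  have hn1 : (1 : ℝ) ≤ A.card := by exact_mod_cast hA.card_pos
  have hlogn0 := Real.log_nonneg hn1
  rcases Nat.lt_or_ge 1 A.card with hc | hc
  swap
  -- For a single arm the factor log 1 = 0 makes the bound zero, so no additive constant is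
  -- affordable and the regret must vanish exactly.
  · obtain ⟨b', hb'⟩ := Finset.card_eq_one.1 (le_antisymm hc hA.card_pos)
    have hbb : b = b' := by simpa [hb'] using hb
    have h0 := integral_regret_le_of_card_eq_one hS hR (I := tunedInput A ε υ T) (b := b)
      (hb'.trans (by rw [hbb])) (inner ℝ b θ)
    rw [sub_self, mul_zero] at h0
    have hreg : regret μ (A : Set (Vec d)) θ T x = 0 := by
      rw [regret, hsup]
      exact h0
    rw [hreg]
    positivity
  have hd := one_le_dim_of_one_lt_card hc
  have hd' : (1 : ℝ) ≤ d := by exact_mod_cast hd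
  have hI := tunedInput_isTuned A hε0 hε1 hυ hT
  have hreg := integral_regret_le hI hS hd hθ.1 hθ.2 hR hb hmax (le_refl _)
    (le_of_eq (add_zero _).symm)
  have hlogn : Real.log 2 ≤ Real.log A.card :=
    Real.log_le_log (by norm_num) (by exact_mod_cast hc)
  -- Both logarithms are at least log 2, so the sum log 2 + 3 log T + log n is dominated by 8 times
  -- the product log T · log n.
  have hΛ : Real.log (2 * (T : ℝ) ^ 3 * (A.card : ℝ))
      ≤ 8 * (Real.log T * Real.log A.card) := by
    rw [log_confidence_eq hT hA.card_pos]
    nlinarith [mul_nonneg (sub_nonneg.2 hlogT) (sub_nonneg.2 hlogn)]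
  have hΛ0 : 0 ≤ Real.log (2 * (T : ℝ) ^ 3 * (A.card : ℝ)) := by
    rw [log_confidence_eq hT hA.card_pos]
    linarith
  have hΛα : Real.log (2 * (T : ℝ) ^ 3 * (A.card : ℝ)) ^ α
      ≤ 8 * (Real.log T ^ α * Real.log A.card ^ α) := by
    rw [← Real.mul_rpow hlog0 hlogn0]
    exact (Real.rpow_le_rpow hΛ0 hΛ hα0).trans
      (mul_rpow_le (by norm_num) (by positivity) hα1)
  have hp1 : 1 ≤ (1 + υ) ^ (1 / (1 + ε)) := Real.one_le_rpow (by linarith) (by positivity)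
  have hp2 : 1 ≤ (T : ℝ) ^ (1 / (1 + ε)) := Real.one_le_rpow (by linarith) (by positivity)
  have hp3 : 1 ≤ Real.sqrt d := Real.one_le_sqrt.2 hd'
  have hp4 := half_le_rpow_log hT hα0 hα1
  have hp5 := half_le_rpow_log hc hα0 hα1
  have hR1 : regret μ (A : Set (Vec d)) θ T x ≤ 8192 * (1 + υ) ^ (1 / (1 + ε)) * Real.sqrt d
      * Real.log (2 * (T : ℝ) ^ 3 * (A.card : ℝ)) ^ α * (T : ℝ) ^ (1 / (1 + ε)) + 4 := by
    rw [regret, hsup]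
    refine hreg.trans (le_of_eq ?_)
    simp only [tunedInput, mul_zero, zero_add, hα]
  -- Two factors are at least 1/2 and the others at least 1, so the additive 4 costs 16, and 65552 =
  -- 8·8192 + 16.
  have hbig : 1 / 4 ≤ (1 + υ) ^ (1 / (1 + ε)) * Real.log T ^ α * Real.sqrt d
      * Real.log A.card ^ α * (T : ℝ) ^ (1 / (1 + ε)) := by
    have h1 : 1 / 2 ≤ (1 + υ) ^ (1 / (1 + ε)) * Real.log T ^ α :=
      hp4.trans (le_mul_of_one_le_left (by positivity) hp1)
    have h2 := h1.trans (le_mul_of_one_le_right (by positivity) hp3)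
    have h3 := mul_le_mul h2 hp5 (by norm_num) (by positivity)
    have h4 := h3.trans (le_mul_of_one_le_right (by positivity) hp2)
    linarith
  calc regret μ (A : Set (Vec d)) θ T x ≤ _ := hR1
    _ ≤ 8192 * (1 + υ) ^ (1 / (1 + ε)) * Real.sqrt d
      * (8 * (Real.log T ^ α * Real.log A.card ^ α)) * (T : ℝ) ^ (1 / (1 + ε)) + 4 := by gcongr
    _ = 65536 * ((1 + υ) ^ (1 / (1 + ε)) * Real.log T ^ α * Real.sqrt d
      * Real.log A.card ^ α * (T : ℝ) ^ (1 / (1 + ε))) + 4 := by ring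
    _ ≤ _ := by linarith

end Regret

end HeavyTailBandit

theorem mainTheorem2 :
    -- finite sets of small size which represent an arbitrary action set exist
    (∃ κ : ℕ, ∀ (d T : ℕ) (A : Set (HeavyTailBandit.Vec d)), 2 ≤ T → A.Nonempty →
      ∃ A₀ : Finset (HeavyTailBandit.Vec d), HeavyTailBandit.IsRewardCover A T κ A₀) ∧
    -- arbitrary action sets
    (∀ κ : ℕ, ∃ C : ℝ, 0 < C ∧
      ∀ (d T : ℕ) (ε υ : ℝ), 2 ≤ T → 0 < ε → ε ≤ 1 → 0 < υ →
      ∀ (A : Set (HeavyTailBandit.Vec d)) (A₀ : Finset (HeavyTailBandit.Vec d)),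
        A.Nonempty → HeavyTailBandit.IsRewardCover A T κ A₀ →
      ∀ S : HeavyTailBandit.Selection d, S.IsValid (HeavyTailBandit.tunedInput A₀ ε υ T) →
      ∀ (Ω : Type*) [MeasurableSpace Ω] (μ : Measure Ω) [IsProbabilityMeasure μ]
        (θ : HeavyTailBandit.Vec d) (x : ℕ → Ω → HeavyTailBandit.Vec d) (y : ℕ → Ω → ℝ),
        HeavyTailBandit.Admissible A θ →
        HeavyTailBandit.IsRun μ (HeavyTailBandit.tunedInput A₀ ε υ T) S θ x y →
        HeavyTailBandit.regret μ A θ T x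
          ≤ C * (1 + υ) ^ (1 / (1 + ε)) * (Real.log T) ^ (ε / (1 + ε))
            * (d : ℝ) ^ ((1 + 3 * ε) / (2 * (1 + ε))) * (T : ℝ) ^ (1 / (1 + ε))) ∧
    -- finite action sets
    (∃ C : ℝ, 0 < C ∧
      ∀ (d T : ℕ) (ε υ : ℝ), 2 ≤ T → 0 < ε → ε ≤ 1 → 0 < υ →
      ∀ A : Finset (HeavyTailBandit.Vec d), A.Nonempty →
      ∀ S : HeavyTailBandit.Selection d, S.IsValid (HeavyTailBandit.tunedInput A ε υ T) →
      ∀ (Ω : Type*) [MeasurableSpace Ω] (μ : Measure Ω) [IsProbabilityMeasure μ]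
        (θ : HeavyTailBandit.Vec d) (x : ℕ → Ω → HeavyTailBandit.Vec d) (y : ℕ → Ω → ℝ),
        HeavyTailBandit.Admissible (A : Set (HeavyTailBandit.Vec d)) θ →
        HeavyTailBandit.IsRun μ (HeavyTailBandit.tunedInput A ε υ T) S θ x y →
        HeavyTailBandit.regret μ (A : Set (HeavyTailBandit.Vec d)) θ T x
          ≤ C * (1 + υ) ^ (1 / (1 + ε)) * (Real.log T) ^ (ε / (1 + ε))
            * Real.sqrt d * (Real.log A.card) ^ (ε / (1 + ε)) * (T : ℝ) ^ (1 / (1 + ε))) := by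
  refine ⟨⟨3, fun d T A hT _ => HeavyTailBandit.exists_isRewardCover hT A⟩, fun κ => ?_, ?_⟩
  · refine ⟨8192 * (4 + κ) + 10, by positivity, ?_⟩
    intro d T ε υ hT hε0 hε1 hυ A A₀ hA hcov S hS Ω _ μ _ θ x y hθ hR
    exact HeavyTailBandit.regret_le_of_isRewardCover hT hε0 hε1 hυ hA hcov hS hθ hR
  · refine ⟨65552, by norm_num, ?_⟩
    intro d T ε υ hT hε0 hε1 hυ A hA S hS Ω _ μ _ θ x y hθ hR
    exact HeavyTailBandit.regret_le_of_finset hT hε0 hε1 hυ hA hS hθ hR
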